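/- Let $N\ge 2$, $1<p<\infty$, $0<s<1$, let $\Omega\subset\mathbb R^N$ be a bounded $C^1$ domain, and let $H:\mathbb R^N\to[0,\infty)$ be a Finsler--Minkowski norm: $H$ is convex with strictly convex unit ball $\{H\le 1\}$, $H\in C^1(\mathbb R^N\setminus\{0\})$, $H(x)=0$ iff $x=0$, $H(tx)=|t|H(x)$ for all $t\in\mathbb R$ and $x\in\mathbb R^N$, and $C_1|x|\le H(x)\le C_2|x|$ for some constants $C_1,C_2>0$. Put $d\mu=|x-y|^{-N-ps}\,dx\,dy$, $H_pu=\operatorname{div}(H(\nabla u)^{p-1}\nabla H(\nabla u))$, and let $(-\Delta_p)^s$ be the fractional $p$-Laplacian, $(-\Delta_p)^su(x)=\mathrm{P.V.}\int_{\mathbb R^N}\frac{|u(x)-u(y)|^{p-2}(u(x)-u(y))}{|x-y|^{N+ps}}\,dy$. Put $W_0^{1,p}(\Omega)=\{u\in W^{1,p}(\mathbb R^N): u=0 \text{ a.e. in }\mathbb R^N\setminus\Omega\}$. Assume that $f:\Omega\times[0,\infty)\to\mathbb R$ satisfies: (f1) $f$ is a Carathéodory function; (f2) $f(\cdot,t)\in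 L^\infty(\Omega)$ for every $t\ge 0$; (f3) there is $c_p>0$ with $|f(x,t)|\le c_p(1+t^{p-1})$ for a.e. $x\in\Omega$ and every $t\ge0$; (f4) for a.e. $x\in\Omega$ the function $t\mapsto f(x,t)/t^{p-1}$ is strictly decreasing in $(0,\infty)$; (f5) there is $\rho_f>0$ such that $f(x,t)>0$ for a.e. $x\in\Omega$ and every $0<t<\rho_f$. For a.e. $x\in\Omega$ let $a_0(x)=\lim_{t\to0^+}f(x,t)/t^{p-1}\in(0,+\infty]$ and $a_\infty(x)=\lim_{t\to+\infty}f(x,t)/t^{p-1}\in\mathbb R$; for $a\in\{a_0,a_\infty\}$ define $$\beta_1\big(-H_p+(-\Delta_p)^s-a\big)=\inf\Big\{\int_\Omega H(\nabla u)^p\,dx+\iint_{\mathbb R^{2N}}|u(x)-u(y)|^p\,d\mu-\int_{\{x\in\Omega:\,u(x)\ne0\}}a|u|^p\,dx\Big\}\in[-\infty,\infty),$$ the infimum being over all $u\in W_0^{1,p}(\Omega)$ with $\|u\|_{L^p(\Omega)}=1$ (the last integral may be $+\infty$ for $a=a_0$). A weak solution of the problem $$-H_pu+(-\Delta_p)^su=f(x,u)\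 \text{in }\Omega,\qquad u\gneqq0\ \text{in }\Omega,\qquad u=0\ \text{in }\mathbb R^N\setminus\Omega \tag{P}$$ is a function $u\in W_0^{1,p}(\Omega)$ with $u\ge0$ a.e. in $\Omega$ and $|\{x\in\Omega:u(x)>0\}|>0$ such that for every $\phi\in W_0^{1,p}(\Omega)$ $$\int_\Omega H(\nabla u)^{p-1}\nabla H(\nabla u)\cdot\nabla\phi\,dx+\iint_{\mathbb R^{2N}}|u(x)-u(y)|^{p-2}(u(x)-u(y))(\phi(x)-\phi(y))\,d\mu=\int_\Omega f(x,u)\phi\,dx .$$ Then (P) has a weak solution $u$ with $u>0$ a.e. in $\Omega$ if and only if $$\beta_1\big(-H_p+(-\Delta_p)^s-a_0\big)<0<\beta_1\big(-H_p+(-\Delta_p)^s-a_\infty\big).$$ -/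

import Mathlib

open MeasureTheory Set Filter Topology
open scoped ENNReal ContDiff

namespace MixedBO

noncomputable section

/-- A Finsler-Minkowski norm on `ℝ^N`. Since a positively homogeneous function is linear on rays,
strict convexity of `H` is, as always for norms, strict convexity of the unit ball. -/
structure IsFinslerMinkowskiNorm {N : ℕ} (H : EuclideanSpace ℝ (Fin N) → ℝ) : Prop where
  nonneg : ∀ x, 0 ≤ H x
  convexOn : ConvexOn ℝ univ H
  strictConvex : StrictConvex ℝ {x | H x ≤ 1}
  contDiffOn : ContDiffOn ℝ 1 H {0}ᶜ
  eq_zero_iff : ∀ x, H x = 0 ↔ x = 0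
  homogeneous : ∀ (t : ℝ) (x : EuclideanSpace ℝ (Fin N)), H (t • x) = |t| * H x
  equivalent : ∃ C₁ C₂ : ℝ, 0 < C₁ ∧ 0 < C₂ ∧ ∀ x, C₁ * ‖x‖ ≤ H x ∧ H x ≤ C₂ * ‖x‖

/-- A bounded `C¹` domain: a bounded connected open set which near each of its boundary points is
the region above the graph, in some direction `ν`, of a `C¹` function on the hyperplane `ν^⊥`. -/
structure IsBoundedC1Domain {N : ℕ} (Ω : Set (EuclideanSpace ℝ (Fin N))) : Prop where
  isOpen : IsOpen Ω
  isConnected : IsConnected Ω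
  isBounded : Bornology.IsBounded Ω
  boundary : ∀ x₀ ∈ frontier Ω, ∃ (r : ℝ) (ν : EuclideanSpace ℝ (Fin N))
    (γ : (Submodule.span ℝ {ν})ᗮ → ℝ), 0 < r ∧ ‖ν‖ = 1 ∧ ContDiff ℝ 1 γ ∧
      Ω ∩ Metric.ball x₀ r =
        {x ∈ Metric.ball x₀ r | γ ((Submodule.span ℝ {ν})ᗮ.orthogonalProjectionOnto x) < inner ℝ ν x}

/-- `G` is a weak gradient of `u` on `ℝ^N`. -/
def IsWeakGradient {N : ℕ} (u : EuclideanSpace ℝ (Fin N) → ℝ)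
    (G : EuclideanSpace ℝ (Fin N) → EuclideanSpace ℝ (Fin N)) : Prop :=
  LocallyIntegrable u ∧ LocallyIntegrable G ∧
    ∀ φ : EuclideanSpace ℝ (Fin N) → ℝ, ContDiff ℝ ∞ φ → HasCompactSupport φ →
      ∀ v : EuclideanSpace ℝ (Fin N),
        ∫ x, u x * fderiv ℝ φ x v = -∫ x, inner ℝ (G x) v * φ x

open Classical in
/-- The weak gradient of `u` on `ℝ^N` (determined almost everywhere when it exists; set to `0`
otherwise). -/
def weakGradient {N : ℕ} (u : EuclideanSpace ℝ (Fin N) → ℝ) :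
    EuclideanSpace ℝ (Fin N) → EuclideanSpace ℝ (Fin N) :=
  if h : ∃ G, IsWeakGradient u G then h.choose else 0

/-- Membership in the Sobolev space `W^{1,p}(ℝ^N)`. -/
def MemW1p {N : ℕ} (p : ℝ) (u : EuclideanSpace ℝ (Fin N) → ℝ) : Prop :=
  MemLp u (ENNReal.ofReal p) volume ∧
    ∃ G, IsWeakGradient u G ∧ MemLp G (ENNReal.ofReal p) volume

/-- The space `W₀^{1,p}(Ω)` of the functions in `W^{1,p}(ℝ^N)` that vanish outside `Ω`. -/
def MemW01p {N : ℕ} (Ω : Set (EuclideanSpace ℝ (Fin N))) (p : ℝ)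
    (u : EuclideanSpace ℝ (Fin N) → ℝ) : Prop :=
  MemW1p p u ∧ ∀ᵐ x, x ∉ Ω → u x = 0

/-- The kernel `|x - y|^{-N-ps}`. -/
def kernel (N : ℕ) (p s : ℝ) (z : EuclideanSpace ℝ (Fin N) × EuclideanSpace ℝ (Fin N)) : ℝ :=
  ‖z.1 - z.2‖ ^ (-(N : ℝ) - p * s)

/-- The weak form of `-H_p u + (-Δ_p)^s u` tested with `φ`. Both integrals converge absolutely for
`u, φ` in `W₀^{1,p}(Ω)`. At points where `∇u = 0` the factor `H(∇u)^{p-1}` vanishes. -/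
def weakForm {N : ℕ} (Ω : Set (EuclideanSpace ℝ (Fin N))) (H : EuclideanSpace ℝ (Fin N) → ℝ)
    (p s : ℝ) (u φ : EuclideanSpace ℝ (Fin N) → ℝ) : ℝ :=
  (∫ x in Ω, H (weakGradient u x) ^ (p - 1) *
      inner ℝ (gradient H (weakGradient u x)) (weakGradient φ x)) +
    ∫ z : EuclideanSpace ℝ (Fin N) × EuclideanSpace ℝ (Fin N),
      |u z.1 - u z.2| ^ (p - 2) * (u z.1 - u z.2) * (φ z.1 - φ z.2) * kernel N p s z

/-- `∫_Ω H(∇u)^p dx + ∬ |u(x) - u(y)|^p |x - y|^{-N-ps} dx dy`, which is finite for `u` in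
`W₀^{1,p}(Ω)`. -/
def energy {N : ℕ} (Ω : Set (EuclideanSpace ℝ (Fin N))) (H : EuclideanSpace ℝ (Fin N) → ℝ)
    (p s : ℝ) (u : EuclideanSpace ℝ (Fin N) → ℝ) : ℝ :=
  (∫ x in Ω, H (weakGradient u x) ^ p) +
    ∫ z : EuclideanSpace ℝ (Fin N) × EuclideanSpace ℝ (Fin N),
      |u z.1 - u z.2| ^ p * kernel N p s z

/-- The structure hypotheses on the nonlinearity `f : Ω × [0,∞) → ℝ`; only the values `f x t` with
`x ∈ Ω` and `t ≥ 0` play a role. -/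
structure IsBrezisOswald {N : ℕ} (Ω : Set (EuclideanSpace ℝ (Fin N))) (p : ℝ)
    (f : EuclideanSpace ℝ (Fin N) → ℝ → ℝ) : Prop where
  measurable : ∀ t, 0 ≤ t → AEStronglyMeasurable (fun x => f x t) (volume.restrict Ω)
  continuous : ∀ᵐ x ∂volume.restrict Ω, ContinuousOn (f x) (Ici 0)
  bounded : ∀ t, 0 ≤ t → MemLp (fun x => f x t) ⊤ (volume.restrict Ω)
  growth : ∃ c : ℝ, 0 < c ∧
    ∀ᵐ x ∂volume.restrict Ω, ∀ t, 0 ≤ t → |f x t| ≤ c * (1 + t ^ (p - 1))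
  strictAnti : ∀ᵐ x ∂volume.restrict Ω, StrictAntiOn (fun t => f x t / t ^ (p - 1)) (Ioi 0)
  pos : ∃ ρ : ℝ, 0 < ρ ∧ ∀ᵐ x ∂volume.restrict Ω, ∀ t, 0 < t → t < ρ → 0 < f x t

/-- `u ∈ W₀^{1,p}(Ω)` is a weak solution of `-H_p u + (-Δ_p)^s u = f(x,u)` in `Ω`, `u ⪈ 0` in `Ω`,
`u = 0` outside `Ω`. -/
structure IsWeakSolution {N : ℕ} (Ω : Set (EuclideanSpace ℝ (Fin N)))
    (H : EuclideanSpace ℝ (Fin N) → ℝ) (p s : ℝ) (f : EuclideanSpace ℝ (Fin N) → ℝ → ℝ)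
    (u : EuclideanSpace ℝ (Fin N) → ℝ) : Prop where
  mem : MemW01p Ω p u
  nonneg : ∀ᵐ x ∂volume.restrict Ω, 0 ≤ u x
  nontrivial : 0 < volume {x ∈ Ω | 0 < u x}
  eqn : ∀ φ, MemW01p Ω p φ → weakForm Ω H p s u φ = ∫ x in Ω, f x (u x) * φ x

/-- `a₀(x) = lim_{t → 0⁺} f(x,t) / t^{p-1}`, a limit in the extended reals. -/
def aZero {N : ℕ} (p : ℝ) (f : EuclideanSpace ℝ (Fin N) → ℝ → ℝ) (x : EuclideanSpace ℝ (Fin N)) :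
    EReal :=
  limUnder (𝓝[>] (0 : ℝ)) fun t => ((f x t / t ^ (p - 1) : ℝ) : EReal)

/-- `a_∞(x) = lim_{t → ∞} f(x,t) / t^{p-1}`, a limit in the extended reals. -/
def aInfty {N : ℕ} (p : ℝ) (f : EuclideanSpace ℝ (Fin N) → ℝ → ℝ) (x : EuclideanSpace ℝ (Fin N)) :
    EReal :=
  limUnder atTop fun t : ℝ => ((f x t / t ^ (p - 1) : ℝ) : EReal)

/-- The integral over `S` of an extended real valued function, as the difference of the integrals
of its positive and negative parts; it is used where at most one of the two is infinite. -/
def erealIntegral {N : ℕ} (S : Set (EuclideanSpace ℝ (Fin N)))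
    (g : EuclideanSpace ℝ (Fin N) → EReal) : EReal :=
  ((∫⁻ x in S, (g x).toENNReal : ℝ≥0∞) : EReal) - ((∫⁻ x in S, (-g x).toENNReal : ℝ≥0∞) : EReal)

/-- `β₁(-H_p + (-Δ_p)^s - a)`: the infimum in `[-∞, ∞]`, over the `u ∈ W₀^{1,p}(Ω)` with
`‖u‖_{L^p(Ω)} = 1`, of the energy of `u` minus `∫_{u ≠ 0} a |u|^p`. -/
def betaOne {N : ℕ} (Ω : Set (EuclideanSpace ℝ (Fin N))) (H : EuclideanSpace ℝ (Fin N) → ℝ)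
    (p s : ℝ) (a : EuclideanSpace ℝ (Fin N) → EReal) : EReal :=
  ⨅ u ∈ {u : EuclideanSpace ℝ (Fin N) → ℝ |
      MemW01p Ω p u ∧ eLpNorm u (ENNReal.ofReal p) (volume.restrict Ω) = 1},
    ((energy Ω H p s u : ℝ) : EReal) -
      erealIntegral {x ∈ Ω | u x ≠ 0} fun x => a x * ((|u x| ^ p : ℝ) : EReal)

end

end MixedBO

/-!
The two conditions on `β₁` are linked to the equation by the monotonicity of `f(x,t)/t^{p-1}`, whose
values lie strictly between `a_∞` and `a₀`.

*Necessity.* Testing the equation with the solution `u` shows that the energy of `u` is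
`∫ f(x,u) u`, which is strictly below `∫ a₀ u^p`; this makes the first infimum negative
(`IsWeakSolution.betaOne_aZero_neg`). For the second, let `v` be any function of the unit sphere of
`L^p`. Picone's inequality for the mixed operator (`weakForm_quot_add_le`) with test functions
approximating `|v|^p u^{1-p}` gives `∫ (f(x,u)/u^{p-1}) |v|^p ≤ energy v`, hence
`∫ a_∞ |v|^p < energy v`. Compactness of sublevel sets turns the strict inequality into a uniform gap
(`exists_gap`), which is the positivity of the infimum (`IsWeakSolution.betaOne_aInfty_pos`).

*Existence.* The solution minimizes `action u = energy u / p - ∫ F(x,u)`, where `F` is the primitive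
of `f`. Positivity of `β₁` for `a_∞`, again with a uniform gap, makes the functional coercive on
nonnegative functions (`exists_coercive`). Negative functions can be discarded, because neither term
increases when `u` is replaced by its positive part, and the direct method applies
(`exists_minimizer`, `weakForm_eq_of_minimizer`). Negativity of `β₁` for `a₀` provides a small multiple
of some function at which the functional is negative (`exists_action_neg`), so that the minimizer is
not zero.

*Positivity.* The minimizer is positive almost everywhere because of the nonlocal term
(`ae_pos_of_supersolution`), with no regularity theory. In Picone's inequality for the test functions
`|w|^p (u + ε)^{1-p}`, with `w` a truncation of a fixed `v` positive in `Ω`, the integral of the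
nonlocal defect stays bounded as `ε → 0`. At pairs `(x, y)` with `u(x) = 0 < u(y)` the defect tends to
`∞`, so such pairs form a null set of the product, and one of its two factors `{u = 0}` and `{u > 0}`
is null in `Ω`.

*Sobolev functions.* The tools above rest on three facts about functions with a weak gradient in
`L^p`. Difference quotients converge in `L^p` to weak derivatives, which gives the chain rule for
Lipschitz functions of two Sobolev functions (`HasWeakDeriv.comp_lipschitz`): it covers `|u|`, positive
parts, and the Picone test functions, and it shows that the gradient vanishes on the zero set. The
fractional seminorm controls the distance in `L^p` of a function from its averages over small balls,
so bounded sequences are precompact in `L^p` (`exists_subseq_cauchy`). Finally, the limit of a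
sequence of bounded energy has a gradient in `L^p`, and the energy is lower semicontinuous
(`memW01p_and_energy_le_of_tendsto`): in place of weak compactness, among the functions close to the
limit with almost minimal energy one takes near minimizers of the strictly convex functional
`∫ √(1 + |∇w|²)`, whose gradients converge in `L^1`. Both facts are combined in
`exists_subseq_energy_compact`.
-/

namespace MixedBO

noncomputable section

set_option linter.unusedSectionVars false

/-! ### Weak directional derivatives -/

section WeakDerivative

variable {E : Type*} [NormedAddCommGroup E] [NormedSpace ℝ E] [FiniteDimensional ℝ E]
  [MeasurableSpace E] [BorelSpace E] {μ : Measure E} [μ.IsAddHaarMeasure]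

/-- `g` is a weak derivative of `u` in the direction `e`. -/
def HasWeakDeriv (μ : Measure E) (e : E) (u g : E → ℝ) : Prop :=
  ∀ φ : E → ℝ, ContDiff ℝ ∞ φ → HasCompactSupport φ →
    ∫ x, u x * fderiv ℝ φ x e ∂μ = -∫ x, g x * φ x ∂μ

lemma HasWeakDeriv.unique {e : E} {u g g' : E → ℝ} (hg : LocallyIntegrable g μ)
    (hg' : LocallyIntegrable g' μ) (h : HasWeakDeriv μ e u g) (h' : HasWeakDeriv μ e u g') :
    g =ᵐ[μ] g' := by
  refine ae_eq_of_integral_contDiff_smul_eq hg hg' fun φ hφ hc => ?_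
  have h1 := h φ hφ hc
  have h2 := h' φ hφ hc
  simp only [smul_eq_mul, mul_comm (φ _)]
  linarith

lemma HasWeakDeriv.smul_dir {e : E} {u g : E → ℝ} (h : HasWeakDeriv μ e u g) (c : ℝ) :
    HasWeakDeriv μ (c • e) u (fun x => c * g x) := by
  intro φ hφ hc
  simp only [map_smul, smul_eq_mul, mul_left_comm _ c, mul_assoc, integral_const_mul, h φ hφ hc]
  ring

/-- The shear `(τ, x) ↦ (τ, x + τ e)` preserves the product measure. -/
lemma measurePreserving_shear (ν : Measure ℝ) [SFinite ν] (e : E) :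
    MeasurePreserving (fun z : ℝ × E => (z.1, z.2 + z.1 • e)) (ν.prod μ) (ν.prod μ) := by
  refine (MeasurePreserving.id ν).skew_product (g := fun t x => x + t • e) ?_ ?_
  · exact (measurable_snd.add (measurable_fst.smul_const e))
  · exact ae_of_all _ fun t => map_add_right_eq_self μ (t • e)

/-- The segment measure `dτ` on `(0,1]`. -/
abbrev unitMeasure : Measure ℝ := volume.restrict (Ioc (0 : ℝ) 1)

instance : IsProbabilityMeasure unitMeasure := ⟨by simp [unitMeasure]⟩

lemma integrable_mul_translate {g ψ : E → ℝ} (hg : LocallyIntegrable g μ) (hψ : Continuous ψ)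
    (hc : HasCompactSupport ψ) (e : E) :
    Integrable (fun z : ℝ × E => g z.2 * ψ (z.2 - z.1 • e)) (unitMeasure.prod μ) := by
  set K : Set E := (fun z : ℝ × E => z.2 + z.1 • e) '' (Icc (0:ℝ) 1 ×ˢ tsupport ψ) with hK
  have hKc : IsCompact K := (isCompact_Icc.prod hc).image (by fun_prop)
  obtain ⟨C, hC⟩ := hc.exists_bound_of_continuous hψ
  have hi : Integrable (K.indicator g) μ := (hg.integrableOn_isCompact hKc).integrable_indicator
    hKc.measurableSet
  have hi2 : Integrable (fun z : ℝ × E => C * ‖K.indicator g z.2‖) (unitMeasure.prod μ) :=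
    (hi.comp_snd unitMeasure).norm.const_mul C
  refine hi2.mono' ?_ ?_
  · refine (hg.aestronglyMeasurable.comp_snd).mul ?_
    exact (hψ.comp (by fun_prop : Continuous fun z : ℝ × E => z.2 - z.1 • e)).aestronglyMeasurable
  · have : ∀ᵐ z ∂(unitMeasure.prod μ), z.1 ∈ Ioc (0:ℝ) 1 :=
      (Measure.quasiMeasurePreserving_fst).ae (ae_restrict_mem measurableSet_Ioc)
    filter_upwards [this] with z hz
    by_cases h : z.2 - z.1 • e ∈ tsupport ψ
    · have hzK : z.2 ∈ K := ⟨(z.1, z.2 - z.1 • e), ⟨⟨hz.1.le, hz.2⟩, h⟩, by simp⟩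
      rw [indicator_of_mem hzK, norm_mul, mul_comm]
      gcongr
      exact hC _
    · rw [image_eq_zero_of_notMem_tsupport h]
      have : 0 ≤ C := (norm_nonneg _).trans (hC 0)
      simp; positivity

/-- Jensen's inequality for averages over `(0,1]`. -/
lemma lintegral_enorm_integral_unit_rpow_le {α : Type*} [MeasurableSpace α] {ρ : Measure α}
    [SFinite ρ] {p : ℝ} (hp : 1 ≤ p) {F : ℝ × α → ℝ}
    (hF : AEStronglyMeasurable F (unitMeasure.prod ρ)) :
    ∫⁻ x, ‖∫ t, F (t, x) ∂unitMeasure‖ₑ ^ p ∂ρ ≤ ∫⁻ t, ∫⁻ x, ‖F (t, x)‖ₑ ^ p ∂ρ ∂unitMeasure := by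
  have hm : AEMeasurable (fun z : ℝ × α => ‖F z‖ₑ ^ p) (unitMeasure.prod ρ) :=
    hF.enorm.pow_const p
  rw [lintegral_lintegral_swap hm]
  refine lintegral_mono_ae ?_
  have hs : ∀ᵐ x ∂ρ, AEStronglyMeasurable (fun t => F (t, x)) unitMeasure := by
    have := hF.prod_swap
    exact this.prodMk_left
  filter_upwards [hs] with x hx
  have h1 : ‖∫ t, F (t, x) ∂unitMeasure‖ₑ ≤ eLpNorm (fun t => F (t, x)) 1 unitMeasure := by
    rw [eLpNorm_one_eq_lintegral_enorm]; exact enorm_integral_le_lintegral_enorm _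
  have h2 : eLpNorm (fun t => F (t, x)) 1 unitMeasure ≤
      eLpNorm (fun t => F (t, x)) (ENNReal.ofReal p) unitMeasure :=
    eLpNorm_le_eLpNorm_of_exponent_le (by simpa using ENNReal.ofReal_le_ofReal hp) hx
  have hp0 : 0 < p := by linarith
  refine (ENNReal.rpow_le_rpow (h1.trans h2) hp0.le).trans ?_
  rw [eLpNorm_eq_lintegral_rpow_enorm_toReal (by simpa using hp0) (by simp),
    ENNReal.toReal_ofReal hp0.le, ← ENNReal.rpow_mul]
  simp [hp0.ne']

lemma locallyIntegrable_of_memLp {F : Type*} [NormedAddCommGroup F] {p : ℝ} (hp : 1 ≤ p) {u : E → F}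
    (hu : MemLp u (ENNReal.ofReal p) μ) : LocallyIntegrable u μ :=
  hu.locallyIntegrable (by simpa using ENNReal.ofReal_le_ofReal hp)

lemma memLp_ofReal_iff {α F : Type*} [MeasurableSpace α] [NormedAddCommGroup F] {ρ : Measure α}
    {p : ℝ} (hp : 0 < p) {u : α → F} :
    MemLp u (ENNReal.ofReal p) ρ ↔ AEStronglyMeasurable u ρ ∧ ∫⁻ x, ‖u x‖ₑ ^ p ∂ρ < ⊤ := by
  unfold MemLp
  rw [eLpNorm_lt_top_iff_lintegral_rpow_enorm_lt_top (by simpa using hp) (by simp),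
    ENNReal.toReal_ofReal hp.le]

lemma aestronglyMeasurable_shear {g : E → ℝ} (hg : AEStronglyMeasurable g μ) (e : E) :
    AEStronglyMeasurable (fun z : ℝ × E => g (z.2 + z.1 • e)) (unitMeasure.prod μ) :=
  (hg.comp_snd (μ := unitMeasure)).comp_quasiMeasurePreserving
    (measurePreserving_shear unitMeasure e).quasiMeasurePreserving

/-- Averages of translates of an `L^p` function along a segment are in `L^p`. -/
lemma memLp_segment_average {p : ℝ} (hp : 1 ≤ p) {g : E → ℝ} (hg : MemLp g (ENNReal.ofReal p) μ)
    (e : E) : MemLp (fun x => ∫ t, g (x + t • e) ∂unitMeasure) (ENNReal.ofReal p) μ ∧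
      ∫⁻ x, ‖∫ t, g (x + t • e) ∂unitMeasure‖ₑ ^ p ∂μ ≤ ∫⁻ x, ‖g x‖ₑ ^ p ∂μ := by
  have hm := aestronglyMeasurable_shear hg.1 e
  have h1 := lintegral_enorm_integral_unit_rpow_le hp hm
  have h2 : ∫⁻ x, ‖∫ t, g (x + t • e) ∂unitMeasure‖ₑ ^ p ∂μ ≤ ∫⁻ x, ‖g x‖ₑ ^ p ∂μ := by
    refine h1.trans ?_
    have : ∀ t : ℝ, ∫⁻ x, ‖g (x + t • e)‖ₑ ^ p ∂μ = ∫⁻ x, ‖g x‖ₑ ^ p ∂μ := fun t =>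
      lintegral_add_right_eq_self (fun x => ‖g x‖ₑ ^ p) (t • e)
    simp [this]
  refine ⟨?_, h2⟩
  rw [memLp_ofReal_iff (by linarith)] at hg ⊢
  exact ⟨hm.prod_swap.integral_prod_right', h2.trans_lt hg.2⟩

/-- The fundamental theorem of calculus for weak derivatives. -/
lemma HasWeakDeriv.translate_sub {p : ℝ} (hp : 1 ≤ p) {e : E} {u g : E → ℝ}
    (h : HasWeakDeriv μ e u g) (hu : MemLp u (ENNReal.ofReal p) μ)
    (hg : MemLp g (ENNReal.ofReal p) μ) :
    ∀ᵐ x ∂μ, u (x + e) - u x = ∫ t, g (x + t • e) ∂unitMeasure := by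
  have hul := locallyIntegrable_of_memLp hp hu
  have hgl := locallyIntegrable_of_memLp hp hg
  have hut : MemLp (fun x => u (x + e)) (ENNReal.ofReal p) μ :=
    hu.comp_measurePreserving (measurePreserving_add_right μ e)
  refine ae_eq_of_integral_contDiff_smul_eq (locallyIntegrable_of_memLp hp (hut.sub hu))
    (locallyIntegrable_of_memLp hp (memLp_segment_average hp hg e).1) fun ψ hψ hc => ?_
  have hψ1 : ContDiff ℝ 1 ψ := hψ.of_le (by exact_mod_cast le_top)
  have hDc : Continuous fun x => fderiv ℝ ψ x e :=
    (hψ1.continuous_fderiv (by norm_num)).clm_apply continuous_const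
  have hDs : HasCompactSupport fun x => fderiv ℝ ψ x e := hc.fderiv_apply (𝕜 := ℝ) e
  -- the fundamental theorem of calculus for the test function
  have hftc : ∀ y, ψ (y - e) - ψ y = -∫ t, fderiv ℝ ψ (y - t • e) e ∂unitMeasure := by
    intro y
    have hd : ∀ t ∈ uIcc (0:ℝ) 1, HasDerivAt (fun t : ℝ => ψ (y - t • e))
        (-(fderiv ℝ ψ (y - t • e) e)) t := by
      intro t _
      have h1 : HasDerivAt (fun t : ℝ => y - t • e) (-e) t := by
        simpa using ((hasDerivAt_id t).smul_const e).const_sub y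
      have h2 := ((hψ1.differentiable (by norm_num)) (y - t • e)).hasFDerivAt.comp_hasDerivAt t h1
      rwa [map_neg] at h2
    have hint : IntervalIntegrable (fun t : ℝ => -(fderiv ℝ ψ (y - t • e) e)) volume 0 1 :=
      (hDc.comp (by fun_prop : Continuous fun t : ℝ => y - t • e)).neg.intervalIntegrable _ _
    have := intervalIntegral.integral_eq_sub_of_hasDerivAt hd hint
    rw [intervalIntegral.integral_of_le zero_le_one, integral_neg] at this
    simpa using this.symm
  have hU := integrable_mul_translate hul hDc hDs e
  have hG := integrable_mul_translate hgl hψ.continuous hc e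
  have hi1 : Integrable (fun x => u (x + e) * ψ x) μ :=
    (locallyIntegrable_of_memLp hp hut).integrable_smul_right_of_hasCompactSupport hψ.continuous hc
  have hi2 : Integrable (fun x => u x * ψ x) μ :=
    hul.integrable_smul_right_of_hasCompactSupport hψ.continuous hc
  have hi3 : Integrable (fun x => u x * ψ (x - e)) μ := by
    simpa using hi1.comp_sub_right e
  calc ∫ x, ψ x • (u (x + e) - u x) ∂μ
      = ∫ x, u (x + e) * ψ x ∂μ - ∫ x, u x * ψ x ∂μ := by
        rw [← integral_sub hi1 hi2]; congr 1; ext x; simp; ring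
    _ = ∫ x, u x * ψ (x - e) ∂μ - ∫ x, u x * ψ x ∂μ := by
        rw [← integral_add_right_eq_self (fun x => u x * ψ (x - e)) e]; simp
    _ = -∫ x, ∫ t, u x * fderiv ℝ ψ (x - t • e) e ∂unitMeasure ∂μ := by
        rw [← integral_sub hi3 hi2, ← integral_neg]
        congr 1; ext x
        rw [← mul_sub, hftc, integral_const_mul]; ring
    _ = -∫ t, ∫ x, u x * fderiv ℝ ψ (x - t • e) e ∂μ ∂unitMeasure := by
        rw [integral_integral_swap]
        exact hU.swap
    _ = ∫ t, ∫ x, g x * ψ (x - t • e) ∂μ ∂unitMeasure := by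
        rw [← integral_neg]
        congr 1; ext t
        have := h (fun x => ψ (x - t • e)) (hψ.comp (contDiff_id.sub contDiff_const))
          (hc.comp_homeomorph (Homeomorph.subRight (t • e)))
        simp only [fderiv_comp_sub] at this
        rw [this, neg_neg]
    _ = ∫ t, ∫ x, g (x + t • e) * ψ x ∂μ ∂unitMeasure := by
        congr 1; ext t
        rw [← integral_add_right_eq_self (fun x => g x * ψ (x - t • e)) (t • e)]; simp
    _ = ∫ x, ∫ t, g (x + t • e) * ψ x ∂unitMeasure ∂μ := by
        rw [integral_integral_swap]
        have := (measurePreserving_shear (μ := μ) unitMeasure e).integrable_comp_of_integrable hG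
        refine this.congr (ae_of_all _ fun z => ?_)
        simp [Function.uncurry]
    _ = ∫ x, ψ x • ∫ t, g (x + t • e) ∂unitMeasure ∂μ := by
        congr 1; ext x; rw [integral_mul_const, smul_eq_mul, mul_comm]

end WeakDerivative

/-! ### Difference quotients and the chain rule -/

section DifferenceQuotient

variable {E : Type*} [NormedAddCommGroup E] [NormedSpace ℝ E] [FiniteDimensional ℝ E]
  [MeasurableSpace E] [BorelSpace E] {μ : Measure E} [μ.IsAddHaarMeasure]

lemma eLpNorm_ofReal_eq {α F : Type*} [MeasurableSpace α] [NormedAddCommGroup F] {ρ : Measure α}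
    {p : ℝ} (hp : 0 < p) (u : α → F) :
    eLpNorm u (ENNReal.ofReal p) ρ = (∫⁻ x, ‖u x‖ₑ ^ p ∂ρ) ^ (1 / p) := by
  rw [eLpNorm_eq_lintegral_rpow_enorm_toReal (by simpa using hp) (by simp),
    ENNReal.toReal_ofReal hp.le]

lemma eLpNorm_ofReal_rpow {α F : Type*} [MeasurableSpace α] [NormedAddCommGroup F] {ρ : Measure α}
    {p : ℝ} (hp : 0 < p) (u : α → F) :
    eLpNorm u (ENNReal.ofReal p) ρ ^ p = ∫⁻ x, ‖u x‖ₑ ^ p ∂ρ := by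
  rw [eLpNorm_ofReal_eq hp, ← ENNReal.rpow_mul]
  simp [hp.ne']

/-- Translation is continuous in `L^p`. -/
lemma tendsto_eLpNorm_translate_sub {p : ℝ} (hp : 1 ≤ p) {g : E → ℝ}
    (hg : MemLp g (ENNReal.ofReal p) μ) :
    Tendsto (fun y => eLpNorm (fun x => g (x + y) - g x) (ENNReal.ofReal p) μ) (𝓝 0) (𝓝 0) := by
  have : Fact (1 ≤ ENNReal.ofReal p) := ⟨by simpa using ENNReal.ofReal_le_ofReal hp⟩
  let T : E → C(E, E) := fun y => ⟨fun x => x + y, by fun_prop⟩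
  have hTm : ∀ y, MeasurePreserving (T y) μ μ := fun y => measurePreserving_add_right μ y
  have hTc : Continuous T := by
    refine ContinuousMap.continuous_of_continuous_uncurry _ ?_
    exact continuous_snd.add continuous_fst
  have h := Filter.Tendsto.compMeasurePreservingLp (μ := μ) (ν := μ) (p := ENNReal.ofReal p)
    (tendsto_const_nhds (x := hg.toLp g) (f := 𝓝 (0 : E))) (hTc.tendsto 0) hTm (hTm 0) (by simp)
  rw [tendsto_iff_edist_tendsto_0] at h
  refine h.congr fun y => ?_
  rw [Lp.edist_def]
  refine eLpNorm_congr_ae ?_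
  have h1 := Lp.coeFn_compMeasurePreserving (hg.toLp g) (hTm y)
  have h2 := Lp.coeFn_compMeasurePreserving (hg.toLp g) (hTm 0)
  have h3 := hg.coeFn_toLp
  have h4 := (hTm y).quasiMeasurePreserving.ae_eq_comp h3
  filter_upwards [h1, h2, h3, h4] with x h1 h2 h3 h4
  simp only [Pi.sub_apply, h1, h2]
  simp only [Function.comp_apply, T, ContinuousMap.coe_mk, add_zero] at h4 ⊢
  rw [h3, h4]

lemma ae_memLp_segment {p : ℝ} (hp : 1 ≤ p) {g : E → ℝ} (hg : MemLp g (ENNReal.ofReal p) μ)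
    (e : E) : ∀ᵐ x ∂μ, Integrable (fun t : ℝ => g (x + t • e)) unitMeasure := by
  have hp0 : 0 < p := by linarith
  have hm := aestronglyMeasurable_shear hg.1 e
  have h1 : ∫⁻ x, ∫⁻ t, ‖g (x + t • e)‖ₑ ^ p ∂unitMeasure ∂μ ≠ ⊤ := by
    rw [← lintegral_lintegral_swap (hm.enorm.pow_const p)]
    have : ∀ t : ℝ, ∫⁻ x, ‖g (x + t • e)‖ₑ ^ p ∂μ = ∫⁻ x, ‖g x‖ₑ ^ p ∂μ := fun t =>
      lintegral_add_right_eq_self (fun x => ‖g x‖ₑ ^ p) (t • e)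
    simp only [this, lintegral_const, measure_univ, mul_one]
    exact ((memLp_ofReal_iff hp0).1 hg).2.ne
  have hm2 : AEMeasurable (fun x => ∫⁻ t, ‖g (x + t • e)‖ₑ ^ p ∂unitMeasure) μ :=
    (hm.enorm.pow_const p).prod_swap.lintegral_prod_right'
  filter_upwards [ae_lt_top' hm2 h1, hm.prod_swap.prodMk_left] with x hx hx'
  have : MemLp (fun t : ℝ => g (x + t • e)) (ENNReal.ofReal p) unitMeasure :=
    (memLp_ofReal_iff hp0).2 ⟨hx', hx⟩
  exact this.integrable (by simpa using ENNReal.ofReal_le_ofReal hp)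

/-- The `L^p` bound `‖u(· + e) - u‖ ≤ ‖∂_e u‖`. -/
lemma lintegral_translate_sub_le {p : ℝ} (hp : 1 ≤ p) {e : E} {u g : E → ℝ}
    (h : HasWeakDeriv μ e u g) (hu : MemLp u (ENNReal.ofReal p) μ)
    (hg : MemLp g (ENNReal.ofReal p) μ) :
    ∫⁻ x, ‖u (x + e) - u x‖ₑ ^ p ∂μ ≤ ∫⁻ x, ‖g x‖ₑ ^ p ∂μ := by
  refine le_trans (le_of_eq ?_) (memLp_segment_average hp hg e).2
  refine lintegral_congr_ae ?_
  filter_upwards [h.translate_sub hp hu hg] with x hx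
  rw [hx]

/-- The difference quotients of a Sobolev function converge in `L^p` to the weak derivative. -/
lemma HasWeakDeriv.tendsto_eLpNorm_slope {p : ℝ} (hp : 1 ≤ p) {e : E} {u g : E → ℝ}
    (h : HasWeakDeriv μ e u g) (hu : MemLp u (ENNReal.ofReal p) μ)
    (hg : MemLp g (ENNReal.ofReal p) μ) :
    Tendsto (fun t : ℝ => eLpNorm (fun x => t⁻¹ * (u (x + t • e) - u x) - g x)
      (ENNReal.ofReal p) μ) (𝓝[>] 0) (𝓝 0) := by
  have hp0 : 0 < p := by linarith
  rw [ENNReal.tendsto_nhds_zero]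
  intro ε hε
  have h0 := tendsto_eLpNorm_translate_sub hp hg
  rw [ENNReal.tendsto_nhds_zero] at h0
  obtain ⟨δ, hδ, hb⟩ := Metric.eventually_nhds_iff.1 (h0 ε hε)
  have hsm : ∀ᶠ t : ℝ in 𝓝[>] 0, t * ‖e‖ < δ := by
    have : Tendsto (fun t : ℝ => t * ‖e‖) (𝓝[>] 0) (𝓝 (0 * ‖e‖)) :=
      ((continuous_id.mul continuous_const).tendsto 0).mono_left nhdsWithin_le_nhds
    rw [zero_mul] at this
    exact this.eventually_lt_const hδ
  filter_upwards [hsm, self_mem_nhdsWithin] with s hs hs0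
  have hs0' : (0:ℝ) < s := hs0
  have hm : AEStronglyMeasurable (fun z : ℝ × E => g (z.2 + z.1 • (s • e)) - g z.2)
      (unitMeasure.prod μ) := (aestronglyMeasurable_shear hg.1 (s • e)).sub hg.1.comp_snd
  have key : ∫⁻ x, ‖s⁻¹ * (u (x + s • e) - u x) - g x‖ₑ ^ p ∂μ ≤ ε ^ p := by
    calc _ = ∫⁻ x, ‖∫ t, (g (x + t • (s • e)) - g x) ∂unitMeasure‖ₑ ^ p ∂μ := by
          refine lintegral_congr_ae ?_
          filter_upwards [(h.smul_dir s).translate_sub hp hu (hg.const_mul s),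
            ae_memLp_segment hp hg (s • e)] with x hx hi
          rw [hx, integral_sub hi (integrable_const _), integral_const_mul, ← mul_assoc,
            inv_mul_cancel₀ hs0'.ne']
          simp
      _ ≤ ∫⁻ t, ∫⁻ x, ‖g (x + t • (s • e)) - g x‖ₑ ^ p ∂μ ∂unitMeasure :=
          lintegral_enorm_integral_unit_rpow_le hp hm
      _ ≤ ∫⁻ t, ε ^ p ∂unitMeasure := by
          refine lintegral_mono_ae ?_
          filter_upwards [ae_restrict_mem measurableSet_Ioc] with t ht
          rw [← eLpNorm_ofReal_rpow hp0]
          gcongr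
          apply hb
          rw [dist_zero_right, norm_smul, norm_smul, Real.norm_of_nonneg ht.1.le,
            Real.norm_of_nonneg hs0'.le]
          refine lt_of_le_of_lt ?_ hs
          exact mul_le_of_le_one_left (by positivity) ht.2
      _ = ε ^ p := by simp
  rw [eLpNorm_ofReal_eq hp0]
  calc _ ≤ (ε ^ p) ^ (1 / p) := by gcongr
    _ = ε := by rw [← ENNReal.rpow_mul]; simp [hp0.ne']

/-- Difference quotients converge to the weak derivative in the sense of distributions. -/
lemma tendsto_integral_slope_mul {u φ : E → ℝ} (hu : LocallyIntegrable u μ)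
    (hφ : ContDiff ℝ ∞ φ) (hc : HasCompactSupport φ) (e : E) :
    Tendsto (fun t : ℝ => ∫ x, t⁻¹ * (u (x + t • e) - u x) * φ x ∂μ) (𝓝[>] 0)
      (𝓝 (-∫ x, u x * fderiv ℝ φ x e ∂μ)) := by
  have hφ1 : ContDiff ℝ 1 φ := hφ.of_le (by exact_mod_cast le_top)
  obtain ⟨L, hL⟩ := hφ1.lipschitzWith_of_hasCompactSupport hc (by norm_num)
  set K : Set E := (fun z : ℝ × E => z.2 + z.1 • e) '' (Icc (0:ℝ) 1 ×ˢ tsupport φ) with hK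
  have hKc : IsCompact K := (isCompact_Icc.prod hc).image (by fun_prop)
  have hi : Integrable (K.indicator u) μ := (hu.integrableOn_isCompact hKc).integrable_indicator
    hKc.measurableSet
  rw [← integral_neg]
  have key : Tendsto (fun t : ℝ => ∫ x, u x * (t⁻¹ * (φ (x - t • e) - φ x)) ∂μ) (𝓝[>] 0)
      (𝓝 (∫ x, -(u x * fderiv ℝ φ x e) ∂μ)) := by
    refine tendsto_integral_filter_of_dominated_convergence
      (fun x => ‖K.indicator u x‖ * (L * ‖e‖)) ?_ ?_ (hi.norm.mul_const _) ?_
    · refine Eventually.of_forall fun t => hu.aestronglyMeasurable.mul ?_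
      have := hφ.continuous
      exact Continuous.aestronglyMeasurable (by fun_prop)
    · have : ∀ᶠ t : ℝ in 𝓝[>] 0, t ∈ Ioo (0:ℝ) 1 := Ioo_mem_nhdsGT one_pos
      filter_upwards [this] with t ht
      refine ae_of_all _ fun x => ?_
      by_cases hx : x ∈ K
      · rw [indicator_of_mem hx, norm_mul]
        gcongr
        rw [norm_mul, norm_inv, Real.norm_of_nonneg ht.1.le]
        have := hL.dist_le_mul (x - t • e) x
        rw [dist_eq_norm, dist_eq_norm] at this
        simp only [sub_sub_cancel_left, norm_neg, norm_smul, Real.norm_of_nonneg ht.1.le] at this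
        rw [inv_mul_le_iff₀ ht.1]
        linarith
      · have h1 : φ x = 0 := by
          refine image_eq_zero_of_notMem_tsupport fun hmem => hx ⟨(0, x), ⟨by simp, hmem⟩, by simp⟩
        have h2 : φ (x - t • e) = 0 := by
          refine image_eq_zero_of_notMem_tsupport fun hmem =>
            hx ⟨(t, x - t • e), ⟨⟨ht.1.le, ht.2.le⟩, hmem⟩, by simp⟩
        simp [h1, h2, hx]
    · refine ae_of_all _ fun x => ?_
      have hd : HasDerivAt (fun t : ℝ => φ (x - t • e)) (-(fderiv ℝ φ x e)) 0 := by
        have h1 : HasDerivAt (fun t : ℝ => x - t • e) (-e) 0 := by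
          simpa using ((hasDerivAt_id (0:ℝ)).smul_const e).const_sub x
        have h2 := ((hφ1.differentiable (by norm_num)) (x - (0:ℝ) • e)).hasFDerivAt.comp_hasDerivAt
          0 h1
        rw [map_neg, zero_smul, sub_zero] at h2
        exact h2
      have h3 := hd.tendsto_slope_zero_right
      simp only [zero_add, zero_smul, sub_zero, smul_eq_mul] at h3
      simpa using h3.const_mul (u x)
  refine key.congr fun t => ?_
  have hut : LocallyIntegrable (fun x => u (x + t • e)) μ := by
    have := (measurePreserving_add_right μ (t • e))
    intro x
    obtain ⟨U, hU, hUi⟩ := hu (x + t • e)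
    refine ⟨(fun y => y + t • e) ⁻¹' U, (by fun_prop : Continuous fun y : E => y + t • e).continuousAt
      hU, ?_⟩
    exact (this.integrableOn_comp_preimage (Homeomorph.addRight (t • e)).measurableEmbedding).2 hUi
  have hi1 : Integrable (fun x => u (x + t • e) * φ x) μ :=
    hut.integrable_smul_right_of_hasCompactSupport hφ.continuous hc
  have hi2 : Integrable (fun x => u x * φ x) μ :=
    hu.integrable_smul_right_of_hasCompactSupport hφ.continuous hc
  have hi3 : Integrable (fun x => u x * φ (x - t • e)) μ := by
    simpa using hi1.comp_sub_right (t • e)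
  have e1 : ∀ x, t⁻¹ * (u (x + t • e) - u x) * φ x = t⁻¹ * (u (x + t • e) * φ x - u x * φ x) :=
    fun x => by ring
  have e2 : ∀ x, u x * (t⁻¹ * (φ (x - t • e) - φ x)) = t⁻¹ * (u x * φ (x - t • e) - u x * φ x) :=
    fun x => by ring
  simp only [e1, e2, integral_const_mul]
  rw [integral_sub hi1 hi2, integral_sub hi3 hi2,
    ← integral_add_right_eq_self (fun x => u x * φ (x - t • e)) (t • e)]
  simp

/-- Convergence to `0` in `L^p` implies weak convergence against test functions. -/
lemma tendsto_lintegral_mul_of_tendsto_eLpNorm {ι : Type*} {l : Filter ι} {p : ℝ} (hp : 1 < p)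
    {a : ι → E → ℝ} {φ : E → ℝ} (ha : ∀ i, AEStronglyMeasurable (a i) μ)
    (h : Tendsto (fun i => eLpNorm (a i) (ENNReal.ofReal p) μ) l (𝓝 0))
    (hφ : Continuous φ) (hc : HasCompactSupport φ) :
    Tendsto (fun i => ∫⁻ x, ‖a i x * φ x‖ₑ ∂μ) l (𝓝 0) := by
  have hpq := Real.HolderConjugate.conjExponent hp
  set q := p.conjExponent
  have hφq : MemLp φ (ENNReal.ofReal q) μ := hφ.memLp_of_hasCompactSupport hc
  have hb : ∀ i, ∫⁻ x, ‖a i x * φ x‖ₑ ∂μ ≤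
      eLpNorm (a i) (ENNReal.ofReal p) μ * eLpNorm φ (ENNReal.ofReal q) μ := by
    intro i
    rw [eLpNorm_ofReal_eq hpq.pos, eLpNorm_ofReal_eq hpq.symm.pos]
    simp only [enorm_mul]
    exact ENNReal.lintegral_mul_le_Lp_mul_Lq μ hpq (ha i).enorm hφq.1.enorm
  have h2 : Tendsto (fun i => eLpNorm (a i) (ENNReal.ofReal p) μ * eLpNorm φ (ENNReal.ofReal q) μ)
      l (𝓝 0) := by
    simpa using ENNReal.Tendsto.mul_const h (Or.inr hφq.2.ne)
  exact tendsto_of_tendsto_of_tendsto_of_le_of_le tendsto_const_nhds h2 (fun _ => zero_le) hb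

/-- Chain rule for Lipschitz functions of two Sobolev functions. It is enough that the one-sided
directional derivatives exist: `Ψ(u(x + te), v(x + te))` differs from `Ψ(u + t α, v + t β)` by
`o(t)` in `L^p`. -/
lemma HasWeakDeriv.comp_lipschitz {p L : ℝ} (hp : 1 < p) {e : E} {u v α β z : E → ℝ}
    {Ψ : ℝ → ℝ → ℝ} (hΨ : ∀ a b a' b', |Ψ a b - Ψ a' b'| ≤ L * (|a - a'| + |b - b'|))
    (h : HasWeakDeriv μ e u α) (h' : HasWeakDeriv μ e v β)
    (hu : MemLp u (ENNReal.ofReal p) μ) (hv : MemLp v (ENNReal.ofReal p) μ)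
    (hα : MemLp α (ENNReal.ofReal p) μ) (hβ : MemLp β (ENNReal.ofReal p) μ)
    (hw : LocallyIntegrable (fun x => Ψ (u x) (v x)) μ)
    (hz : ∀ᵐ x ∂μ, Tendsto (fun t => t⁻¹ * (Ψ (u x + t * α x) (v x + t * β x) - Ψ (u x) (v x)))
      (𝓝[>] 0) (𝓝 (z x))) :
    MemLp z (ENNReal.ofReal p) μ ∧ HasWeakDeriv μ e (fun x => Ψ (u x) (v x)) z := by
  have hL : 0 ≤ L := by
    have := (abs_nonneg _).trans (hΨ 1 0 0 0)
    simpa using this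
  have hΨc : Continuous (fun q : ℝ × ℝ => Ψ q.1 q.2) := by
    rw [Metric.continuous_iff]
    intro b ε hε
    refine ⟨ε / (2 * L + 1), by positivity, fun a ha => ?_⟩
    have h1 := hΨ a.1 a.2 b.1 b.2
    have h2 : |a.1 - b.1| ≤ dist a b := by rw [← Real.dist_eq]; exact le_max_left _ _
    have h3 : |a.2 - b.2| ≤ dist a b := by rw [← Real.dist_eq]; exact le_max_right _ _
    rw [Real.dist_eq]
    rw [lt_div_iff₀ (by positivity)] at ha
    have : L * (|a.1 - b.1| + |a.2 - b.2|) ≤ L * (dist a b + dist a b) := by gcongr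
    nlinarith [dist_nonneg (x := a) (y := b)]
  set R : ℝ → E → ℝ := fun t x =>
    t⁻¹ * (Ψ (u x + t * α x) (v x + t * β x) - Ψ (u x) (v x)) with hR
  have hRm : ∀ t, AEStronglyMeasurable (R t) μ := fun t =>
    ((hΨc.comp_aestronglyMeasurable ((hu.1.add (hα.1.const_mul t)).prodMk
      (hv.1.add (hβ.1.const_mul t)))).sub
      (hΨc.comp_aestronglyMeasurable (hu.1.prodMk hv.1))).const_mul _
  have hRb : ∀ t : ℝ, 0 < t → ∀ x, ‖R t x‖ ≤ L * (|α x| + |β x|) := by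
    intro t ht x
    have := hΨ (u x + t * α x) (v x + t * β x) (u x) (v x)
    simp only [add_sub_cancel_left, abs_mul, abs_of_pos ht] at this
    rw [hR, norm_mul, norm_inv, Real.norm_of_nonneg ht.le, Real.norm_eq_abs, inv_mul_le_iff₀ ht]
    linarith
  have hdom : MemLp (fun x => L * (|α x| + |β x|)) (ENNReal.ofReal p) μ :=
    (hα.abs.add hβ.abs).const_mul L
  have hzm : AEStronglyMeasurable z μ := by
    refine aestronglyMeasurable_of_tendsto_ae (𝓝[>] (0:ℝ)) hRm hz
  have hzb : ∀ᵐ x ∂μ, ‖z x‖ ≤ L * (|α x| + |β x|) := by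
    filter_upwards [hz] with x hx
    refine le_of_tendsto hx.norm ?_
    filter_upwards [self_mem_nhdsWithin] with t ht using hRb t ht x
  have hzp : MemLp z (ENNReal.ofReal p) μ := by
    refine hdom.mono hzm ?_
    filter_upwards [hzb] with x hx using hx.trans (le_abs_self _)
  refine ⟨hzp, fun φ hφ hc => ?_⟩
  have hlim1 := tendsto_integral_slope_mul hw hφ hc e
  have hlim2 : Tendsto (fun t => ∫ x, R t x * φ x ∂μ) (𝓝[>] 0) (𝓝 (∫ x, z x * φ x ∂μ)) := by
    refine tendsto_integral_filter_of_dominated_convergence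
      (fun x => (L * (|α x| + |β x|)) * ‖φ x‖) ?_ ?_ ?_ ?_
    · exact Eventually.of_forall fun t => (hRm t).mul hφ.continuous.aestronglyMeasurable
    · filter_upwards [self_mem_nhdsWithin] with t ht
      refine ae_of_all _ fun x => ?_
      rw [norm_mul]
      gcongr
      exact hRb t ht x
    · exact (locallyIntegrable_of_memLp hp.le hdom).integrable_smul_right_of_hasCompactSupport
        hφ.continuous.norm hc.norm
    · filter_upwards [hz] with x hx using hx.mul_const _
  have hsl1 := h.tendsto_eLpNorm_slope hp.le hu hα
  have hsl2 := h'.tendsto_eLpNorm_slope hp.le hv hβ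
  have hum : ∀ {w : E → ℝ}, AEStronglyMeasurable w μ → ∀ y : E,
      AEStronglyMeasurable (fun x => w (x + y)) μ := fun hw y =>
    hw.comp_measurePreserving (measurePreserving_add_right μ y)
  have e1 := tendsto_lintegral_mul_of_tendsto_eLpNorm hp (μ := μ)
    (fun t => (((hum hu.1 (t • e)).sub hu.1).const_mul t⁻¹).sub hα.1) hsl1 hφ.continuous hc
  have e2 := tendsto_lintegral_mul_of_tendsto_eLpNorm hp (μ := μ)
    (fun t => (((hum hv.1 (t • e)).sub hv.1).const_mul t⁻¹).sub hβ.1) hsl2 hφ.continuous hc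
  have e3 := ENNReal.Tendsto.const_mul (a := ENNReal.ofReal L) (e1.add e2)
    (Or.inr ENNReal.ofReal_ne_top)
  simp only [add_zero, mul_zero, Pi.sub_apply] at e3
  have hdiff : Tendsto (fun t => ∫ x, (t⁻¹ * (Ψ (u (x + t • e)) (v (x + t • e)) - Ψ (u x) (v x)) * φ x
      - R t x * φ x) ∂μ) (𝓝[>] 0) (𝓝 0) := by
    rw [tendsto_zero_iff_enorm_tendsto_zero]
    refine tendsto_of_tendsto_of_tendsto_of_le_of_le' tendsto_const_nhds e3
      (Eventually.of_forall fun _ => zero_le) ?_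
    filter_upwards [self_mem_nhdsWithin] with t ht
    have ht' : (0:ℝ) < t := ht
    refine (enorm_integral_le_lintegral_enorm _).trans ?_
    have mm : AEMeasurable (fun x => ‖(t⁻¹ * (u (x + t • e) - u x) - α x) * φ x‖ₑ) μ :=
      (((((hum hu.1 (t • e)).sub hu.1).const_mul t⁻¹).sub hα.1).mul
        hφ.continuous.aestronglyMeasurable).enorm
    rw [← lintegral_add_left' mm, ← lintegral_const_mul' _ _ ENNReal.ofReal_ne_top]
    refine lintegral_mono fun x => ?_
    simp only [← sub_mul, enorm_mul, ← add_mul]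
    rw [← mul_assoc]
    gcongr
    rw [← ofReal_norm, ← ofReal_norm, ← ofReal_norm,
      ← ENNReal.ofReal_add (norm_nonneg _) (norm_nonneg _), ← ENNReal.ofReal_mul hL]
    refine ENNReal.ofReal_le_ofReal ?_
    have hh := hΨ (u (x + t • e)) (v (x + t • e)) (u x + t * α x) (v x + t * β x)
    have e4 : t⁻¹ * (Ψ (u (x + t • e)) (v (x + t • e)) - Ψ (u x) (v x)) - R t x =
        t⁻¹ * (Ψ (u (x + t • e)) (v (x + t • e)) - Ψ (u x + t * α x) (v x + t * β x)) := by
      rw [hR]; ring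
    have e5 : ∀ a b c : ℝ, t⁻¹ * (a - b) - c = t⁻¹ * (a - (b + t * c)) := by
      intro a b c; field_simp; ring
    rw [e4, e5, e5]
    simp only [norm_mul, norm_inv, Real.norm_of_nonneg ht'.le, Real.norm_eq_abs]
    rw [inv_mul_le_iff₀ ht']
    calc _ ≤ _ := hh
      _ = _ := by field_simp
  have hQi : ∀ t : ℝ, Integrable (fun x => t⁻¹ * (Ψ (u (x + t • e)) (v (x + t • e)) - Ψ (u x) (v x))
      * φ x) μ := by
    intro t
    have hut : LocallyIntegrable (fun x => Ψ (u (x + t • e)) (v (x + t • e))) μ := by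
      intro x
      obtain ⟨U, hU, hUi⟩ := hw (x + t • e)
      refine ⟨(fun y => y + t • e) ⁻¹' U,
        (by fun_prop : Continuous fun y : E => y + t • e).continuousAt hU, ?_⟩
      exact ((measurePreserving_add_right μ (t • e)).integrableOn_comp_preimage
        (Homeomorph.addRight (t • e)).measurableEmbedding).2 hUi
    have := ((hut.sub hw).integrable_smul_right_of_hasCompactSupport hφ.continuous hc).const_mul t⁻¹
    refine this.congr (ae_of_all _ fun x => ?_)
    simp only [smul_eq_mul, Pi.sub_apply]; ring
  have hRi : ∀ t : ℝ, 0 < t → Integrable (fun x => R t x * φ x) μ := by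
    intro t ht
    refine Integrable.mono' ((locallyIntegrable_of_memLp hp.le
      hdom).integrable_smul_right_of_hasCompactSupport hφ.continuous.norm hc.norm)
      ((hRm t).mul hφ.continuous.aestronglyMeasurable) (ae_of_all _ fun x => ?_)
    rw [norm_mul, smul_eq_mul]
    gcongr
    exact hRb t ht x
  have hlim3 : Tendsto (fun t => ∫ x, t⁻¹ * (Ψ (u (x + t • e)) (v (x + t • e)) - Ψ (u x) (v x))
      * φ x ∂μ) (𝓝[>] 0) (𝓝 (∫ x, z x * φ x ∂μ)) := by
    have := hdiff.add hlim2
    rw [zero_add] at this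
    refine this.congr' ?_
    filter_upwards [self_mem_nhdsWithin] with t ht
    rw [integral_sub (hQi t) (hRi t ht)]
    ring
  have := tendsto_nhds_unique hlim1 hlim3
  linarith

/-- A weak derivative vanishes almost everywhere on the zero set: the one-sided derivatives of
`|u|` along `e` and `-e` are both weak derivatives, hence opposite. -/
lemma HasWeakDeriv.ae_eq_zero_of_eq_zero {p : ℝ} (hp : 1 < p) {e : E} {u α : E → ℝ}
    (h : HasWeakDeriv μ e u α) (hu : MemLp u (ENNReal.ofReal p) μ)
    (hα : MemLp α (ENNReal.ofReal p) μ) : ∀ᵐ x ∂μ, u x = 0 → α x = 0 := by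
  have hl : LocallyIntegrable (fun x => |u x|) μ := locallyIntegrable_of_memLp hp.le hu.abs
  have key : ∀ c : ℝ, MemLp (fun x => if u x = 0 then |c * α x| else SignType.sign (u x) * (c * α x))
      (ENNReal.ofReal p) μ ∧ HasWeakDeriv μ (c • e) (fun x => |u x|)
      (fun x => if u x = 0 then |c * α x| else SignType.sign (u x) * (c * α x)) := by
    intro c
    refine HasWeakDeriv.comp_lipschitz (L := 1) (Ψ := fun a _ => |a|) hp ?_ (h.smul_dir c)
      (h.smul_dir c) hu hu (hα.const_mul c) (hα.const_mul c) hl ?_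
    · intro a b a' b'
      rw [one_mul]
      exact (abs_abs_sub_abs_le_abs_sub a a').trans (le_add_of_nonneg_right (abs_nonneg _))
    · refine ae_of_all _ fun x => ?_
      split_ifs with h0
      · refine tendsto_const_nhds.congr' ?_
        filter_upwards [self_mem_nhdsWithin] with t ht
        have ht' : (0:ℝ) < t := ht
        simp only [h0, zero_add, abs_zero, sub_zero, abs_mul, abs_of_pos ht']
        field_simp
      · have hd : HasDerivAt (fun t : ℝ => |u x + t * (c * α x)|)
            (SignType.sign (u x) * (c * α x)) 0 := by
          have h1 : HasDerivAt (fun t : ℝ => u x + t * (c * α x)) (c * α x) 0 := by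
            simpa using ((hasDerivAt_id (0:ℝ)).mul_const (c * α x)).const_add (u x)
          have h2 := (hasDerivAt_abs (x := u x + 0 * (c * α x)) (by simpa using h0)).comp 0 h1
          rw [zero_mul, add_zero] at h2
          exact h2
        have h3 := hd.tendsto_slope_zero_right
        simpa using h3
  obtain ⟨m1, w1⟩ := key 1
  obtain ⟨m2, w2⟩ := key (-1)
  have w3 := w2.smul_dir (-1)
  simp only [smul_smul, mul_neg, mul_one, neg_neg] at w3
  have := w1.unique (locallyIntegrable_of_memLp hp.le m1)
    (locallyIntegrable_of_memLp hp.le (m2.const_mul (-1))) w3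
  filter_upwards [this] with x hx h0
  simp only [h0, if_true, one_mul, neg_mul, abs_neg] at hx
  have : |α x| = 0 := by linarith [abs_nonneg (α x)]
  simpa using this

/-- The weak derivative of `|u|`. -/
lemma HasWeakDeriv.abs {p : ℝ} (hp : 1 < p) {e : E} {u α : E → ℝ}
    (h : HasWeakDeriv μ e u α) (hu : MemLp u (ENNReal.ofReal p) μ)
    (hα : MemLp α (ENNReal.ofReal p) μ) :
    HasWeakDeriv μ e (fun x => |u x|) (fun x => SignType.sign (u x) * α x) := by
  refine (HasWeakDeriv.comp_lipschitz (L := 1) (Ψ := fun a _ => |a|) hp ?_ h h hu hu hα hα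
    (locallyIntegrable_of_memLp hp.le hu.abs) ?_).2
  · intro a b a' b'
    rw [one_mul]
    exact (abs_abs_sub_abs_le_abs_sub a a').trans (le_add_of_nonneg_right (abs_nonneg _))
  · filter_upwards [h.ae_eq_zero_of_eq_zero hp hu hα] with x hx
    by_cases h0 : u x = 0
    · simp [h0, hx h0]
    · have h1 : HasDerivAt (fun t : ℝ => u x + t * α x) (α x) 0 := by
        simpa using ((hasDerivAt_id (0:ℝ)).mul_const (α x)).const_add (u x)
      have h2 := (hasDerivAt_abs (x := u x + 0 * α x) (by simpa using h0)).comp 0 h1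
      rw [zero_mul, add_zero] at h2
      have h3 := HasDerivAt.tendsto_slope_zero_right h2
      simpa using h3

end DifferenceQuotient

/-! ### Finsler--Minkowski norms -/

namespace IsFinslerMinkowskiNorm

variable {N : ℕ} {H : EuclideanSpace ℝ (Fin N) → ℝ}

lemma continuous (hH : IsFinslerMinkowskiNorm H) : Continuous H :=
  continuousOn_univ.1 (hH.convexOn.continuousOn isOpen_univ)

lemma map_zero (hH : IsFinslerMinkowskiNorm H) : H 0 = 0 := (hH.eq_zero_iff 0).2 rfl

lemma add_le (hH : IsFinslerMinkowskiNorm H) (x y : EuclideanSpace ℝ (Fin N)) :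
    H (x + y) ≤ H x + H y := by
  have h := hH.convexOn.2 (mem_univ x) (mem_univ y)
    (by norm_num : (0:ℝ) ≤ 1 / 2) (by norm_num : (0:ℝ) ≤ 1 / 2) (by norm_num)
  rw [← smul_add, hH.homogeneous] at h
  simp only [smul_eq_mul] at h
  rw [abs_of_pos (by norm_num)] at h
  linarith

lemma map_neg (hH : IsFinslerMinkowskiNorm H) (x : EuclideanSpace ℝ (Fin N)) : H (-x) = H x := by
  have := hH.homogeneous (-1) x
  simpa using this

lemma differentiableAt (hH : IsFinslerMinkowskiNorm H) {x : EuclideanSpace ℝ (Fin N)} (hx : x ≠ 0) :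
    DifferentiableAt ℝ H x :=
  (hH.contDiffOn.contDiffAt (isOpen_compl_singleton.mem_nhds hx)).differentiableAt (by norm_num)

lemma inner_gradient {x : EuclideanSpace ℝ (Fin N)} (y : EuclideanSpace ℝ (Fin N)) :
    inner ℝ (gradient H x) y = fderiv ℝ H x y := by
  rw [← toDual_gradient, InnerProductSpace.toDual_apply_apply]

lemma hasDerivAt_line (hH : IsFinslerMinkowskiNorm H) {x : EuclideanSpace ℝ (Fin N)} (hx : x ≠ 0)
    (y : EuclideanSpace ℝ (Fin N)) :
    HasDerivAt (fun t : ℝ => H (x + t • y)) (inner ℝ (gradient H x) y) 0 := by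
  have h1 : HasDerivAt (fun t : ℝ => x + t • y) y 0 := by
    simpa using ((hasDerivAt_id (0:ℝ)).smul_const y).const_add x
  have h2 : HasFDerivAt H (fderiv ℝ H x) (x + (0:ℝ) • y) := by
    simpa using (hH.differentiableAt hx).hasFDerivAt
  rw [inner_gradient]
  exact h2.comp_hasDerivAt 0 h1

lemma inner_gradient_le (hH : IsFinslerMinkowskiNorm H) {x : EuclideanSpace ℝ (Fin N)} (hx : x ≠ 0)
    (y : EuclideanSpace ℝ (Fin N)) : inner ℝ (gradient H x) y ≤ H y := by
  have h := (hH.hasDerivAt_line hx y).tendsto_slope_zero_right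
  refine le_of_tendsto h ?_
  filter_upwards [self_mem_nhdsWithin] with t ht
  have ht' : (0:ℝ) < t := ht
  have h1 := hH.add_le x (t • y)
  rw [hH.homogeneous, abs_of_pos ht'] at h1
  simp only [zero_add, zero_smul, add_zero, smul_eq_mul]
  rw [inv_mul_le_iff₀ ht']
  linarith

lemma abs_inner_gradient_le (hH : IsFinslerMinkowskiNorm H) {x : EuclideanSpace ℝ (Fin N)}
    (hx : x ≠ 0) (y : EuclideanSpace ℝ (Fin N)) : |inner ℝ (gradient H x) y| ≤ H y := by
  refine abs_le.2 ⟨?_, hH.inner_gradient_le hx y⟩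
  have := hH.inner_gradient_le hx (-y)
  rw [inner_neg_right, hH.map_neg] at this
  linarith

/-- Euler's identity. -/
lemma inner_gradient_self (hH : IsFinslerMinkowskiNorm H) {x : EuclideanSpace ℝ (Fin N)}
    (hx : x ≠ 0) : inner ℝ (gradient H x) x = H x := by
  refine le_antisymm (hH.inner_gradient_le hx x) ?_
  have h := (hH.hasDerivAt_line hx x).tendsto_slope_zero_right
  refine ge_of_tendsto h ?_
  filter_upwards [self_mem_nhdsWithin] with t ht
  have ht' : (0:ℝ) < t := ht
  have h1 : x + t • x = (1 + t) • x := by rw [add_smul, one_smul]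
  simp only [zero_add, zero_smul, add_zero, smul_eq_mul]
  rw [h1, hH.homogeneous, abs_of_pos (by positivity)]
  apply le_of_eq
  field_simp
  ring

lemma hasDerivAt_rpow (hH : IsFinslerMinkowskiNorm H) {p : ℝ} (hp : 1 < p)
    (A B : EuclideanSpace ℝ (Fin N)) (t : ℝ) :
    HasDerivAt (fun t : ℝ => H (A + t • B) ^ p)
      (p * (H (A + t • B) ^ (p - 1) * inner ℝ (gradient H (A + t • B)) B)) t := by
  by_cases h0 : A + t • B = 0
  · rw [h0, hH.map_zero, Real.zero_rpow (by linarith), zero_mul, mul_zero]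
    have h1 : (fun r : ℝ => H (A + r • B) ^ p) = fun r => |r - t| ^ p * H B ^ p := by
      ext r
      have : A + r • B = (r - t) • B := by
        rw [sub_smul, eq_sub_iff_add_eq, add_right_comm, h0, zero_add]
      rw [this, hH.homogeneous, Real.mul_rpow (abs_nonneg _) (hH.nonneg _)]
    rw [h1]
    have h2 := HasDerivAt.comp t (h₂ := fun r : ℝ => |r| ^ p) (h := fun r : ℝ => r - t)
      (hasDerivAt_abs_rpow (t - t) hp) ((hasDerivAt_id t).sub_const t)
    have h3 := h2.mul_const (H B ^ p)
    simpa [Function.comp_def] using h3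
  · have h1 : HasDerivAt (fun t : ℝ => A + t • B) B t := by
      simpa using ((hasDerivAt_id t).smul_const B).const_add A
    have h2 := (hH.differentiableAt h0).hasFDerivAt.comp_hasDerivAt t h1
    rw [← inner_gradient] at h2
    have h3 := h2.rpow_const (p := p) (Or.inr hp.le)
    refine HasDerivAt.congr_deriv h3 ?_
    change inner ℝ (gradient H (A + t • B)) B * p * H (A + t • B) ^ (p - 1) =
      p * (H (A + t • B) ^ (p - 1) * inner ℝ (gradient H (A + t • B)) B)
    ring

lemma measurable_gradient : Measurable (gradient H) :=
  (InnerProductSpace.toDual ℝ (EuclideanSpace ℝ (Fin N))).symm.continuous.measurable.comp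
    (measurable_fderiv ℝ H)

end IsFinslerMinkowskiNorm

/-! ### The Sobolev space `W₀^{1,p}(Ω)` -/

section Sobolev

variable {N : ℕ} {Ω : Set (EuclideanSpace ℝ (Fin N))} {p : ℝ}
  {u v : EuclideanSpace ℝ (Fin N) → ℝ} {G : EuclideanSpace ℝ (Fin N) → EuclideanSpace ℝ (Fin N)}

lemma IsWeakGradient.hasWeakDeriv (h : IsWeakGradient u G) (e : EuclideanSpace ℝ (Fin N)) :
    HasWeakDeriv volume e u (fun x => inner ℝ (G x) e) :=
  fun φ hφ hc => h.2.2 φ hφ hc e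

lemma LocallyIntegrable.inner_const' (h : LocallyIntegrable G volume)
    (e : EuclideanSpace ℝ (Fin N)) : LocallyIntegrable (fun x => (inner ℝ (G x) e : ℝ)) volume := by
  intro x
  obtain ⟨U, hU, hi⟩ := h x
  exact ⟨U, hU, Integrable.inner_const hi e⟩

lemma ae_eq_of_inner_basis {G G' : EuclideanSpace ℝ (Fin N) → EuclideanSpace ℝ (Fin N)}
    (h : ∀ e, (fun x => (inner ℝ (G x) e : ℝ)) =ᵐ[volume] fun x => inner ℝ (G' x) e) :
    G =ᵐ[volume] G' := by
  have h2 : ∀ᵐ x, ∀ i : Fin N, (inner ℝ (G x) (EuclideanSpace.single i (1:ℝ)) : ℝ) =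
      inner ℝ (G' x) (EuclideanSpace.single i (1:ℝ)) := ae_all_iff.2 fun i => h _
  filter_upwards [h2] with x hx
  ext i
  simpa [EuclideanSpace.inner_single_right] using hx i

lemma IsWeakGradient.ae_eq {G' : EuclideanSpace ℝ (Fin N) → EuclideanSpace ℝ (Fin N)}
    (h : IsWeakGradient u G) (h' : IsWeakGradient u G') : G =ᵐ[volume] G' :=
  ae_eq_of_inner_basis fun e => (h.hasWeakDeriv e).unique (LocallyIntegrable.inner_const' h.2.1 e)
    (LocallyIntegrable.inner_const' h'.2.1 e) (h'.hasWeakDeriv e)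

lemma IsWeakGradient.weakGradient_ae_eq (h : IsWeakGradient u G) : weakGradient u =ᵐ[volume] G := by
  have hex : ∃ G, IsWeakGradient u G := ⟨G, h⟩
  rw [weakGradient, dif_pos hex]
  exact hex.choose_spec.ae_eq h

lemma MemW01p.memLp (h : MemW01p Ω p u) : MemLp u (ENNReal.ofReal p) volume := h.1.1

lemma MemW01p.isWeakGradient (h : MemW01p Ω p u) : IsWeakGradient u (weakGradient u) := by
  obtain ⟨G, hG, _⟩ := h.1.2
  have hex : ∃ G, IsWeakGradient u G := ⟨G, hG⟩
  rw [weakGradient, dif_pos hex]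
  exact hex.choose_spec

lemma MemW01p.memLp_weakGradient (h : MemW01p Ω p u) :
    MemLp (weakGradient u) (ENNReal.ofReal p) volume := by
  obtain ⟨G, hG, hGp⟩ := h.1.2
  exact (memLp_congr_ae hG.weakGradient_ae_eq).2 hGp

lemma MemW01p.hasWeakDeriv (h : MemW01p Ω p u) (e : EuclideanSpace ℝ (Fin N)) :
    HasWeakDeriv volume e u (fun x => inner ℝ (weakGradient u x) e) :=
  h.isWeakGradient.hasWeakDeriv e

lemma MemW01p.memLp_inner (h : MemW01p Ω p u) (e : EuclideanSpace ℝ (Fin N)) :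
    MemLp (fun x => (inner ℝ (weakGradient u x) e : ℝ)) (ENNReal.ofReal p) volume :=
  h.memLp_weakGradient.inner_const e

/-- The criterion by which membership in `W₀^{1,p}(Ω)` is proved, together with the formula for
the gradient. -/
lemma memW01p_of_hasWeakDeriv (hp : 1 ≤ p) (hu : MemLp u (ENNReal.ofReal p) volume)
    (hG : MemLp G (ENNReal.ofReal p) volume)
    (h : ∀ e, HasWeakDeriv volume e u (fun x => inner ℝ (G x) e)) (h0 : ∀ᵐ x, x ∉ Ω → u x = 0) :
    MemW01p Ω p u ∧ weakGradient u =ᵐ[volume] G := by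
  have hw : IsWeakGradient u G := ⟨locallyIntegrable_of_memLp hp hu, locallyIntegrable_of_memLp hp hG,
    fun φ hφ hc e => h e φ hφ hc⟩
  exact ⟨⟨⟨hu, G, hw, hG⟩, h0⟩, hw.weakGradient_ae_eq⟩

/-- The gradient of a Sobolev function vanishes almost everywhere on its zero set. -/
lemma MemW01p.weakGradient_eq_zero (h : MemW01p Ω p u) (hp : 1 < p) :
    ∀ᵐ x, u x = 0 → weakGradient u x = 0 := by
  have h2 : ∀ᵐ x, ∀ i : Fin N, u x = 0 →
      (inner ℝ (weakGradient u x) (EuclideanSpace.single i (1:ℝ)) : ℝ) = 0 := ae_all_iff.2 fun i =>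
    (h.hasWeakDeriv _).ae_eq_zero_of_eq_zero hp h.memLp (h.memLp_inner _)
  filter_upwards [h2] with x hx h0
  ext i
  simpa [EuclideanSpace.inner_single_right] using hx i h0

lemma MemW01p.weakGradient_eq_zero_off (h : MemW01p Ω p u) (hp : 1 < p) :
    ∀ᵐ x, x ∉ Ω → weakGradient u x = 0 := by
  filter_upwards [h.weakGradient_eq_zero hp, h.2] with x h1 h2 h3 using h1 (h2 h3)

lemma MemW01p.lin_comb (hu : MemW01p Ω p u) (hv : MemW01p Ω p v) (hp : 1 ≤ p) (a b : ℝ) :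
    MemW01p Ω p (fun x => a * u x + b * v x) ∧
      weakGradient (fun x => a * u x + b * v x) =ᵐ[volume]
        fun x => a • weakGradient u x + b • weakGradient v x := by
  refine memW01p_of_hasWeakDeriv hp ((hu.memLp.const_mul a).add (hv.memLp.const_mul b))
    ((hu.memLp_weakGradient.const_smul a).add (hv.memLp_weakGradient.const_smul b)) ?_ ?_
  · intro e φ hφ hc
    have hφ1 : ContDiff ℝ 1 φ := hφ.of_le (by exact_mod_cast le_top)
    have hDc : Continuous fun x => fderiv ℝ φ x e :=
      (hφ1.continuous_fderiv (by norm_num)).clm_apply continuous_const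
    have hDs : HasCompactSupport fun x => fderiv ℝ φ x e := hc.fderiv_apply (𝕜 := ℝ) e
    have i1 := (locallyIntegrable_of_memLp hp hu.memLp).integrable_smul_right_of_hasCompactSupport
      hDc hDs
    have i2 := (locallyIntegrable_of_memLp hp hv.memLp).integrable_smul_right_of_hasCompactSupport
      hDc hDs
    have i3 := (locallyIntegrable_of_memLp hp
      (hu.memLp_inner e)).integrable_smul_right_of_hasCompactSupport hφ.continuous hc
    have i4 := (locallyIntegrable_of_memLp hp
      (hv.memLp_inner e)).integrable_smul_right_of_hasCompactSupport hφ.continuous hc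
    simp only [smul_eq_mul] at i1 i2 i3 i4
    simp only [inner_add_left, inner_smul_left, conj_trivial, add_mul, mul_assoc]
    rw [integral_add (i1.const_mul a) (i2.const_mul b), integral_add (i3.const_mul a)
      (i4.const_mul b)]
    simp only [integral_const_mul, hu.hasWeakDeriv e φ hφ hc, hv.hasWeakDeriv e φ hφ hc]
    ring
  · filter_upwards [hu.2, hv.2] with x h1 h2 h3
    simp [h1 h3, h2 h3]

lemma MemW01p.abs (hu : MemW01p Ω p u) (hp : 1 < p) :
    MemW01p Ω p (fun x => |u x|) ∧
      weakGradient (fun x => |u x|) =ᵐ[volume]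
        fun x => ((SignType.sign (u x) : ℝ)) • weakGradient u x := by
  have hs : AEStronglyMeasurable (fun x => ((SignType.sign (u x) : ℝ))) volume := by
    have : Measurable fun t : ℝ => ((SignType.sign t : ℝ)) := by
      have h : (fun t : ℝ => ((SignType.sign t : ℝ))) =
          fun t => if 0 < t then 1 else if t < 0 then -1 else 0 := by
        ext t; rw [sign_apply]; split_ifs <;> simp
      rw [h]
      exact Measurable.ite measurableSet_Ioi measurable_const
        (Measurable.ite measurableSet_Iio measurable_const measurable_const)
    exact (this.comp_aemeasurable hu.memLp.1.aemeasurable).aestronglyMeasurable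
  refine memW01p_of_hasWeakDeriv hp.le hu.memLp.abs ?_ ?_ ?_
  · refine hu.memLp_weakGradient.mono (hs.smul hu.memLp_weakGradient.1) (ae_of_all _ fun x => ?_)
    rw [norm_smul]
    refine mul_le_of_le_one_left (norm_nonneg _) ?_
    rcases lt_trichotomy (u x) 0 with h | h | h <;> simp [h]
  · intro e
    have := (hu.hasWeakDeriv e).abs hp hu.memLp (hu.memLp_inner e)
    simpa only [inner_smul_left, conj_trivial] using this
  · filter_upwards [hu.2] with x h1 h3
    simp [h1 h3]

end Sobolev

/-! ### Truncations and quotients of Sobolev functions -/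

/-- A smooth truncation of `t` at height `k π / 2`. -/
def trunc (k t : ℝ) : ℝ := k * Real.arctan (t / k)

lemma hasDerivAt_trunc {k : ℝ} (hk : 0 < k) (t : ℝ) :
    HasDerivAt (trunc k) (1 / (1 + (t / k) ^ 2)) t := by
  have h := (((hasDerivAt_id t).div_const k).arctan).const_mul k
  refine h.congr_deriv ?_
  simp only [id]
  field_simp

lemma trunc_deriv_mem (k t : ℝ) : 0 < 1 / (1 + (t / k) ^ 2) ∧ 1 / (1 + (t / k) ^ 2) ≤ 1 := by
  refine ⟨by positivity, ?_⟩
  rw [div_le_one (by positivity)]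
  nlinarith [sq_nonneg (t / k)]

lemma trunc_zero (k : ℝ) : trunc k 0 = 0 := by simp [trunc]

lemma abs_trunc_sub_le {k : ℝ} (hk : 0 < k) (t s : ℝ) : |trunc k t - trunc k s| ≤ |t - s| := by
  have h := Convex.norm_image_sub_le_of_norm_hasDerivWithin_le (f := trunc k) (s := univ) (C := 1)
    (fun x _ => (hasDerivAt_trunc hk x).hasDerivWithinAt) (fun x _ => ?_) convex_univ (mem_univ s)
    (mem_univ t)
  · simpa using h
  · rw [Real.norm_of_nonneg (trunc_deriv_mem k x).1.le]
    exact (trunc_deriv_mem k x).2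

lemma abs_trunc_le {k : ℝ} (hk : 0 < k) (t : ℝ) : |trunc k t| ≤ |t| := by
  simpa [trunc_zero] using abs_trunc_sub_le hk t 0

lemma abs_trunc_le_const {k : ℝ} (hk : 0 < k) (t : ℝ) : |trunc k t| ≤ k * 2 := by
  rw [trunc, abs_mul, abs_of_pos hk]
  gcongr
  have h1 := Real.arctan_lt_pi_div_two (t / k)
  have h2 := Real.neg_pi_div_two_lt_arctan (t / k)
  have h3 := Real.pi_le_four
  rw [abs_le]; constructor <;> linarith

lemma trunc_pos {k t : ℝ} (hk : 0 < k) (ht : 0 < t) : 0 < trunc k t := by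
  unfold trunc
  have := Real.arctan_pos.2 (div_pos ht hk)
  positivity

/-- `k arctan (t / k) → t` as `k → ∞`. -/
lemma tendsto_trunc (t : ℝ) : Tendsto (fun n : ℕ => trunc (n + 1) t) atTop (𝓝 t) := by
  have h1 : HasDerivAt (fun r : ℝ => Real.arctan (r * t)) t 0 := by
    have := ((hasDerivAt_id (0:ℝ)).mul_const t).arctan
    simpa using this
  have h2 := h1.tendsto_slope_zero_right
  have h3 : Tendsto (fun n : ℕ => ((n:ℝ) + 1)⁻¹) atTop (𝓝[>] 0) := by
    refine tendsto_nhdsWithin_iff.2 ⟨?_, Eventually.of_forall fun n => ?_⟩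
    · simpa using tendsto_one_div_add_atTop_nhds_zero_nat (𝕜 := ℝ)
    · exact (by positivity : (0:ℝ) < ((n:ℝ) + 1)⁻¹)
  refine (h2.comp h3).congr fun n => ?_
  simp [trunc, div_eq_inv_mul]

/-- Mean value inequality for `t ↦ |t|^p`. -/
lemma abs_abs_rpow_sub_le {p M x y : ℝ} (hp : 1 < p) (hx : |x| ≤ M) (hy : |y| ≤ M) :
    |(|x| ^ p - |y| ^ p)| ≤ p * M ^ (p - 1) * |x - y| := by
  have h := Convex.norm_image_sub_le_of_norm_hasDerivWithin_le (f := fun t : ℝ => |t| ^ p)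
    (s := Icc (-M) M) (C := p * M ^ (p - 1))
    (fun t _ => (hasDerivAt_abs_rpow t hp).hasDerivWithinAt) (fun t ht => ?_) (convex_Icc _ _)
    (abs_le.1 hy) (abs_le.1 hx)
  · simpa using h
  · have h1 : |t| ≤ M := abs_le.2 ht
    rw [norm_mul, norm_mul, Real.norm_of_nonneg (by linarith), Real.norm_eq_abs, Real.norm_eq_abs,
      abs_of_nonneg (by positivity), mul_assoc]
    gcongr
    rcases eq_or_ne t 0 with rfl | h0
    · simp; exact Real.rpow_nonneg ((abs_nonneg _).trans hx) _
    · have : |t| ^ (p - 2) * |t| = |t| ^ (p - 1) := by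
        rw [← Real.rpow_add_one (by simpa using h0)]; ring_nf
      rw [this]
      exact Real.rpow_le_rpow (abs_nonneg _) h1 (by linarith)

/-- The function `|w|^p (|a| + ε)^{1-p}`, `w = trunc k b`: the test functions of Picone's inequality
are `quot p k ε (u x) (v x)`. The shift by `ε` and the truncation at height `k` make it Lipschitz in
`(a, b)`, so that no regularity of `u` or `v` is needed to use them. -/
def quot (p k ε a b : ℝ) : ℝ := |trunc k b| ^ p * (|a| + ε) ^ (1 - p)

lemma quot_nonneg {p k ε : ℝ} (hε : 0 < ε) (a b : ℝ) : 0 ≤ quot p k ε a b := by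
  unfold quot; positivity

lemma abs_rpow_one_sub_le {p ε a a' : ℝ} (hp : 1 < p) (hε : 0 < ε) :
    |(|a| + ε) ^ (1 - p) - (|a'| + ε) ^ (1 - p)| ≤ (p - 1) * ε ^ (-p) * |a - a'| := by
  have h := Convex.norm_image_sub_le_of_norm_hasDerivWithin_le (f := fun t : ℝ => t ^ (1 - p))
    (f' := fun t => (1 - p) * t ^ (1 - p - 1))
    (s := Ici ε) (C := (p - 1) * ε ^ (-p)) (x := |a'| + ε) (y := |a| + ε)
    (fun t ht => (Real.hasDerivAt_rpow_const
      (Or.inl (lt_of_lt_of_le hε ht).ne')).hasDerivWithinAt) (fun t ht => ?_) (convex_Ici _)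
    (by simp) (by simp)
  · refine h.trans ?_
    have : 0 ≤ (p - 1) * ε ^ (-p) := mul_nonneg (by linarith) (by positivity)
    gcongr
    rw [Real.norm_eq_abs, add_sub_add_right_eq_sub]
    exact abs_abs_sub_abs_le_abs_sub a a'
  · have ht' : ε ≤ t := ht
    have h0 : 0 < t := lt_of_lt_of_le hε ht
    rw [norm_mul, Real.norm_eq_abs, abs_of_neg (by linarith), Real.norm_of_nonneg (by positivity)]
    have : t ^ (1 - p - 1) ≤ ε ^ (-p) := by
      rw [show 1 - p - 1 = -p by ring]
      exact Real.rpow_le_rpow_of_nonpos hε ht' (by linarith)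
    have h1 : 0 ≤ p - 1 := by linarith
    nlinarith

lemma quot_lipschitz {p k ε : ℝ} (hp : 1 < p) (hk : 0 < k) (hε : 0 < ε) :
    ∃ L, ∀ a b a' b', |quot p k ε a b - quot p k ε a' b'| ≤ L * (|a - a'| + |b - b'|) := by
  set M := k * 2
  have hM : 0 ≤ M := by positivity
  refine ⟨p * M ^ (p - 1) * ε ^ (1 - p) + M ^ p * ((p - 1) * ε ^ (-p)), fun a b a' b' => ?_⟩
  have h1 := abs_abs_rpow_sub_le hp (abs_trunc_le_const hk b) (abs_trunc_le_const hk b')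
  have h2 := abs_rpow_one_sub_le (a := a) (a' := a') hp hε
  have h3 : (|a| + ε) ^ (1 - p) ≤ ε ^ (1 - p) :=
    Real.rpow_le_rpow_of_nonpos hε (by linarith [abs_nonneg a]) (by linarith)
  have h4 : |trunc k b'| ^ p ≤ M ^ p :=
    Real.rpow_le_rpow (abs_nonneg _) (abs_trunc_le_const hk b') (by linarith)
  have h5 := abs_trunc_sub_le hk b b'
  have e1 : quot p k ε a b - quot p k ε a' b' =
      (|trunc k b| ^ p - |trunc k b'| ^ p) * (|a| + ε) ^ (1 - p) +
      |trunc k b'| ^ p * ((|a| + ε) ^ (1 - p) - (|a'| + ε) ^ (1 - p)) := by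
    unfold quot; ring
  have hp1 : 0 ≤ p - 1 := by linarith
  have hpp : 0 ≤ p := by linarith
  rw [e1]
  refine (abs_add_le _ _).trans ?_
  rw [abs_mul, abs_mul, abs_of_nonneg (by positivity : 0 ≤ (|a| + ε) ^ (1 - p)),
    abs_of_nonneg (by positivity : 0 ≤ |trunc k b'| ^ p)]
  calc _ ≤ (p * M ^ (p - 1) * |b - b'|) * ε ^ (1 - p) + M ^ p * ((p - 1) * ε ^ (-p) * |a - a'|) := by
        gcongr
        exact h1.trans (by gcongr)
    _ ≤ _ := by
        have t1 : 0 ≤ p * M ^ (p - 1) * ε ^ (1 - p) := by positivity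
        have t2 : 0 ≤ M ^ p * ((p - 1) * ε ^ (-p)) := by positivity
        nlinarith [abs_nonneg (a - a'), abs_nonneg (b - b'), mul_nonneg t1 (abs_nonneg (a - a')),
          mul_nonneg t2 (abs_nonneg (b - b'))]

section Sobolev

variable {N : ℕ} {Ω : Set (EuclideanSpace ℝ (Fin N))} {p : ℝ}
  {u v : EuclideanSpace ℝ (Fin N) → ℝ}

lemma continuous_trunc (k : ℝ) : Continuous (trunc k) := by
  unfold trunc; fun_prop

/-- The gradient of the Picone test function `|w|^p (|u| + ε)^{1-p}`, `w = trunc k v`. The sign of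
`u` is the derivative of the absolute value; its value on `{u = 0}` is irrelevant, as `∇u = 0`
there. -/
def quotGradient (p k ε : ℝ) (u v : EuclideanSpace ℝ (Fin N) → ℝ) (x : EuclideanSpace ℝ (Fin N)) :
    EuclideanSpace ℝ (Fin N) :=
  ((|u x| + ε) ^ (1 - p) * (p * |trunc k (v x)| ^ (p - 2) * trunc k (v x) *
      (1 / (1 + (v x / k) ^ 2)))) • weakGradient v x +
    (|trunc k (v x)| ^ p * ((1 - p) * (|u x| + ε) ^ (-p) * SignType.sign (u x))) • weakGradient u x

/-- The functions that Picone's inequality needs as test functions are admissible. -/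
lemma MemW01p.quot_comp (hu : MemW01p Ω p u) (hv : MemW01p Ω p v) (hp : 1 < p) {k ε : ℝ}
    (hk : 0 < k) (hε : 0 < ε) :
    MemW01p Ω p (fun x => quot p k ε (u x) (v x)) ∧
      weakGradient (fun x => quot p k ε (u x) (v x)) =ᵐ[volume] quotGradient p k ε u v := by
  obtain ⟨L, hL⟩ := quot_lipschitz hp hk hε
  have hL0 : 0 ≤ L := by
    have := (abs_nonneg _).trans (hL 1 0 0 0)
    simpa using this
  have hTm : AEStronglyMeasurable (fun x => trunc k (v x)) volume :=
    (continuous_trunc k).comp_aestronglyMeasurable hv.memLp.1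
  have hm : AEStronglyMeasurable (fun x => quot p k ε (u x) (v x)) volume := by
    have h1 : AEMeasurable (fun x => |trunc k (v x)| ^ p) volume :=
      hTm.aemeasurable.abs.pow_const p
    have h2 : AEMeasurable (fun x => (|u x| + ε) ^ (1 - p)) volume :=
      (hu.memLp.1.aemeasurable.abs.add_const ε).pow_const _
    exact (h1.mul h2).aestronglyMeasurable
  have hmem : MemLp (fun x => quot p k ε (u x) (v x)) (ENNReal.ofReal p) volume := by
    refine (hv.memLp.const_mul L).mono hm (ae_of_all _ fun x => ?_)
    have := hL (u x) (v x) (u x) 0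
    have h0 : quot p k ε (u x) 0 = 0 := by
      simp [quot, trunc_zero, Real.zero_rpow (by linarith : p ≠ 0)]
    simpa [h0, abs_of_nonneg hL0] using this
  have hlim : ∀ e, ∀ᵐ x, Tendsto (fun t : ℝ => t⁻¹ *
      (quot p k ε (u x + t * inner ℝ (weakGradient u x) e) (v x + t * inner ℝ (weakGradient v x) e) -
        quot p k ε (u x) (v x))) (𝓝[>] 0) (𝓝 (inner ℝ (quotGradient p k ε u v x) e)) := by
    intro e
    filter_upwards [hu.weakGradient_eq_zero hp] with x hx
    set α : ℝ := inner ℝ (weakGradient u x) e with hα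
    set β : ℝ := inner ℝ (weakGradient v x) e with hβ
    have h1 : HasDerivAt (fun t : ℝ => v x + t * β) β 0 := by
      simpa using ((hasDerivAt_id (0:ℝ)).mul_const β).const_add (v x)
    have h2 := (hasDerivAt_trunc hk (v x + 0 * β)).comp 0 h1
    have h3 := HasDerivAt.comp (h₂ := fun s : ℝ => |s| ^ p) 0
      (hasDerivAt_abs_rpow (trunc k (v x + 0 * β)) hp) h2
    have h4 : HasDerivAt (fun t : ℝ => |u x + t * α|) (SignType.sign (u x) * α) 0 := by
      by_cases h0 : u x = 0
      · have hα0 : α = 0 := by rw [hα, hx h0, inner_zero_left]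
        simp only [h0, hα0, mul_zero, add_zero]
        exact hasDerivAt_const _ _
      · have h1 : HasDerivAt (fun t : ℝ => u x + t * α) α 0 := by
          simpa using ((hasDerivAt_id (0:ℝ)).mul_const α).const_add (u x)
        have h2 := (hasDerivAt_abs (x := u x + 0 * α) (by simpa using h0)).comp 0 h1
        rw [zero_mul, add_zero] at h2
        exact h2
    have hpos : |u x + 0 * α| + ε ≠ 0 := by positivity
    have h5 := (h4.add_const ε).rpow_const (p := 1 - p) (Or.inl hpos)
    have h6 := HasDerivAt.mul h3 h5
    have h7 := h6.tendsto_slope_zero_right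
    have e1 : (inner ℝ (quotGradient p k ε u v x) e : ℝ) =
        (|u x| + ε) ^ (1 - p) * (p * |trunc k (v x)| ^ (p - 2) * trunc k (v x) *
          (1 / (1 + (v x / k) ^ 2))) * β +
        |trunc k (v x)| ^ p * ((1 - p) * (|u x| + ε) ^ (-p) * SignType.sign (u x)) * α := by
      rw [quotGradient, inner_add_left, inner_smul_left, inner_smul_left, conj_trivial, conj_trivial]
    rw [e1]
    convert h7 using 2
    · simp [quot]
    · simp only [Function.comp_apply, zero_mul, add_zero]
      rw [show 1 - p - 1 = -p by ring]
      ring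
  have hcomp := fun e => HasWeakDeriv.comp_lipschitz hp hL (hu.hasWeakDeriv e) (hv.hasWeakDeriv e)
      hu.memLp hv.memLp (hu.memLp_inner e) (hv.memLp_inner e)
      (locallyIntegrable_of_memLp hp.le hmem) (hlim e)
  refine memW01p_of_hasWeakDeriv hp.le hmem ?_ (fun e => (hcomp e).2) ?_
  · refine MemLp.of_eval_piLp fun i => ?_
    have := (hcomp (EuclideanSpace.single i (1:ℝ))).1
    simpa [EuclideanSpace.inner_single_right] using this
  · filter_upwards [hv.2] with x h1 h3
    simp [quot, h1 h3, trunc_zero, Real.zero_rpow (by linarith : p ≠ 0)]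

/-- Smooth functions supported in a bounded set `Ω`. -/
lemma memW01p_of_contDiff {ψ : EuclideanSpace ℝ (Fin N) → ℝ} (hp : 1 ≤ p) (hψ : ContDiff ℝ ∞ ψ)
    (hc : HasCompactSupport ψ) (h0 : ∀ x ∉ Ω, ψ x = 0) : MemW01p Ω p ψ := by
  have hψ1 : ContDiff ℝ 1 ψ := hψ.of_le (by exact_mod_cast le_top)
  have hin : ∀ x e, (inner ℝ (gradient ψ x) e : ℝ) = fderiv ℝ ψ x e := fun x e => by
    rw [← toDual_gradient, InnerProductSpace.toDual_apply_apply]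
  have hDc : Continuous (gradient ψ) :=
    (InnerProductSpace.toDual ℝ (EuclideanSpace ℝ (Fin N))).symm.continuous.comp
      (hψ1.continuous_fderiv (by norm_num))
  have hDs : HasCompactSupport (gradient ψ) := by
    have := hc.fderiv (𝕜 := ℝ)
    exact this.comp_left (g := (InnerProductSpace.toDual ℝ (EuclideanSpace ℝ (Fin N))).symm) (by simp)
  refine (memW01p_of_hasWeakDeriv (G := gradient ψ) hp (hψ.continuous.memLp_of_hasCompactSupport hc)
    (hDc.memLp_of_hasCompactSupport hDs) ?_ (ae_of_all _ h0)).1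
  intro e φ hφ hφc
  have hφ1 : ContDiff ℝ 1 φ := hφ.of_le (by exact_mod_cast le_top)
  simp only [hin]
  have c1 : Continuous fun x => fderiv ℝ φ x e :=
    (hφ1.continuous_fderiv (by norm_num)).clm_apply continuous_const
  have c2 : Continuous fun x => fderiv ℝ ψ x e :=
    (hψ1.continuous_fderiv (by norm_num)).clm_apply continuous_const
  refine integral_mul_fderiv_eq_neg_fderiv_mul_of_integrable ?_ ?_ ?_ ?_ ?_
  · exact (c2.mul hφ.continuous).integrable_of_hasCompactSupport hφc.mul_left
  · exact (hψ.continuous.mul c1).integrable_of_hasCompactSupport hc.mul_right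
  · exact (hψ.continuous.mul hφ.continuous).integrable_of_hasCompactSupport hc.mul_right
  · exact fun x _ => (hψ1.differentiable (by norm_num)) x
  · exact fun x _ => (hφ1.differentiable (by norm_num)) x

end Sobolev

/-! ### The energy -/

lemma add_rpow_le_two_rpow_mul {p a b : ℝ} (hp : 0 ≤ p) (ha : 0 ≤ a) (hb : 0 ≤ b) :
    (a + b) ^ p ≤ 2 ^ p * (a ^ p + b ^ p) := by
  have h1 : a + b ≤ 2 * max a b := by linarith [le_max_left a b, le_max_right a b]
  have hm : 0 ≤ max a b := ha.trans (le_max_left _ _)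
  calc (a + b) ^ p ≤ (2 * max a b) ^ p := Real.rpow_le_rpow (by positivity) h1 hp
    _ = 2 ^ p * (max a b) ^ p := Real.mul_rpow (by norm_num) hm
    _ ≤ 2 ^ p * (a ^ p + b ^ p) := by
        gcongr
        rcases max_cases a b with ⟨h, _⟩ | ⟨h, _⟩ <;> rw [h]
        · exact le_add_of_nonneg_right (by positivity)
        · exact le_add_of_nonneg_left (by positivity)

lemma enorm_rpow_eq_ofReal {F : Type*} [NormedAddCommGroup F] {p : ℝ} (hp : 0 ≤ p) (a : F) :
    ‖a‖ₑ ^ p = ENNReal.ofReal (‖a‖ ^ p) := by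
  rw [← ofReal_norm, ENNReal.ofReal_rpow_of_nonneg (norm_nonneg _) hp]

lemma integrable_norm_rpow_of_memLp {α F : Type*} [MeasurableSpace α] [NormedAddCommGroup F]
    {ρ : Measure α} {p : ℝ} (hp : 0 < p) {u : α → F} (hu : MemLp u (ENNReal.ofReal p) ρ) :
    Integrable (fun x => ‖u x‖ ^ p) ρ := by
  have := hu.integrable_norm_rpow (by simpa using hp) (by simp)
  rwa [ENNReal.toReal_ofReal hp.le] at this

section Nonlocal

variable {N : ℕ} {Ω : Set (EuclideanSpace ℝ (Fin N))} {p s : ℝ}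
  {u v φ : EuclideanSpace ℝ (Fin N) → ℝ} {H : EuclideanSpace ℝ (Fin N) → ℝ}

lemma kernel_nonneg (z : EuclideanSpace ℝ (Fin N) × EuclideanSpace ℝ (Fin N)) :
    0 ≤ kernel N p s z := by
  unfold kernel; positivity

lemma measurable_kernel : Measurable (kernel N p s) := by
  unfold kernel
  exact (measurable_fst.sub measurable_snd).norm.pow_const _

/-- `min(1, |h|^p) |h|^{-N-ps}` is integrable: this is where `0 < s < 1` enters. -/
lemma integrable_min_mul_kernel (hN : 1 ≤ N) (hp : 1 < p) (hs₀ : 0 < s) (hs₁ : s < 1) :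
    Integrable (fun h : EuclideanSpace ℝ (Fin N) =>
      min 1 (‖h‖ ^ p) * ‖h‖ ^ (-(N : ℝ) - p * s)) volume := by
  have : Nonempty (Fin N) := ⟨⟨0, hN⟩⟩
  have hm : Measurable fun r : ℝ => min 1 (r ^ p) * r ^ (-(N : ℝ) - p * s) := by fun_prop
  have hps : 0 < p * s := by positivity
  rw [integrable_fun_norm_addHaar volume (f := fun r : ℝ => min 1 (r ^ p) * r ^ (-(N : ℝ) - p * s)),
    finrank_euclideanSpace_fin, ← Ioc_union_Ioi_eq_Ioi (zero_le_one' ℝ)]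
  have hpow : ∀ y : ℝ, 0 < y → y ^ (N - 1) = y ^ ((N : ℝ) - 1) := fun y hy => by
    rw [← Real.rpow_natCast, Nat.cast_sub hN, Nat.cast_one]
  refine IntegrableOn.union ?_ ?_
  · have h1 : IntegrableOn (fun y : ℝ => y ^ (p - p * s - 1)) (Ioc 0 1) := by
      have := (intervalIntegral.intervalIntegrable_rpow' (a := 0) (b := 1)
        (r := p - p * s - 1) (by nlinarith)).1
      exact this
    refine h1.congr_fun (fun y hy => ?_) measurableSet_Ioc
    have hy0 : 0 < y := hy.1
    have : y ^ p ≤ 1 := Real.rpow_le_one hy0.le hy.2 (by linarith)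
    simp only [smul_eq_mul]
    rw [min_eq_right this, hpow y hy0, ← Real.rpow_add hy0, ← Real.rpow_add hy0]
    congr 1; ring
  · have h1 : IntegrableOn (fun y : ℝ => y ^ (-1 - p * s)) (Ioi 1) :=
      integrableOn_Ioi_rpow_of_lt (by linarith) one_pos
    refine h1.congr_fun (fun y hy => ?_) measurableSet_Ioi
    have hy1 : 1 < y := hy
    have hy0 : 0 < y := by linarith
    have : 1 ≤ y ^ p := Real.one_le_rpow hy1.le (by linarith)
    simp only [smul_eq_mul]
    rw [min_eq_left this, hpow y hy0, one_mul, ← Real.rpow_add hy0]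
    congr 1; ring

lemma aestronglyMeasurable_sub_prod (hu : AEStronglyMeasurable u volume) :
    AEStronglyMeasurable (fun z : EuclideanSpace ℝ (Fin N) × EuclideanSpace ℝ (Fin N) =>
      u z.1 - u z.2) volume :=
  hu.comp_fst.sub hu.comp_snd

lemma aestronglyMeasurable_gagliardo (hu : AEStronglyMeasurable u volume) :
    AEStronglyMeasurable (fun z : EuclideanSpace ℝ (Fin N) × EuclideanSpace ℝ (Fin N) =>
      |u z.1 - u z.2| ^ p * kernel N p s z) volume :=
  (((aestronglyMeasurable_sub_prod hu).aemeasurable.abs.pow_const p).mul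
    measurable_kernel.aemeasurable).aestronglyMeasurable

/-- Translations by `h` move `u` in `L^p` by at most `C min(1, |h|)`: the triangle inequality for
large `h`, the gradient bound for small `h`. -/
lemma lintegral_translate_rpow_le (hp : 1 < p) (hu : MemW01p Ω p u)
    (h : EuclideanSpace ℝ (Fin N)) :
    ∫⁻ x, ‖u x - u (x + h)‖ₑ ^ p ≤ (2 ^ p * (2 * ∫⁻ x, ‖u x‖ₑ ^ p) +
      ∫⁻ x, ‖weakGradient u x‖ₑ ^ p) * ENNReal.ofReal (min 1 (‖h‖ ^ p)) := by
  have hp0 : 0 < p := by linarith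
  rcases le_total 1 (‖h‖ ^ p) with hh | hh
  · rw [min_eq_left hh, ENNReal.ofReal_one, mul_one]
    refine le_trans ?_ le_self_add
    calc ∫⁻ x, ‖u x - u (x + h)‖ₑ ^ p ≤ ∫⁻ x, 2 ^ p * (‖u x‖ₑ ^ p + ‖u (x + h)‖ₑ ^ p) := by
          refine lintegral_mono fun x => ?_
          rw [enorm_rpow_eq_ofReal hp0.le, enorm_rpow_eq_ofReal hp0.le, enorm_rpow_eq_ofReal hp0.le,
            ← ENNReal.ofReal_add (by positivity) (by positivity),
            show (2 : ℝ≥0∞) ^ p = ENNReal.ofReal (2 ^ p) by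
              rw [← ENNReal.ofReal_rpow_of_pos (by norm_num)]; simp,
            ← ENNReal.ofReal_mul (by positivity)]
          refine ENNReal.ofReal_le_ofReal ?_
          refine le_trans ?_ (add_rpow_le_two_rpow_mul hp0.le (norm_nonneg _) (norm_nonneg _))
          exact Real.rpow_le_rpow (norm_nonneg _) (norm_sub_le _ _) hp0.le
      _ = _ := by
          rw [lintegral_const_mul' _ _ (by simp),
            lintegral_add_left' (hu.memLp.1.enorm.pow_const p),
            lintegral_add_right_eq_self (fun x => ‖u x‖ₑ ^ p) h, two_mul]
  · rw [min_eq_right hh, add_mul]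
    refine le_trans ?_ le_add_self
    have h1 := lintegral_translate_sub_le hp.le (hu.hasWeakDeriv h) hu.memLp (hu.memLp_inner h)
    calc ∫⁻ x, ‖u x - u (x + h)‖ₑ ^ p = ∫⁻ x, ‖u (x + h) - u x‖ₑ ^ p := by
          congr 1; ext x; rw [← enorm_neg, neg_sub]
      _ ≤ ∫⁻ x, ‖(inner ℝ (weakGradient u x) h : ℝ)‖ₑ ^ p := h1
      _ ≤ ∫⁻ x, ‖weakGradient u x‖ₑ ^ p * ENNReal.ofReal (‖h‖ ^ p) := by
          refine lintegral_mono fun x => ?_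
          rw [← enorm_rpow_eq_ofReal hp0.le, ← ENNReal.mul_rpow_of_nonneg _ _ hp0.le]
          gcongr
          rw [← ofReal_norm, ← ofReal_norm, ← ofReal_norm, ← ENNReal.ofReal_mul (norm_nonneg _)]
          exact ENNReal.ofReal_le_ofReal (norm_inner_le_norm _ _)
      _ = _ := lintegral_mul_const' _ _ ENNReal.ofReal_ne_top

/-- `W^{1,p} ⊂ W^{s,p}`: the nonlocal part of the energy is finite. -/
lemma MemW01p.integrable_gagliardo (hN : 1 ≤ N) (hp : 1 < p) (hs₀ : 0 < s) (hs₁ : s < 1)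
    (hu : MemW01p Ω p u) :
    Integrable (fun z : EuclideanSpace ℝ (Fin N) × EuclideanSpace ℝ (Fin N) =>
      |u z.1 - u z.2| ^ p * kernel N p s z) volume := by
  have hp0 : 0 < p := by linarith
  have hm := aestronglyMeasurable_gagliardo (p := p) (s := s) hu.memLp.1
  refine ⟨hm, ?_⟩
  set F := fun z : EuclideanSpace ℝ (Fin N) × EuclideanSpace ℝ (Fin N) =>
      ‖|u z.1 - u z.2| ^ p * kernel N p s z‖ₑ with hF
  have hT : MeasurePreserving (fun z : EuclideanSpace ℝ (Fin N) × EuclideanSpace ℝ (Fin N) =>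
      (z.1, z.1 + z.2)) volume volume := measurePreserving_prod_add volume volume
  have hFm : AEMeasurable F volume := hm.enorm
  have e1 : ∫⁻ z, F z = ∫⁻ z : EuclideanSpace ℝ (Fin N) × EuclideanSpace ℝ (Fin N),
      F (z.1, z.1 + z.2) := by
    rw [← hT.map_eq, lintegral_map' (by rwa [hT.map_eq]) hT.measurable.aemeasurable, hT.map_eq]
  have hFm2 : AEMeasurable (fun z : EuclideanSpace ℝ (Fin N) × EuclideanSpace ℝ (Fin N) =>
      F (z.1, z.1 + z.2)) volume := hFm.comp_quasiMeasurePreserving hT.quasiMeasurePreserving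
  unfold HasFiniteIntegral
  rw [e1, Measure.volume_eq_prod, lintegral_prod_symm _ hFm2]
  set C := 2 ^ p * (2 * ∫⁻ x, ‖u x‖ₑ ^ p) + ∫⁻ x, ‖weakGradient u x‖ₑ ^ p with hC
  have hCt : C < ⊤ := by
    have h1 := ((memLp_ofReal_iff hp0).1 hu.memLp).2
    have h2 := ((memLp_ofReal_iff hp0).1 hu.memLp_weakGradient).2
    rw [hC]
    refine ENNReal.add_lt_top.2 ⟨ENNReal.mul_lt_top ?_ (ENNReal.mul_lt_top (by simp) h1), h2⟩
    exact ENNReal.rpow_lt_top_of_nonneg hp0.le (by simp)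
  have hb : ∀ h : EuclideanSpace ℝ (Fin N), ∫⁻ x, F (x, x + h) ≤
      C * ENNReal.ofReal (min 1 (‖h‖ ^ p) * ‖h‖ ^ (-(N : ℝ) - p * s)) := by
    intro h
    have e2 : ∀ x, F (x, x + h) = ‖u x - u (x + h)‖ₑ ^ p *
        ENNReal.ofReal (‖h‖ ^ (-(N : ℝ) - p * s)) := by
      intro x
      simp only [hF, kernel, sub_add_cancel_left, norm_neg]
      rw [enorm_mul, enorm_rpow_eq_ofReal hp0.le, Real.enorm_of_nonneg (by positivity),
        Real.enorm_of_nonneg (by positivity), Real.norm_eq_abs]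
    simp only [e2]
    rw [lintegral_mul_const' _ _ ENNReal.ofReal_ne_top, ENNReal.ofReal_mul (by positivity), ← mul_assoc]
    gcongr
    exact lintegral_translate_rpow_le hp hu h
  refine (lintegral_mono hb).trans_lt ?_
  rw [lintegral_const_mul' _ _ hCt.ne]
  exact ENNReal.mul_lt_top hCt (integrable_min_mul_kernel hN hp hs₀ hs₁).lintegral_lt_top

lemma IsFinslerMinkowskiNorm.integrable_rpow (hH : IsFinslerMinkowskiNorm H) (hp : 1 < p)
    (hu : MemW01p Ω p u) : Integrable (fun x => H (weakGradient u x) ^ p) volume := by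
  obtain ⟨C₁, C₂, _, hC, hb⟩ := hH.equivalent
  have hp0 : 0 < p := by linarith
  refine ((integrable_norm_rpow_of_memLp hp0 hu.memLp_weakGradient).const_mul (C₂ ^ p)).mono' ?_ ?_
  · exact ((hH.continuous.comp_aestronglyMeasurable
      hu.memLp_weakGradient.1).aemeasurable.pow_const p).aestronglyMeasurable
  · refine ae_of_all _ fun x => ?_
    rw [Real.norm_of_nonneg (Real.rpow_nonneg (hH.nonneg _) _),
      ← Real.mul_rpow hC.le (norm_nonneg _)]
    exact Real.rpow_le_rpow (hH.nonneg _) (hb _).2 hp0.le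

lemma energy_nonneg (hH : IsFinslerMinkowskiNorm H) : 0 ≤ energy Ω H p s u := by
  unfold energy
  refine add_nonneg (integral_nonneg fun x => Real.rpow_nonneg (hH.nonneg _) _)
    (integral_nonneg fun z => mul_nonneg (by positivity) (kernel_nonneg z))

lemma half_add_rpow_le {a b : ℝ} (hp : 1 ≤ p) (ha : 0 ≤ a) (hb : 0 ≤ b) :
    ((a + b) / 2) ^ p ≤ (a ^ p + b ^ p) / 2 := by
  have h := (convexOn_rpow hp).2 (mem_Ici.2 ha) (mem_Ici.2 hb) (by norm_num : (0:ℝ) ≤ 1 / 2)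
    (by norm_num : (0:ℝ) ≤ 1 / 2) (by norm_num)
  simp only [smul_eq_mul] at h
  calc ((a + b) / 2) ^ p = (1 / 2 * a + 1 / 2 * b) ^ p := by ring_nf
    _ ≤ _ := h
    _ = _ := by ring

/-- Convexity of the energy, at midpoints. -/
lemma energy_midpoint_le (hN : 1 ≤ N) (hp : 1 < p) (hs₀ : 0 < s) (hs₁ : s < 1)
    (hH : IsFinslerMinkowskiNorm H) (hu : MemW01p Ω p u) (hv : MemW01p Ω p v) :
    energy Ω H p s (fun x => 1 / 2 * u x + 1 / 2 * v x) ≤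
      (energy Ω H p s u + energy Ω H p s v) / 2 := by
  obtain ⟨hw, hg⟩ := hu.lin_comb hv hp.le (1 / 2) (1 / 2)
  have i1 := (hH.integrable_rpow hp hu).restrict (s := Ω)
  have i2 := (hH.integrable_rpow hp hv).restrict (s := Ω)
  have i3 := (hH.integrable_rpow hp hw).restrict (s := Ω)
  have j1 := hu.integrable_gagliardo hN hp hs₀ hs₁
  have j2 := hv.integrable_gagliardo hN hp hs₀ hs₁
  have j3 := hw.integrable_gagliardo hN hp hs₀ hs₁
  have k1 : ∫ x in Ω, H (weakGradient (fun x => 1 / 2 * u x + 1 / 2 * v x) x) ^ p ≤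
      ∫ x in Ω, (H (weakGradient u x) ^ p + H (weakGradient v x) ^ p) / 2 := by
    refine integral_mono_ae i3 ((i1.add i2).div_const 2) ?_
    filter_upwards [ae_restrict_of_ae hg] with x hx
    rw [hx]
    refine le_trans ?_ (half_add_rpow_le hp.le (hH.nonneg _) (hH.nonneg _))
    refine Real.rpow_le_rpow (hH.nonneg _) ?_ (by linarith)
    refine (hH.add_le _ _).trans ?_
    rw [hH.homogeneous, hH.homogeneous, abs_of_pos (by norm_num)]
    linarith
  have k2 : ∫ z : EuclideanSpace ℝ (Fin N) × EuclideanSpace ℝ (Fin N),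
      |(1 / 2 * u z.1 + 1 / 2 * v z.1) - (1 / 2 * u z.2 + 1 / 2 * v z.2)| ^ p * kernel N p s z ≤
      ∫ z : EuclideanSpace ℝ (Fin N) × EuclideanSpace ℝ (Fin N),
        (|u z.1 - u z.2| ^ p * kernel N p s z + |v z.1 - v z.2| ^ p * kernel N p s z) / 2 := by
    refine integral_mono j3 ((j1.add j2).div_const 2) fun z => ?_
    have h1 := half_add_rpow_le hp.le (abs_nonneg (u z.1 - u z.2)) (abs_nonneg (v z.1 - v z.2))
    have h2 : |(1 / 2 * u z.1 + 1 / 2 * v z.1) - (1 / 2 * u z.2 + 1 / 2 * v z.2)| ≤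
        (|u z.1 - u z.2| + |v z.1 - v z.2|) / 2 := by
      rw [show (1 / 2 * u z.1 + 1 / 2 * v z.1) - (1 / 2 * u z.2 + 1 / 2 * v z.2) =
        ((u z.1 - u z.2) + (v z.1 - v z.2)) / 2 by ring, abs_div, abs_two]
      gcongr
      exact abs_add_le _ _
    calc _ ≤ (|u z.1 - u z.2| ^ p + |v z.1 - v z.2| ^ p) / 2 * kernel N p s z :=
          mul_le_mul_of_nonneg_right ((Real.rpow_le_rpow (abs_nonneg _) h2 (by linarith)).trans h1)
            (kernel_nonneg z)
      _ = _ := by ring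
  rw [integral_div, integral_add i1 i2] at k1
  rw [integral_div, integral_add j1 j2] at k2
  unfold energy
  linarith

lemma MemW01p.const_mul (hu : MemW01p Ω p u) (hp : 1 ≤ p) (c : ℝ) :
    MemW01p Ω p (fun x => c * u x) ∧
      weakGradient (fun x => c * u x) =ᵐ[volume] fun x => c • weakGradient u x := by
  have := hu.lin_comb hu hp c 0
  simpa using this

lemma energy_const_mul (hp : 1 < p) (hH : IsFinslerMinkowskiNorm H) (hu : MemW01p Ω p u) (c : ℝ) :
    energy Ω H p s (fun x => c * u x) = |c| ^ p * energy Ω H p s u := by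
  obtain ⟨_, hg⟩ := hu.const_mul hp.le c
  have k1 : ∫ x in Ω, H (weakGradient (fun x => c * u x) x) ^ p =
      |c| ^ p * ∫ x in Ω, H (weakGradient u x) ^ p := by
    rw [← integral_const_mul]
    refine integral_congr_ae ?_
    filter_upwards [ae_restrict_of_ae hg] with x hx
    rw [hx, hH.homogeneous, Real.mul_rpow (abs_nonneg _) (hH.nonneg _)]
  have k2 : ∫ z : EuclideanSpace ℝ (Fin N) × EuclideanSpace ℝ (Fin N),
      |c * u z.1 - c * u z.2| ^ p * kernel N p s z =
      |c| ^ p * ∫ z : EuclideanSpace ℝ (Fin N) × EuclideanSpace ℝ (Fin N),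
        |u z.1 - u z.2| ^ p * kernel N p s z := by
    rw [← integral_const_mul]
    refine integral_congr_ae (ae_of_all _ fun z => ?_)
    simp only
    rw [← mul_sub, abs_mul, Real.mul_rpow (abs_nonneg _) (abs_nonneg _), mul_assoc]
  unfold energy
  rw [k1, k2, mul_add]

lemma energy_abs_le (hN : 1 ≤ N) (hp : 1 < p) (hs₀ : 0 < s) (hs₁ : s < 1)
    (hH : IsFinslerMinkowskiNorm H) (hu : MemW01p Ω p u) :
    energy Ω H p s (fun x => |u x|) ≤ energy Ω H p s u := by
  obtain ⟨hw, hg⟩ := hu.abs hp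
  unfold energy
  refine add_le_add ?_ ?_
  · have i1 := (hH.integrable_rpow hp hw).restrict (s := Ω)
    have i2 := (hH.integrable_rpow hp hu).restrict (s := Ω)
    refine integral_mono_ae i1 i2 ?_
    filter_upwards [ae_restrict_of_ae hg] with x hx
    rw [hx, hH.homogeneous]
    refine Real.rpow_le_rpow (mul_nonneg (abs_nonneg _) (hH.nonneg _)) ?_ (by linarith)
    refine mul_le_of_le_one_left (hH.nonneg _) ?_
    rcases lt_trichotomy (u x) 0 with h | h | h <;> simp [h]
  · have j1 := hu.integrable_gagliardo hN hp hs₀ hs₁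
    have j2 := hw.integrable_gagliardo hN hp hs₀ hs₁
    refine integral_mono j2 j1 fun z => ?_
    refine mul_le_mul_of_nonneg_right (Real.rpow_le_rpow (abs_nonneg _) ?_ (by linarith))
      (kernel_nonneg z)
    exact abs_abs_sub_abs_le_abs_sub _ _

lemma MemW01p.posPart (hu : MemW01p Ω p u) (hp : 1 < p) : MemW01p Ω p (fun x => max (u x) 0) := by
  have := (hu.lin_comb (hu.abs hp).1 hp.le (1 / 2) (1 / 2)).1
  convert this using 2 with x
  rcases le_total (u x) 0 with h | h
  · rw [max_eq_right h, abs_of_nonpos h]; ring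
  · rw [max_eq_left h, abs_of_nonneg h]; ring

/-- Since `u⁺ = (u + |u|) / 2`, this is a consequence of convexity. -/
lemma energy_posPart_le (hN : 1 ≤ N) (hp : 1 < p) (hs₀ : 0 < s) (hs₁ : s < 1)
    (hH : IsFinslerMinkowskiNorm H) (hu : MemW01p Ω p u) :
    energy Ω H p s (fun x => max (u x) 0) ≤ energy Ω H p s u := by
  have h1 := energy_midpoint_le hN hp hs₀ hs₁ hH hu (hu.abs hp).1
  have h2 := energy_abs_le hN hp hs₀ hs₁ hH hu
  have e : (fun x => max (u x) 0) = fun x => 1 / 2 * u x + 1 / 2 * |u x| := by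
    ext x
    rcases le_total (u x) 0 with h | h
    · rw [max_eq_right h, abs_of_nonpos h]; ring
    · rw [max_eq_left h, abs_of_nonneg h]; ring
  rw [e]
  linarith

lemma abs_rpow_sub_two_mul (p a : ℝ) (hp : 1 < p) : |(|a| ^ (p - 2) * a)| = |a| ^ (p - 1) := by
  rcases eq_or_ne a 0 with rfl | h
  · simp [Real.zero_rpow (by linarith : p - 1 ≠ 0)]
  · rw [abs_mul, abs_of_nonneg (by positivity), ← Real.rpow_add_one (by simpa using h)]
    ring_nf

lemma abs_rpow_sub_two_mul_self (p a : ℝ) (hp : 1 < p) : |a| ^ (p - 2) * a * a = |a| ^ p := by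
  rcases eq_or_ne a 0 with rfl | h
  · simp [Real.zero_rpow (by linarith : p ≠ 0)]
  · have h1 : |a| ≠ 0 := by simpa using h
    rw [mul_assoc, ← abs_mul_abs_self a, ← mul_assoc, ← Real.rpow_add_one h1,
      ← Real.rpow_add_one h1]
    ring_nf

lemma weakForm_self (hp : 1 < p) (hH : IsFinslerMinkowskiNorm H) :
    weakForm Ω H p s u u = energy Ω H p s u := by
  unfold weakForm energy
  congr 2
  · ext x
    by_cases h : weakGradient u x = 0
    · simp [h, hH.map_zero, Real.zero_rpow (by linarith : p ≠ 0)]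
    · rw [hH.inner_gradient_self h]
      have : H (weakGradient u x) ≠ 0 := fun h0 => h ((hH.eq_zero_iff _).1 h0)
      rw [← Real.rpow_add_one this]
      ring_nf
  · ext z
    rw [abs_rpow_sub_two_mul_self p _ hp]

lemma rpow_sub_one_mul_le {a b : ℝ} (hp : 1 ≤ p) (ha : 0 ≤ a) (hb : 0 ≤ b) :
    (a + b) ^ (p - 1) * b ≤ 2 ^ p * (a ^ p + b ^ p) := by
  refine le_trans ?_ (add_rpow_le_two_rpow_mul (by linarith) ha hb)
  rcases (add_nonneg ha hb).eq_or_lt with h | h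
  · have : b = 0 := by linarith
    rw [this, mul_zero]; positivity
  · calc (a + b) ^ (p - 1) * b ≤ (a + b) ^ (p - 1) * (a + b) := by gcongr; linarith
      _ = (a + b) ^ p := by rw [← Real.rpow_add_one h.ne']; ring_nf

/-- The local energy density, its derivative along `B`, and a bound for the derivative. -/
lemma IsFinslerMinkowskiNorm.abs_rpow_mul_inner_le (hH : IsFinslerMinkowskiNorm H) (hp : 1 < p)
    (A B : EuclideanSpace ℝ (Fin N)) {t : ℝ} (ht : |t| ≤ 1) :
    |H (A + t • B) ^ (p - 1) * inner ℝ (gradient H (A + t • B)) B| ≤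
      2 ^ p * (H A ^ p + H B ^ p) := by
  refine le_trans ?_ (rpow_sub_one_mul_le hp.le (hH.nonneg A) (hH.nonneg B))
  have hsum := add_nonneg (hH.nonneg A) (hH.nonneg B)
  rw [abs_mul, abs_of_nonneg (Real.rpow_nonneg (hH.nonneg _) _)]
  by_cases h : A + t • B = 0
  · rw [h, hH.map_zero, Real.zero_rpow (by linarith), zero_mul]
    exact mul_nonneg (Real.rpow_nonneg hsum _) (hH.nonneg B)
  · refine mul_le_mul (Real.rpow_le_rpow (hH.nonneg _) ?_ (by linarith))
      (hH.abs_inner_gradient_le h B) (abs_nonneg _) (Real.rpow_nonneg hsum _)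
    refine (hH.add_le _ _).trans ?_
    rw [hH.homogeneous]
    have := mul_le_of_le_one_left (hH.nonneg B) ht
    linarith

lemma MemW01p.integrable_local_form (hH : IsFinslerMinkowskiNorm H) (hp : 1 < p)
    (hu : MemW01p Ω p u) (hφ : MemW01p Ω p φ) :
    Integrable (fun x => H (weakGradient u x) ^ (p - 1) *
      inner ℝ (gradient H (weakGradient u x)) (weakGradient φ x)) volume := by
  have hm : AEStronglyMeasurable (fun x => H (weakGradient u x) ^ (p - 1) *
      (inner ℝ (gradient H (weakGradient u x)) (weakGradient φ x) : ℝ)) volume := by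
    have h1 : AEMeasurable (fun x => H (weakGradient u x) ^ (p - 1)) volume :=
      (hH.continuous.comp_aestronglyMeasurable hu.memLp_weakGradient.1).aemeasurable.pow_const _
    have h2 : AEStronglyMeasurable (fun x => gradient H (weakGradient u x)) volume :=
      (IsFinslerMinkowskiNorm.measurable_gradient.comp_aemeasurable
        hu.memLp_weakGradient.1.aemeasurable).aestronglyMeasurable
    exact h1.aestronglyMeasurable.mul (h2.inner hφ.memLp_weakGradient.1)
  refine (((hH.integrable_rpow hp hu).add (hH.integrable_rpow hp hφ)).const_mul (2 ^ p)).mono' hm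
    (ae_of_all _ fun x => ?_)
  have := hH.abs_rpow_mul_inner_le hp (weakGradient u x) (weakGradient φ x) (t := 0) (by simp)
  simpa using this

lemma abs_rpow_sub_two_mul_le (hp : 1 < p) (a b : ℝ) {t : ℝ} (ht : |t| ≤ 1) :
    |(|a + t * b| ^ (p - 2) * (a + t * b) * b)| ≤ 2 ^ p * (|a| ^ p + |b| ^ p) := by
  refine le_trans ?_ (rpow_sub_one_mul_le hp.le (abs_nonneg a) (abs_nonneg b))
  rw [abs_mul, abs_rpow_sub_two_mul p _ hp]
  gcongr
  refine (abs_add_le _ _).trans ?_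
  rw [abs_mul]
  have := mul_le_of_le_one_left (abs_nonneg b) ht
  linarith

lemma aestronglyMeasurable_nonlocal_form (hu : AEStronglyMeasurable u volume)
    (hφ : AEStronglyMeasurable φ volume) :
    AEStronglyMeasurable (fun z : EuclideanSpace ℝ (Fin N) × EuclideanSpace ℝ (Fin N) =>
      |u z.1 - u z.2| ^ (p - 2) * (u z.1 - u z.2) * (φ z.1 - φ z.2) * kernel N p s z) volume := by
  have h1 := (aestronglyMeasurable_sub_prod hu).aemeasurable
  have h2 := (aestronglyMeasurable_sub_prod hφ).aemeasurable
  exact ((((h1.abs.pow_const _).mul h1).mul h2).mul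
    measurable_kernel.aemeasurable).aestronglyMeasurable

lemma MemW01p.integrable_nonlocal_form (hN : 1 ≤ N) (hp : 1 < p) (hs₀ : 0 < s) (hs₁ : s < 1)
    (hu : MemW01p Ω p u) (hφ : MemW01p Ω p φ) :
    Integrable (fun z : EuclideanSpace ℝ (Fin N) × EuclideanSpace ℝ (Fin N) =>
      |u z.1 - u z.2| ^ (p - 2) * (u z.1 - u z.2) * (φ z.1 - φ z.2) * kernel N p s z) volume := by
  refine (((hu.integrable_gagliardo hN hp hs₀ hs₁).add
    (hφ.integrable_gagliardo hN hp hs₀ hs₁)).const_mul (2 ^ p)).mono'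
    (aestronglyMeasurable_nonlocal_form hu.memLp.1 hφ.memLp.1) (ae_of_all _ fun z => ?_)
  have := abs_rpow_sub_two_mul_le hp (u z.1 - u z.2) (φ z.1 - φ z.2) (t := 0) (by simp)
  rw [norm_mul, Real.norm_of_nonneg (kernel_nonneg z), Real.norm_eq_abs]
  simp only [zero_mul, add_zero] at this
  calc _ ≤ _ := mul_le_mul_of_nonneg_right this (kernel_nonneg z)
    _ = _ := by simp only [Pi.add_apply]; ring

/-- The weak form is `1/p` times the first variation of the energy. -/
lemma hasDerivAt_energy (hN : 1 ≤ N) (hp : 1 < p) (hs₀ : 0 < s) (hs₁ : s < 1)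
    (hH : IsFinslerMinkowskiNorm H) (hu : MemW01p Ω p u) (hφ : MemW01p Ω p φ) :
    HasDerivAt (fun t : ℝ => energy Ω H p s (fun x => u x + t * φ x))
      (p * weakForm Ω H p s u φ) 0 := by
  have hball : Metric.ball (0:ℝ) 1 ∈ 𝓝 (0:ℝ) := Metric.ball_mem_nhds _ one_pos
  have hgrad : ∀ t : ℝ, weakGradient (fun x => u x + t * φ x) =ᵐ[volume]
      fun x => weakGradient u x + t • weakGradient φ x := fun t => by
    have := (hu.lin_comb hφ hp.le 1 t).2
    simpa using this
  have hmem : ∀ t : ℝ, MemW01p Ω p (fun x => u x + t * φ x) := fun t => by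
    have := (hu.lin_comb hφ hp.le 1 t).1
    simpa using this
  have d1 : HasDerivAt (fun t : ℝ => ∫ x in Ω, H (weakGradient u x + t • weakGradient φ x) ^ p)
      (∫ x in Ω, p * (H (weakGradient u x + (0:ℝ) • weakGradient φ x) ^ (p - 1) *
        inner ℝ (gradient H (weakGradient u x + (0:ℝ) • weakGradient φ x)) (weakGradient φ x))) 0 := by
    refine (hasDerivAt_integral_of_dominated_loc_of_deriv_le hball
      (bound := fun x => p * (2 ^ p * (H (weakGradient u x) ^ p + H (weakGradient φ x) ^ p)))
      (F' := fun t x => p * (H (weakGradient u x + t • weakGradient φ x) ^ (p - 1) *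
        inner ℝ (gradient H (weakGradient u x + t • weakGradient φ x)) (weakGradient φ x)))
      (Eventually.of_forall fun t => ?_) ?_ ?_ ?_ ?_ ?_).2
    · refine AEStronglyMeasurable.restrict ?_
      exact ((hH.continuous.comp_aestronglyMeasurable (hu.memLp_weakGradient.1.add
        (hφ.memLp_weakGradient.1.const_smul t))).aemeasurable.pow_const p).aestronglyMeasurable
    · have := (hH.integrable_rpow hp hu).restrict (s := Ω)
      simpa using this
    · have := ((hu.integrable_local_form hH hp hφ).const_mul p).restrict (s := Ω)
      simpa using this.1
    · refine ae_of_all _ fun x t ht => ?_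
      rw [norm_mul, Real.norm_of_nonneg (by linarith : 0 ≤ p)]
      refine mul_le_mul_of_nonneg_left (hH.abs_rpow_mul_inner_le hp _ _ ?_) (by linarith)
      have := Metric.mem_ball.1 ht
      rw [Real.dist_eq, sub_zero] at this
      exact this.le
    · exact ((((hH.integrable_rpow hp hu).add
        (hH.integrable_rpow hp hφ)).const_mul _).const_mul _).restrict
    · exact ae_of_all _ fun x t _ => hH.hasDerivAt_rpow hp _ _ t
  have d2 : HasDerivAt (fun t : ℝ => ∫ z : EuclideanSpace ℝ (Fin N) × EuclideanSpace ℝ (Fin N),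
      |(u z.1 - u z.2) + t * (φ z.1 - φ z.2)| ^ p * kernel N p s z)
      (∫ z : EuclideanSpace ℝ (Fin N) × EuclideanSpace ℝ (Fin N),
        p * (|(u z.1 - u z.2) + 0 * (φ z.1 - φ z.2)| ^ (p - 2) *
          ((u z.1 - u z.2) + 0 * (φ z.1 - φ z.2)) * (φ z.1 - φ z.2) * kernel N p s z)) 0 := by
    refine (hasDerivAt_integral_of_dominated_loc_of_deriv_le hball
      (bound := fun z => p * (2 ^ p * (|u z.1 - u z.2| ^ p * kernel N p s z +
        |φ z.1 - φ z.2| ^ p * kernel N p s z)))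
      (F' := fun t z => p * (|(u z.1 - u z.2) + t * (φ z.1 - φ z.2)| ^ (p - 2) *
          ((u z.1 - u z.2) + t * (φ z.1 - φ z.2)) * (φ z.1 - φ z.2) * kernel N p s z))
      (Eventually.of_forall fun t => ?_) ?_ ?_ ?_ ?_ ?_).2
    · have := aestronglyMeasurable_gagliardo (p := p) (s := s) (hmem t).memLp.1
      refine this.congr (ae_of_all _ fun z => ?_)
      simp only
      congr 3; ring
    · have := hu.integrable_gagliardo hN hp hs₀ hs₁
      simpa using this
    · have := ((hu.integrable_nonlocal_form hN hp hs₀ hs₁ hφ).const_mul p)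
      simpa using this.1
    · refine ae_of_all _ fun z t ht => ?_
      have ht' := Metric.mem_ball.1 ht
      rw [Real.dist_eq, sub_zero] at ht'
      rw [norm_mul, Real.norm_of_nonneg (by linarith : 0 ≤ p), norm_mul,
        Real.norm_of_nonneg (kernel_nonneg z), Real.norm_eq_abs]
      refine mul_le_mul_of_nonneg_left ?_ (by linarith)
      rw [← add_mul, ← mul_assoc]
      exact mul_le_mul_of_nonneg_right (abs_rpow_sub_two_mul_le hp _ _ ht'.le) (kernel_nonneg z)
    · exact (((hu.integrable_gagliardo hN hp hs₀ hs₁).add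
        (hφ.integrable_gagliardo hN hp hs₀ hs₁)).const_mul _).const_mul _
    · refine ae_of_all _ fun z t _ => ?_
      have h1 : HasDerivAt (fun t : ℝ => (u z.1 - u z.2) + t * (φ z.1 - φ z.2)) (φ z.1 - φ z.2) t := by
        simpa using ((hasDerivAt_id t).mul_const (φ z.1 - φ z.2)).const_add (u z.1 - u z.2)
      have h2 := (HasDerivAt.comp (h₂ := fun r : ℝ => |r| ^ p) t
        (hasDerivAt_abs_rpow ((u z.1 - u z.2) + t * (φ z.1 - φ z.2)) hp) h1).mul_const
        (kernel N p s z)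
      refine HasDerivAt.congr_deriv h2 ?_
      ring
  have d3 := d1.add d2
  refine HasDerivAt.congr_deriv (d3.congr_of_eventuallyEq (Eventually.of_forall fun t => ?_)) ?_
  · simp only [energy, Pi.add_apply]
    congr 1
    · refine integral_congr_ae ?_
      filter_upwards [ae_restrict_of_ae (hgrad t)] with x hx
      rw [hx]
    · congr 1; ext z
      congr 3; ring
  · simp only [weakForm, zero_smul, add_zero, zero_mul, integral_const_mul]
    ring

end Nonlocal

/-! ### Compactness in `L^p` -/

section LpCompactness

variable {N : ℕ} {Ω : Set (EuclideanSpace ℝ (Fin N))} {p s : ℝ}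
  {u : EuclideanSpace ℝ (Fin N) → ℝ}

/-- Jensen's inequality for the average over a ball. -/
lemma enorm_average_sub_rpow_le (hp : 1 ≤ p) (hu : MemLp u (ENNReal.ofReal p) volume)
    (x₀ : EuclideanSpace ℝ (Fin N)) {r : ℝ} (hr : 0 < r) (c : ℝ) :
    ‖(⨍ y in Metric.ball x₀ r, u y) - c‖ₑ ^ p ≤
      (volume (Metric.ball (0 : EuclideanSpace ℝ (Fin N)) r))⁻¹ *
        ∫⁻ y in Metric.ball x₀ r, ‖u y - c‖ₑ ^ p := by
  have hp0 : 0 < p := by linarith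
  set B := Metric.ball x₀ r
  have hB0 : volume B ≠ 0 := (Metric.measure_ball_pos volume x₀ hr).ne'
  have hBt : volume B ≠ ⊤ := measure_ball_lt_top.ne
  have hv : volume B = volume (Metric.ball (0 : EuclideanSpace ℝ (Fin N)) r) := by
    rw [Measure.addHaar_ball_center]
  set ρ : Measure (EuclideanSpace ℝ (Fin N)) := (volume B)⁻¹ • volume.restrict B with hρ
  have hpr : IsProbabilityMeasure ρ := ⟨by
    rw [hρ, Measure.smul_apply, Measure.restrict_apply_univ, smul_eq_mul,
      ENNReal.inv_mul_cancel hB0 hBt]⟩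
  have hav : (⨍ y in B, u y) = ∫ y, u y ∂ρ := by
    rw [average, hρ, Measure.restrict_apply_univ]
  have hLr : MemLp u (ENNReal.ofReal p) ρ := hu.restrict B |>.smul_measure (ENNReal.inv_ne_top.2 hB0)
  have hi : Integrable u ρ := hLr.integrable (by simpa using ENNReal.ofReal_le_ofReal hp)
  have e1 : (⨍ y in B, u y) - c = ∫ y, (u y - c) ∂ρ := by
    rw [hav, integral_sub hi (integrable_const c)]
    simp
  rw [e1, ← hv]
  have h1 : ‖∫ y, (u y - c) ∂ρ‖ₑ ≤ eLpNorm (fun y => u y - c) 1 ρ := by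
    rw [eLpNorm_one_eq_lintegral_enorm]; exact enorm_integral_le_lintegral_enorm _
  have h2 : eLpNorm (fun y => u y - c) 1 ρ ≤ eLpNorm (fun y => u y - c) (ENNReal.ofReal p) ρ :=
    eLpNorm_le_eLpNorm_of_exponent_le (by simpa using ENNReal.ofReal_le_ofReal hp)
      (hLr.1.sub aestronglyMeasurable_const)
  refine (ENNReal.rpow_le_rpow (h1.trans h2) hp0.le).trans ?_
  rw [eLpNorm_ofReal_rpow hp0, hρ, lintegral_smul_measure, smul_eq_mul]

/-- The oscillation of `u` at scale `r`, a function of `(x, y)`. -/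
def oscDensity (p r : ℝ) (u : EuclideanSpace ℝ (Fin N) → ℝ)
    (z : EuclideanSpace ℝ (Fin N) × EuclideanSpace ℝ (Fin N)) : ℝ≥0∞ :=
  {z : EuclideanSpace ℝ (Fin N) × EuclideanSpace ℝ (Fin N) | dist z.2 z.1 < 2 * r}.indicator
    (fun z => (volume (Metric.ball (0 : EuclideanSpace ℝ (Fin N)) r))⁻¹ * ‖u z.2 - u z.1‖ₑ ^ p) z

lemma measurableSet_dist_lt (r : ℝ) : MeasurableSet
    {z : EuclideanSpace ℝ (Fin N) × EuclideanSpace ℝ (Fin N) | dist z.2 z.1 < r} :=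
  measurableSet_lt (measurable_snd.dist measurable_fst) measurable_const

lemma aemeasurable_oscDensity (hu : AEStronglyMeasurable u volume) (r : ℝ) :
    AEMeasurable (oscDensity p r u) (volume.prod volume) := by
  refine AEMeasurable.indicator ?_ (measurableSet_dist_lt _)
  exact ((hu.comp_snd.sub hu.comp_fst).enorm.pow_const p).const_mul _

/-- The deviation of `u` at `x` from its average over a ball of radius `r` containing `x` is
controlled by the oscillation at scale `r`. -/
lemma enorm_sub_average_le (hp : 1 ≤ p) (hu : MemLp u (ENNReal.ofReal p) volume)
    {x x₀ : EuclideanSpace ℝ (Fin N)} {r : ℝ} (hr : 0 < r) (hx : x ∈ Metric.ball x₀ r) :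
    ‖u x - ⨍ y in Metric.ball x₀ r, u y‖ₑ ^ p ≤ ∫⁻ y, oscDensity p r u (x, y) := by
  rw [← enorm_neg, neg_sub]
  refine (enorm_average_sub_rpow_le hp hu x₀ hr (u x)).trans ?_
  have hb : (volume (Metric.ball (0 : EuclideanSpace ℝ (Fin N)) r))⁻¹ ≠ ⊤ :=
    ENNReal.inv_ne_top.2 (Metric.measure_ball_pos volume _ hr).ne'
  rw [← lintegral_const_mul' _ _ hb, ← lintegral_indicator Metric.isOpen_ball.measurableSet]
  refine lintegral_mono fun y => ?_
  by_cases hy : y ∈ Metric.ball x₀ r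
  · rw [indicator_of_mem hy, oscDensity, indicator_of_mem]
    have h1 := Metric.mem_ball.1 hx
    have h2 := Metric.mem_ball.1 hy
    have h3 := dist_triangle_right y x x₀
    simp only [mem_ofPred_eq]
    linarith
  · rw [indicator_of_notMem hy]; exact zero_le

/-- The factor `C r^{ps}` that controls the `L^p` oscillation of a function at scale `r`. -/
def oscConst (N : ℕ) (p s r : ℝ) : ℝ≥0∞ :=
  (volume (Metric.ball (0 : EuclideanSpace ℝ (Fin N)) 1))⁻¹ *
    ENNReal.ofReal (2 ^ ((N : ℝ) + p * s) * r ^ (p * s))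

/-- The `L^p` oscillation at scale `r` is controlled by `r^{ps}` times the fractional seminorm,
because `|x - y|^{-N-ps}` is at least a multiple of `r^{-N-ps}` at distances below `2r`. -/
lemma lintegral_oscDensity_le (hp : 1 < p) (hs₀ : 0 < s) {r : ℝ} (hr : 0 < r)
    (hu : AEStronglyMeasurable u volume) :
    ∫⁻ x, ∫⁻ y, oscDensity p r u (x, y) ≤ oscConst N p s r *
      ∫⁻ z : EuclideanSpace ℝ (Fin N) × EuclideanSpace ℝ (Fin N),
        ENNReal.ofReal (|u z.1 - u z.2| ^ p * kernel N p s z) := by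
  rw [lintegral_lintegral (f := fun x y => oscDensity p r u (x, y)) (aemeasurable_oscDensity hu r),
    ← Measure.volume_eq_prod]
  have hc : oscConst N p s r ≠ ⊤ :=
    ENNReal.mul_ne_top (ENNReal.inv_ne_top.2 (Metric.measure_ball_pos volume _ one_pos).ne')
      ENNReal.ofReal_ne_top
  rw [← lintegral_const_mul' _ _ hc]
  refine lintegral_mono fun z => ?_
  have hp0 : 0 < p := by linarith
  have hps : 0 < p * s := by positivity
  unfold oscDensity
  by_cases hz : dist z.2 z.1 < 2 * r
  · rw [indicator_of_mem (by exact hz), Measure.addHaar_ball_of_pos _ _ hr, finrank_euclideanSpace_fin,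
      ENNReal.mul_inv (Or.inr measure_ball_lt_top.ne)
        (Or.inl ENNReal.ofReal_ne_top), oscConst, mul_comm (ENNReal.ofReal (r ^ N))⁻¹, mul_assoc,
      mul_assoc, ← ENNReal.ofReal_inv_of_pos (by positivity), enorm_rpow_eq_ofReal hp0.le,
      ← ENNReal.ofReal_mul (by positivity), ← ENNReal.ofReal_mul (by positivity)]
    refine mul_le_mul' le_rfl (ENNReal.ofReal_le_ofReal ?_)
    rw [Real.norm_eq_abs, abs_sub_comm]
    rcases eq_or_ne z.1 z.2 with h | h
    · rw [h]; simp [Real.zero_rpow hp0.ne']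
    · have hd : 0 < ‖z.1 - z.2‖ := norm_pos_iff.2 (sub_ne_zero.2 h)
      rw [dist_comm, dist_eq_norm] at hz
      unfold kernel
      have h1 : (2 * r) ^ (-(N : ℝ) - p * s) ≤ ‖z.1 - z.2‖ ^ (-(N : ℝ) - p * s) :=
        Real.rpow_le_rpow_of_nonpos hd hz.le (by
          have : (0:ℝ) ≤ N := Nat.cast_nonneg N
          linarith)
      have h2 : (2 : ℝ) ^ ((N : ℝ) + p * s) * r ^ (p * s) * (2 * r) ^ (-(N : ℝ) - p * s) =
          (r ^ N)⁻¹ := by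
        rw [Real.mul_rpow (by norm_num) hr.le]
        calc _ = ((2 : ℝ) ^ ((N : ℝ) + p * s) * 2 ^ (-(N : ℝ) - p * s)) *
              (r ^ (p * s) * r ^ (-(N : ℝ) - p * s)) := by ring
          _ = _ := by
            rw [← Real.rpow_add (by norm_num), ← Real.rpow_add hr, ← Real.rpow_natCast,
              ← Real.rpow_neg hr.le]
            ring_nf
            simp
      rw [← h2]
      calc _ = (2 ^ ((N : ℝ) + p * s) * r ^ (p * s)) * (|u z.1 - u z.2| ^ p *
            (2 * r) ^ (-(N : ℝ) - p * s)) := by ring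
        _ ≤ _ := by gcongr
  · rw [indicator_of_notMem (by exact hz)]; exact zero_le

lemma tendsto_oscConst (hp : 1 < p) (hs₀ : 0 < s) :
    Tendsto (fun j : ℕ => oscConst N p s (1 / ((j : ℝ) + 1))) atTop (𝓝 0) := by
  have hps : 0 < p * s := by positivity
  have h1 : Tendsto (fun j : ℕ => (1 / ((j : ℝ) + 1)) ^ (p * s)) atTop (𝓝 0) := by
    have := (tendsto_one_div_add_atTop_nhds_zero_nat (𝕜 := ℝ)).rpow_const (p := p * s)
      (Or.inr hps.le)
    rwa [Real.zero_rpow hps.ne'] at this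
  have h2 := ENNReal.tendsto_ofReal (h1.const_mul ((2:ℝ) ^ ((N : ℝ) + p * s)))
  rw [mul_zero, ENNReal.ofReal_zero] at h2
  have h3 := ENNReal.Tendsto.const_mul
    (a := (volume (Metric.ball (0 : EuclideanSpace ℝ (Fin N)) 1))⁻¹) h2
    (Or.inr (ENNReal.inv_ne_top.2 (Metric.measure_ball_pos volume _ one_pos).ne'))
  rwa [mul_zero] at h3

lemma enorm_add_three_rpow_le {p : ℝ} (hp : 0 ≤ p) (a b c : ℝ) :
    ‖a + b + c‖ₑ ^ p ≤ 3 ^ p * (‖a‖ₑ ^ p + ‖b‖ₑ ^ p + ‖c‖ₑ ^ p) := by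
  set m := max (max ‖a‖ₑ ‖b‖ₑ) ‖c‖ₑ
  have ha : ‖a‖ₑ ≤ m := (le_max_left _ _).trans (le_max_left _ _)
  have hb : ‖b‖ₑ ≤ m := (le_max_right _ _).trans (le_max_left _ _)
  have hc : ‖c‖ₑ ≤ m := le_max_right _ _
  have h1 : ‖a + b + c‖ₑ ≤ 3 * m := by
    calc ‖a + b + c‖ₑ ≤ ‖a‖ₑ + ‖b‖ₑ + ‖c‖ₑ :=
          (enorm_add_le _ _).trans (add_le_add_left (enorm_add_le _ _) _)
      _ ≤ m + m + m := by gcongr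
      _ = 3 * m := by ring
  refine (ENNReal.rpow_le_rpow h1 hp).trans ?_
  rw [ENNReal.mul_rpow_of_nonneg _ _ hp]
  gcongr
  rcases max_choice (max ‖a‖ₑ ‖b‖ₑ) ‖c‖ₑ with h | h
  · rcases max_choice ‖a‖ₑ ‖b‖ₑ with h' | h'
    · rw [show m = ‖a‖ₑ from h.trans h']; exact le_add_right le_self_add
    · rw [show m = ‖b‖ₑ from h.trans h']; exact le_add_right le_add_self
  · rw [show m = ‖c‖ₑ from h]; exact le_add_self

/-- Compactness of the embedding into `L^p`. Up to a small `L^p` error controlled by the fractional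
seminorm, a function is determined by its averages over finitely many small balls, and along a
subsequence all averages over a countable family of balls converge. -/
lemma exists_subseq_cauchy (hp : 1 < p) (hs₀ : 0 < s) (hΩ : Bornology.IsBounded Ω)
    (hΩm : MeasurableSet Ω)
    {w : ℕ → EuclideanSpace ℝ (Fin N) → ℝ} {M : ℝ≥0∞} (hM : M ≠ ⊤) (hw : ∀ n, MemW01p Ω p (w n))
    (hwp : ∀ n, ∫⁻ x, ‖w n x‖ₑ ^ p ≤ M)
    (hws : ∀ n, ∫⁻ z : EuclideanSpace ℝ (Fin N) × EuclideanSpace ℝ (Fin N),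
        ENNReal.ofReal (|w n z.1 - w n z.2| ^ p * kernel N p s z) ≤ M) :
    ∃ θ : ℕ → ℕ, StrictMono θ ∧ ∀ ε : ℝ≥0∞, 0 < ε → ∃ n₀, ∀ m ≥ n₀, ∀ n ≥ n₀,
      ∫⁻ x, ‖w (θ m) x - w (θ n) x‖ₑ ^ p ≤ ε := by
  have hp0 : 0 < p := by linarith
  set xs := TopologicalSpace.denseSeq (EuclideanSpace ℝ (Fin N)) with hxs
  set r : ℕ → ℝ := fun j => 1 / ((j : ℝ) + 1) with hr
  have hr0 : ∀ j, 0 < r j := fun j => by positivity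
  set A : ℕ → ℕ × ℕ → ℝ := fun n i => ⨍ y in Metric.ball (xs i.1) (r i.2), w n y with hA
  set bd : ℕ × ℕ → ℝ := fun i => (((volume (Metric.ball (0 : EuclideanSpace ℝ (Fin N)) (r i.2)))⁻¹ *
    M) ^ (1 / p)).toReal with hbd
  have hAb : ∀ n i, A n i ∈ Icc (-bd i) (bd i) := by
    intro n i
    have h1 := enorm_average_sub_rpow_le hp.le (hw n).memLp (xs i.1) (hr0 i.2) 0
    simp only [sub_zero] at h1
    have h2 : ‖A n i‖ₑ ^ p ≤ (volume (Metric.ball (0 : EuclideanSpace ℝ (Fin N)) (r i.2)))⁻¹ * M :=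
      h1.trans (by gcongr; exact (setLIntegral_le_lintegral _ _).trans (hwp n))
    have h3 : ‖A n i‖ₑ ≤ ((volume (Metric.ball (0 : EuclideanSpace ℝ (Fin N)) (r i.2)))⁻¹ *
        M) ^ (1 / p) := by
      rwa [one_div, ENNReal.le_rpow_inv_iff hp0]
    have h4 : ((volume (Metric.ball (0 : EuclideanSpace ℝ (Fin N)) (r i.2)))⁻¹ * M) ^ (1 / p) ≠ ⊤ :=
      ENNReal.rpow_ne_top_of_nonneg (by positivity) (ENNReal.mul_ne_top
        (ENNReal.inv_ne_top.2 (Metric.measure_ball_pos volume _ (hr0 _)).ne') hM)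
    have h5 := ENNReal.toReal_mono h4 h3
    rw [toReal_enorm, Real.norm_eq_abs] at h5
    exact abs_le.1 h5
  obtain ⟨a, _, θ, hθ, hlim⟩ := (isCompact_univ_pi fun i : ℕ × ℕ =>
    isCompact_Icc (a := -bd i) (b := bd i)).tendsto_subseq
      (x := A) (fun n => fun i _ => hAb n i)
  refine ⟨θ, hθ, fun ε hε => ?_⟩
  rw [tendsto_pi_nhds] at hlim
  have h3t : (3 : ℝ≥0∞) ^ p ≠ ⊤ := ENNReal.rpow_ne_top_of_nonneg hp0.le (by simp)
  have hvΩ : volume Ω < ⊤ := hΩ.measure_lt_top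
  -- the scale of the balls
  obtain ⟨j, hj⟩ : ∃ j, 3 ^ p * (oscConst N p s (r j) * M + oscConst N p s (r j) * M) ≤ ε / 2 := by
    have h1 := ENNReal.Tendsto.mul_const (b := M) (tendsto_oscConst (N := N) hp hs₀) (Or.inr hM)
    have h2 := ENNReal.Tendsto.const_mul (a := 3 ^ p) (h1.add h1) (Or.inr h3t)
    simp only [zero_mul, add_zero, mul_zero] at h2
    have h3 := (ENNReal.tendsto_nhds_zero.1 h2) (ε / 2) (ENNReal.half_pos hε.ne')
    exact h3.exists
  -- the admissible error of the averages
  obtain ⟨δ, hδ0, hδ⟩ : ∃ δ : ℝ, 0 < δ ∧ 3 ^ p * (ENNReal.ofReal δ ^ p * volume Ω) ≤ ε / 2 := by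
    have h0 : Tendsto (fun d : ℝ => d) (𝓝[>] 0) (𝓝 0) := nhdsWithin_le_nhds
    have h1 := (ENNReal.continuous_rpow_const (y := p)).tendsto 0 |>.comp
      ((by simpa using ENNReal.tendsto_ofReal h0 :
        Tendsto (fun d : ℝ => ENNReal.ofReal d) (𝓝[>] 0) (𝓝 0)))
    rw [ENNReal.zero_rpow_of_pos hp0] at h1
    have h2 := ENNReal.Tendsto.const_mul (a := 3 ^ p)
      (ENNReal.Tendsto.mul_const (b := volume Ω) h1 (Or.inr hvΩ.ne)) (Or.inr h3t)
    simp only [zero_mul, mul_zero] at h2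
    have h3 := (ENNReal.tendsto_nhds_zero.1 h2) (ε / 2) (ENNReal.half_pos hε.ne')
    obtain ⟨d, hd, hd'⟩ := (h3.and self_mem_nhdsWithin).exists
    exact ⟨d, hd', hd⟩
  have hcov : closure Ω ⊆ ⋃ k, Metric.ball (xs k) (r j) := by
    intro x _
    obtain ⟨y, ⟨k, rfl⟩, hy⟩ := Metric.dense_iff.1
      (TopologicalSpace.denseRange_denseSeq (EuclideanSpace ℝ (Fin N))) x (r j) (hr0 j)
      |>.imp fun y hy => And.intro hy.2 hy.1
    exact mem_iUnion.2 ⟨k, Metric.mem_ball_comm.1 hy⟩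
  obtain ⟨F, hF⟩ := (hΩ.isCompact_closure).elim_finite_subcover _ (fun k => Metric.isOpen_ball) hcov
  have hev : ∀ᶠ n in atTop, ∀ k ∈ F, dist (A (θ n) (k, j)) (a (k, j)) < δ / 2 := by
    rw [Filter.eventually_all_finset]
    intro k _
    exact (Metric.tendsto_nhds.1 (hlim (k, j))) (δ / 2) (by positivity)
  obtain ⟨n₀, hn₀⟩ := eventually_atTop.1 hev
  refine ⟨n₀, fun m hm n hn => ?_⟩
  have hosc : ∀ l, ∫⁻ x, ∫⁻ y, oscDensity p (r j) (w l) (x, y) ≤ oscConst N p s (r j) * M :=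
    fun l => (lintegral_oscDensity_le hp hs₀ (hr0 j) (hw l).memLp.1).trans (by gcongr; exact hws l)
  have hpt : ∀ x ∈ Ω, ‖w (θ m) x - w (θ n) x‖ₑ ^ p ≤ 3 ^ p *
      ((∫⁻ y, oscDensity p (r j) (w (θ m)) (x, y)) + (∫⁻ y, oscDensity p (r j) (w (θ n)) (x, y)) +
        ENNReal.ofReal δ ^ p) := by
    intro x hx
    obtain ⟨k, hk, hxk⟩ := mem_iUnion₂.1 (hF (subset_closure hx))
    have e1 : w (θ m) x - w (θ n) x = (w (θ m) x - A (θ m) (k, j)) + -(w (θ n) x - A (θ n) (k, j)) +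
        (A (θ m) (k, j) - A (θ n) (k, j)) := by ring
    rw [e1]
    refine (enorm_add_three_rpow_le hp0.le _ _ _).trans ?_
    rw [enorm_neg]
    gcongr
    · exact enorm_sub_average_le hp.le (hw _).memLp (hr0 j) hxk
    · exact enorm_sub_average_le hp.le (hw _).memLp (hr0 j) hxk
    · rw [← ofReal_norm, ← dist_eq_norm]
      refine ENNReal.ofReal_le_ofReal ?_
      have h1 := hn₀ m hm k hk
      have h2 := hn₀ n hn k hk
      have h3 := dist_triangle_right (A (θ m) (k, j)) (A (θ n) (k, j)) (a (k, j))
      linarith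
  have hmo : ∀ l, AEMeasurable (fun x => ∫⁻ y, oscDensity p (r j) (w l) (x, y)) volume := fun l =>
    (aemeasurable_oscDensity (hw l).memLp.1 (r j)).lintegral_prod_right'
  calc ∫⁻ x, ‖w (θ m) x - w (θ n) x‖ₑ ^ p
      = ∫⁻ x in Ω, ‖w (θ m) x - w (θ n) x‖ₑ ^ p := by
        rw [← lintegral_indicator hΩm]
        refine lintegral_congr_ae ?_
        filter_upwards [(hw (θ m)).2, (hw (θ n)).2] with x h1 h2
        by_cases hx : x ∈ Ω
        · rw [indicator_of_mem hx]
        · rw [indicator_of_notMem hx, h1 hx, h2 hx]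
          simp [hp0]
    _ ≤ ∫⁻ x in Ω, 3 ^ p *
      ((∫⁻ y, oscDensity p (r j) (w (θ m)) (x, y)) + (∫⁻ y, oscDensity p (r j) (w (θ n)) (x, y)) +
        ENNReal.ofReal δ ^ p) := setLIntegral_mono' hΩm hpt
    _ ≤ 3 ^ p * (oscConst N p s (r j) * M + oscConst N p s (r j) * M +
          ENNReal.ofReal δ ^ p * volume Ω) := by
        rw [lintegral_const_mul' _ _ h3t]
        gcongr
        rw [lintegral_add_right _ measurable_const, lintegral_add_left' (hmo _).restrict,
          setLIntegral_const]
        gcongr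
        · exact (setLIntegral_le_lintegral _ _).trans (hosc _)
        · exact (setLIntegral_le_lintegral _ _).trans (hosc _)
    _ ≤ ε := by
        rw [mul_add]
        calc _ ≤ ε / 2 + ε / 2 := add_le_add hj hδ
          _ = ε := ENNReal.add_halves ε

/-- Passing to a subsequence, an `L^p`-convergent sequence converges almost everywhere and is
dominated in `L^p`. -/
lemma exists_subseq_ae_dominated {α F : Type*} [MeasurableSpace α] [NormedAddCommGroup F]
    {ρ : Measure α} (hp : 1 ≤ p) {f : ℕ → α → F} {f₀ : α → F}
    (hf : ∀ n, MemLp (f n) (ENNReal.ofReal p) ρ) (hf₀ : MemLp f₀ (ENNReal.ofReal p) ρ)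
    (h : Tendsto (fun n => ∫⁻ x, ‖f n x - f₀ x‖ₑ ^ p ∂ρ) atTop (𝓝 0)) :
    ∃ θ : ℕ → ℕ, StrictMono θ ∧ (∀ᵐ x ∂ρ, Tendsto (fun n => f (θ n) x) atTop (𝓝 (f₀ x))) ∧
      ∃ g : α → ℝ, Integrable g ρ ∧ ∀ᵐ x ∂ρ, ∀ n, ‖f (θ n) x‖ ^ p ≤ g x := by
  have hp0 : 0 < p := by linarith
  obtain ⟨θ, hθ, hb⟩ := extraction_forall_of_eventually (P := fun n k =>
    ∫⁻ x, ‖f k x - f₀ x‖ₑ ^ p ∂ρ ≤ (2 : ℝ≥0∞)⁻¹ ^ n) (fun n =>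
      (ENNReal.tendsto_nhds_zero.1 h) _ (ENNReal.pow_pos (by simp) n))
  set S : α → ℝ≥0∞ := fun x => ∑' n, ‖f (θ n) x - f₀ x‖ₑ ^ p with hS
  have hm : ∀ n, AEMeasurable (fun x => ‖f (θ n) x - f₀ x‖ₑ ^ p) ρ := fun n =>
    ((hf _).1.sub hf₀.1).enorm.pow_const p
  have hSm : AEMeasurable S ρ := AEMeasurable.tsum hm
  have hSi : ∫⁻ x, S x ∂ρ ≠ ⊤ := by
    rw [hS, lintegral_tsum hm]
    refine ne_top_of_le_ne_top ?_ (ENNReal.tsum_le_tsum hb)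
    rw [ENNReal.tsum_geometric]
    simp
  refine ⟨θ, hθ, ?_, fun x => 2 ^ p * (‖f₀ x‖ ^ p + (S x).toReal), ?_, ?_⟩
  · filter_upwards [ae_lt_top' hSm hSi] with x hx
    have h1 := ENNReal.tendsto_atTop_zero_of_tsum_ne_top hx.ne
    have h2 := (ENNReal.continuous_rpow_const (y := 1 / p)).tendsto 0 |>.comp h1
    rw [ENNReal.zero_rpow_of_pos (by positivity)] at h2
    rw [tendsto_iff_norm_sub_tendsto_zero]
    have h3 : Tendsto (fun n => ‖f (θ n) x - f₀ x‖ₑ) atTop (𝓝 0) := by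
      refine h2.congr fun n => ?_
      simp only [Function.comp_apply]
      rw [← ENNReal.rpow_mul]; simp [hp0.ne']
    have h4 := (ENNReal.tendsto_toReal ENNReal.zero_ne_top).comp h3
    exact h4.congr fun n => by simp
  · exact ((integrable_norm_rpow_of_memLp hp0 hf₀).add
      (integrable_toReal_of_lintegral_ne_top hSm hSi)).const_mul _
  · filter_upwards [ae_lt_top' hSm hSi] with x hx n
    have h1 : ‖f (θ n) x - f₀ x‖ₑ ^ p ≤ S x := ENNReal.le_tsum n
    have h2 : ‖f (θ n) x - f₀ x‖ ^ p ≤ (S x).toReal := by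
      have := ENNReal.toReal_mono hx.ne h1
      rwa [← ENNReal.toReal_rpow, toReal_enorm] at this
    have h3 : ‖f (θ n) x‖ ≤ ‖f₀ x‖ + ‖f (θ n) x - f₀ x‖ := by
      have := norm_add_le (f₀ x) (f (θ n) x - f₀ x)
      simpa using this
    calc ‖f (θ n) x‖ ^ p ≤ (‖f₀ x‖ + ‖f (θ n) x - f₀ x‖) ^ p :=
          Real.rpow_le_rpow (norm_nonneg _) h3 hp0.le
      _ ≤ 2 ^ p * (‖f₀ x‖ ^ p + ‖f (θ n) x - f₀ x‖ ^ p) :=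
          add_rpow_le_two_rpow_mul hp0.le (norm_nonneg _) (norm_nonneg _)
      _ ≤ _ := by gcongr

/-- Completeness of `L^p`, for sequences of functions. -/
lemma exists_limit_of_cauchy {α F : Type*} [MeasurableSpace α] [NormedAddCommGroup F]
    [CompleteSpace F] {ρ : Measure α} (hp : 1 ≤ p) {f : ℕ → α → F}
    (hf : ∀ n, MemLp (f n) (ENNReal.ofReal p) ρ)
    (h : ∀ ε : ℝ≥0∞, 0 < ε → ∃ n₀, ∀ m ≥ n₀, ∀ n ≥ n₀, ∫⁻ x, ‖f m x - f n x‖ₑ ^ p ∂ρ ≤ ε) :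
    ∃ f₀ : α → F, MemLp f₀ (ENNReal.ofReal p) ρ ∧
      Tendsto (fun n => ∫⁻ x, ‖f n x - f₀ x‖ₑ ^ p ∂ρ) atTop (𝓝 0) := by
  have hp0 : 0 < p := by linarith
  have : Fact (1 ≤ ENNReal.ofReal p) := ⟨by simpa using ENNReal.ofReal_le_ofReal hp⟩
  have hc : CauchySeq fun n => (hf n).toLp (f n) := by
    rw [EMetric.cauchySeq_iff]
    intro ε hε
    obtain ⟨ε', h0, hε'⟩ := exists_between hε
    obtain ⟨n₀, hn₀⟩ := h (ε' ^ p) (ENNReal.rpow_pos_of_nonneg h0 hp0.le)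
    refine ⟨n₀, fun m hm n hn => lt_of_le_of_lt ?_ hε'⟩
    rw [Lp.edist_toLp_toLp, eLpNorm_ofReal_eq hp0, one_div, ENNReal.rpow_inv_le_iff hp0]
    exact hn₀ m hm n hn
  obtain ⟨f₀, hf₀⟩ := cauchySeq_tendsto_of_complete hc
  refine ⟨f₀, Lp.memLp f₀, ?_⟩
  rw [tendsto_iff_edist_tendsto_0] at hf₀
  have h2 := (ENNReal.continuous_rpow_const (y := p)).tendsto 0 |>.comp hf₀
  rw [ENNReal.zero_rpow_of_pos hp0] at h2
  refine h2.congr fun n => ?_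
  simp only [Function.comp_apply]
  rw [Lp.edist_def, eLpNorm_ofReal_rpow hp0]
  refine lintegral_congr_ae ?_
  filter_upwards [(hf n).coeFn_toLp] with x hx
  simp [hx]

end LpCompactness

/-! ### Convergence of gradients along a minimizing sequence of a strictly convex functional -/

section Gradients

/-- The strictly convex function `√(1 + |a|²)`. -/
def areaFun {V : Type*} [NormedAddCommGroup V] (a : V) : ℝ := √(1 + ‖a‖ ^ 2)

lemma one_le_areaFun {V : Type*} [NormedAddCommGroup V] (a : V) : 1 ≤ areaFun a :=
  Real.one_le_sqrt.2 (by nlinarith [sq_nonneg ‖a‖])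

lemma areaFun_sq {V : Type*} [NormedAddCommGroup V] (a : V) : areaFun a ^ 2 = 1 + ‖a‖ ^ 2 :=
  Real.sq_sqrt (by positivity)

lemma norm_le_areaFun {V : Type*} [NormedAddCommGroup V] (a : V) : ‖a‖ ≤ areaFun a :=
  Real.le_sqrt_of_sq_le (by linarith)

lemma areaFun_le {V : Type*} [NormedAddCommGroup V] (a : V) : areaFun a ≤ 1 + ‖a‖ :=
  Real.sqrt_le_iff.2 ⟨by positivity, by nlinarith [norm_nonneg a]⟩

/-- The convexity defect of `areaFun` at the midpoint of `a` and `b`. -/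
def areaDefect {V : Type*} [NormedAddCommGroup V] [InnerProductSpace ℝ V] (a b : V) : ℝ :=
  (areaFun a + areaFun b) / 2 - areaFun ((1 / 2 : ℝ) • a + (1 / 2 : ℝ) • b)

lemma norm_sub_sq_le_areaDefect {V : Type*} [NormedAddCommGroup V] [InnerProductSpace ℝ V] (a b : V) :
    ‖a - b‖ ^ 2 ≤ 4 * (areaFun a * areaFun b * (areaFun a + areaFun b)) * areaDefect a b := by
  set α := areaFun a with hα
  set β := areaFun b with hβ
  set m := areaFun ((1 / 2 : ℝ) • a + (1 / 2 : ℝ) • b) with hm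
  set c : ℝ := inner ℝ a b with hc
  have hα1 : 1 ≤ α := one_le_areaFun a
  have hβ1 : 1 ≤ β := one_le_areaFun b
  have hm1 : 1 ≤ m := one_le_areaFun _
  have hα2 : α ^ 2 = 1 + ‖a‖ ^ 2 := areaFun_sq a
  have hβ2 : β ^ 2 = 1 + ‖b‖ ^ 2 := areaFun_sq b
  have hm2 : m ^ 2 = 1 + (‖a‖ ^ 2 + 2 * c + ‖b‖ ^ 2) / 4 := by
    rw [hm, areaFun_sq, ← smul_add, norm_smul, mul_pow, norm_add_sq_real]
    norm_num
    ring
  have hd : ‖a - b‖ ^ 2 = ‖a‖ ^ 2 - 2 * c + ‖b‖ ^ 2 := norm_sub_sq_real a b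
  have hcs : c ^ 2 ≤ ‖a‖ ^ 2 * ‖b‖ ^ 2 := by
    have := abs_real_inner_le_norm a b
    rw [← mul_pow, ← sq_abs c]
    exact pow_le_pow_left₀ (abs_nonneg _) this 2
  rw [hd]
  have hAB : 0 ≤ ‖a‖ ^ 2 - 2 * c + ‖b‖ ^ 2 := hd ▸ sq_nonneg _
  change _ ≤ 4 * (α * β * (α + β)) * ((α + β) / 2 - m)
  generalize ‖a‖ ^ 2 = A at *
  generalize ‖b‖ ^ 2 = B at *
  clear_value α β m c
  -- `(αβ)² - (1 + a·b)² ≥ |a - b|²`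
  have h1 : A - 2 * c + B ≤ (α * β) ^ 2 - (1 + c) ^ 2 := by
    rw [mul_pow, hα2, hβ2]; linarith
  have hab : 0 < α * β := by positivity
  have hk : |1 + c| ≤ α * β := abs_le_of_sq_le_sq (by linarith) hab.le
  have hk1 : 1 + c ≤ α * β := (le_abs_self _).trans hk
  have h2 : A - 2 * c + B ≤ (α * β - (1 + c)) * (2 * (α * β)) := by
    have : (α * β) ^ 2 - (1 + c) ^ 2 = (α * β - (1 + c)) * (α * β + (1 + c)) := by ring
    rw [this] at h1
    exact h1.trans (mul_le_mul_of_nonneg_left (by linarith) (by linarith))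
  have h3 : α * β - (1 + c) = 2 * (((α + β) / 2) ^ 2 - m ^ 2) := by
    have : 2 * (((α + β) / 2) ^ 2 - m ^ 2) = (α ^ 2 + β ^ 2) / 2 + α * β - 2 * m ^ 2 := by ring
    rw [this, hα2, hβ2, hm2]; ring
  have h4 : m ≤ (α + β) / 2 :=
    (le_abs_self m).trans (abs_le_of_sq_le_sq (by linarith) (by positivity))
  have h5 : ((α + β) / 2) ^ 2 - m ^ 2 ≤ ((α + β) / 2 - m) * (α + β) := by
    have : ((α + β) / 2) ^ 2 - m ^ 2 = ((α + β) / 2 - m) * ((α + β) / 2 + m) := by ring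
    rw [this]
    exact mul_le_mul_of_nonneg_left (by linarith) (by linarith)
  calc A - 2 * c + B ≤ (α * β - (1 + c)) * (2 * (α * β)) := h2
    _ = 4 * (α * β) * (((α + β) / 2) ^ 2 - m ^ 2) := by rw [h3]; ring
    _ ≤ 4 * (α * β) * (((α + β) / 2 - m) * (α + β)) := by gcongr
    _ = _ := by ring

lemma areaDefect_nonneg {V : Type*} [NormedAddCommGroup V] [InnerProductSpace ℝ V] (a b : V) :
    0 ≤ areaDefect a b := by
  have h := norm_sub_sq_le_areaDefect a b
  have ha := one_le_areaFun a
  have hb := one_le_areaFun b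
  have hpos : 0 < 4 * (areaFun a * areaFun b * (areaFun a + areaFun b)) := by positivity
  by_contra hneg
  push Not at hneg
  nlinarith [sq_nonneg ‖a - b‖]

/-- The convexity defect controls the distance, up to a small multiple of the `p`-th powers. -/
lemma exists_norm_sub_le_areaDefect {V : Type*} [NormedAddCommGroup V] [InnerProductSpace ℝ V]
    {p : ℝ} (hp : 1 < p) {ε : ℝ} (hε : 0 < ε) :
    ∃ C : ℝ, 0 ≤ C ∧ ∀ a b : V, ‖a - b‖ ≤ ε * (1 + ‖a‖ ^ p + ‖b‖ ^ p) + C * areaDefect a b := by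
  obtain ⟨R, hR1, hR⟩ : ∃ R : ℝ, 1 ≤ R ∧ 2 * 2 ^ p * R ^ (-(p - 1)) ≤ ε := by
    have h1 := (tendsto_rpow_neg_atTop (by linarith : 0 < p - 1)).const_mul (2 * 2 ^ p)
    rw [mul_zero] at h1
    obtain ⟨R, h, h'⟩ := ((h1.eventually_le_const hε).and (eventually_ge_atTop 1)).exists
    exact ⟨R, h', h⟩
  refine ⟨8 * R ^ 3 / ε, by positivity, fun a b => ?_⟩
  have hS := areaDefect_nonneg a b
  have hp0 : 0 ≤ p := by linarith
  -- the case of a large vector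
  have large : ∀ a b : V, areaFun b ≤ areaFun a → R < areaFun a →
      ‖a - b‖ ≤ ε * (1 + ‖a‖ ^ p + ‖b‖ ^ p) := by
    intro a b hba hRa
    have ha1 := one_le_areaFun a
    have h1 : ‖a - b‖ ≤ 2 * areaFun a := by
      have := norm_sub_le a b
      linarith [norm_le_areaFun a, norm_le_areaFun b]
    have h2 : areaFun a = areaFun a ^ (-(p - 1)) * areaFun a ^ p := by
      rw [← Real.rpow_add (by linarith)]
      norm_num
    have h3 : areaFun a ^ (-(p - 1)) ≤ R ^ (-(p - 1)) :=
      Real.rpow_le_rpow_of_nonpos (by linarith) hRa.le (by linarith)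
    have h4 : areaFun a ^ p ≤ 2 ^ p * (1 + ‖a‖ ^ p) := by
      refine (Real.rpow_le_rpow (by linarith) (areaFun_le a) hp0).trans ?_
      have := add_rpow_le_two_rpow_mul hp0 zero_le_one (norm_nonneg a)
      rwa [Real.one_rpow] at this
    calc ‖a - b‖ ≤ 2 * areaFun a := h1
      _ = 2 * (areaFun a ^ (-(p - 1)) * areaFun a ^ p) := by rw [← h2]
      _ ≤ 2 * (R ^ (-(p - 1)) * (2 ^ p * (1 + ‖a‖ ^ p))) := by gcongr
      _ = (2 * 2 ^ p * R ^ (-(p - 1))) * (1 + ‖a‖ ^ p) := by ring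
      _ ≤ ε * (1 + ‖a‖ ^ p) := by gcongr
      _ ≤ _ := by
        have : 0 ≤ ‖b‖ ^ p := by positivity
        nlinarith
  have hC : 0 ≤ 8 * R ^ 3 / ε * areaDefect a b := by positivity
  by_cases hRa : R < max (areaFun a) (areaFun b)
  · rcases le_total (areaFun b) (areaFun a) with h | h
    · rw [max_eq_left h] at hRa
      linarith [large a b h hRa]
    · rw [max_eq_right h] at hRa
      have := large b a h hRa
      rw [norm_sub_rev] at this
      linarith
  · push Not at hRa
    have ha := (le_max_left _ _).trans hRa
    have hb := (le_max_right _ _).trans hRa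
    have ha1 := one_le_areaFun a
    have hb1 := one_le_areaFun b
    by_cases hd : ‖a - b‖ ≤ ε
    · have h1 : 0 ≤ ‖a‖ ^ p := by positivity
      have h2 : 0 ≤ ‖b‖ ^ p := by positivity
      nlinarith
    · push Not at hd
      have h1 := norm_sub_sq_le_areaDefect a b
      have h2 : 4 * (areaFun a * areaFun b * (areaFun a + areaFun b)) ≤ 8 * R ^ 3 := by
        calc 4 * (areaFun a * areaFun b * (areaFun a + areaFun b)) ≤ 4 * (R * R * (R + R)) := by
              gcongr
          _ = 8 * R ^ 3 := by ring
      have h3 : ‖a - b‖ ≤ 8 * R ^ 3 / ε * areaDefect a b := by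
        rw [div_mul_eq_mul_div, le_div_iff₀ hε]
        calc ‖a - b‖ * ε ≤ ‖a - b‖ * ‖a - b‖ := by gcongr
          _ = ‖a - b‖ ^ 2 := by ring
          _ ≤ _ := h1.trans (by gcongr)
      have h4 : 0 ≤ ‖a‖ ^ p := by positivity
      have h5 : 0 ≤ ‖b‖ ^ p := by positivity
      have : 0 ≤ ε * (1 + ‖a‖ ^ p + ‖b‖ ^ p) := by positivity
      linarith

end Gradients

/-! ### Lower semicontinuity of the energy -/

section LowerSemicontinuity

lemma ennreal_liminf_add_le (a b : ℕ → ℝ≥0∞) :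
    liminf a atTop + liminf b atTop ≤ liminf (fun n => a n + b n) atTop := by
  rw [Filter.liminf_eq_iSup_iInf_of_nat, Filter.liminf_eq_iSup_iInf_of_nat,
    Filter.liminf_eq_iSup_iInf_of_nat, ENNReal.iSup_add_iSup_of_monotone]
  · refine iSup_mono fun n => le_iInf₂ fun i hi => add_le_add (iInf₂_le i hi) (iInf₂_le i hi)
  · intro m n hmn
    exact le_iInf₂ fun i hi => iInf₂_le i (hmn.trans hi)
  · intro m n hmn
    exact le_iInf₂ fun i hi => iInf₂_le i (hmn.trans hi)

variable {N : ℕ} {Ω : Set (EuclideanSpace ℝ (Fin N))} {p s : ℝ}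
  {H : EuclideanSpace ℝ (Fin N) → ℝ}

lemma ofReal_energy (hN : 1 ≤ N) (hp : 1 < p) (hs₀ : 0 < s) (hs₁ : s < 1)
    (hH : IsFinslerMinkowskiNorm H) {u : EuclideanSpace ℝ (Fin N) → ℝ} (hu : MemW01p Ω p u) :
    ENNReal.ofReal (energy Ω H p s u) = (∫⁻ x in Ω, ENNReal.ofReal (H (weakGradient u x) ^ p)) +
      ∫⁻ z : EuclideanSpace ℝ (Fin N) × EuclideanSpace ℝ (Fin N),
        ENNReal.ofReal (|u z.1 - u z.2| ^ p * kernel N p s z) := by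
  have n1 : ∀ x, 0 ≤ H (weakGradient u x) ^ p := fun x => Real.rpow_nonneg (hH.nonneg _) _
  have n2 : ∀ z : EuclideanSpace ℝ (Fin N) × EuclideanSpace ℝ (Fin N),
      0 ≤ |u z.1 - u z.2| ^ p * kernel N p s z :=
    fun z => mul_nonneg (by positivity) (kernel_nonneg z)
  unfold energy
  rw [ENNReal.ofReal_add (integral_nonneg n1) (integral_nonneg n2),
    ofReal_integral_eq_lintegral_ofReal (hH.integrable_rpow hp hu).restrict (ae_of_all _ n1),
    ofReal_integral_eq_lintegral_ofReal (hu.integrable_gagliardo hN hp hs₀ hs₁) (ae_of_all _ n2)]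

/-- Lower semicontinuity of the energy under almost everywhere convergence of the functions and of
their gradients. -/
lemma energy_le_of_ae_tendsto (hN : 1 ≤ N) (hp : 1 < p) (hs₀ : 0 < s) (hs₁ : s < 1)
    (hH : IsFinslerMinkowskiNorm H) {w : ℕ → EuclideanSpace ℝ (Fin N) → ℝ}
    {u : EuclideanSpace ℝ (Fin N) → ℝ} (hw : ∀ n, MemW01p Ω p (w n)) (hu : MemW01p Ω p u)
    (h1 : ∀ᵐ x, Tendsto (fun n => w n x) atTop (𝓝 (u x)))
    (h2 : ∀ᵐ x, Tendsto (fun n => weakGradient (w n) x) atTop (𝓝 (weakGradient u x)))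
    {l : ℕ → ℝ} {L : ℝ} (hl : ∀ n, energy Ω H p s (w n) ≤ l n) (hL : Tendsto l atTop (𝓝 L)) :
    energy Ω H p s u ≤ L := by
  have hp0 : 0 < p := by linarith
  have hL0 : 0 ≤ L := ge_of_tendsto' hL fun n => (energy_nonneg hH).trans (hl n)
  rw [← ENNReal.ofReal_le_ofReal_iff hL0, ofReal_energy hN hp hs₀ hs₁ hH hu]
  have f1 : ∫⁻ x in Ω, ENNReal.ofReal (H (weakGradient u x) ^ p) ≤
      liminf (fun n => ∫⁻ x in Ω, ENNReal.ofReal (H (weakGradient (w n) x) ^ p)) atTop := by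
    refine le_trans (le_of_eq (lintegral_congr_ae ?_)) (lintegral_liminf_le' fun n => ?_)
    · filter_upwards [ae_restrict_of_ae h2] with x hx
      refine (Tendsto.liminf_eq ?_).symm
      exact ENNReal.tendsto_ofReal (((hH.continuous.tendsto _).comp hx).rpow_const (Or.inr hp0.le))
    · exact (hH.integrable_rpow hp (hw n)).restrict.1.aemeasurable.ennreal_ofReal
  have f2 : ∫⁻ z : EuclideanSpace ℝ (Fin N) × EuclideanSpace ℝ (Fin N),
        ENNReal.ofReal (|u z.1 - u z.2| ^ p * kernel N p s z) ≤
      liminf (fun n => ∫⁻ z : EuclideanSpace ℝ (Fin N) × EuclideanSpace ℝ (Fin N),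
        ENNReal.ofReal (|w n z.1 - w n z.2| ^ p * kernel N p s z)) atTop := by
    refine le_trans (le_of_eq (lintegral_congr_ae ?_)) (lintegral_liminf_le' fun n => ?_)
    · have a1 : ∀ᵐ z : EuclideanSpace ℝ (Fin N) × EuclideanSpace ℝ (Fin N),
          Tendsto (fun n => w n z.1) atTop (𝓝 (u z.1)) := Measure.quasiMeasurePreserving_fst.ae h1
      have a2 : ∀ᵐ z : EuclideanSpace ℝ (Fin N) × EuclideanSpace ℝ (Fin N),
          Tendsto (fun n => w n z.2) atTop (𝓝 (u z.2)) := Measure.quasiMeasurePreserving_snd.ae h1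
      filter_upwards [a1, a2] with z hz1 hz2
      refine (Tendsto.liminf_eq ?_).symm
      exact ENNReal.tendsto_ofReal ((((hz1.sub hz2).abs).rpow_const (Or.inr hp0.le)).mul_const _)
    · exact (aestronglyMeasurable_gagliardo (hw n).memLp.1).aemeasurable.ennreal_ofReal
  refine (add_le_add f1 f2).trans ?_
  refine le_trans (ennreal_liminf_add_le
    (fun n => ∫⁻ x in Ω, ENNReal.ofReal (H (weakGradient (w n) x) ^ p))
    (fun n => ∫⁻ z : EuclideanSpace ℝ (Fin N) × EuclideanSpace ℝ (Fin N),
        ENNReal.ofReal (|w n z.1 - w n z.2| ^ p * kernel N p s z))) ?_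
  have f3 : Tendsto (fun n => ENNReal.ofReal (l n)) atTop (𝓝 (ENNReal.ofReal L)) :=
    ENNReal.tendsto_ofReal hL
  rw [← f3.liminf_eq]
  refine liminf_le_liminf (Eventually.of_forall fun n => ?_)
  rw [← ofReal_energy hN hp hs₀ hs₁ hH (hw n)]
  exact ENNReal.ofReal_le_ofReal (hl n)

/-- Weak gradients pass to the limit when the functions converge in `L^p` and the gradients in
`L^1`. -/
lemma hasWeakDeriv_of_tendsto (hp : 1 < p) {w : ℕ → EuclideanSpace ℝ (Fin N) → ℝ}
    {u : EuclideanSpace ℝ (Fin N) → ℝ}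
    {G : EuclideanSpace ℝ (Fin N) → EuclideanSpace ℝ (Fin N)} (hw : ∀ n, MemW01p Ω p (w n))
    (hu : MemLp u (ENNReal.ofReal p) volume) (hGm : LocallyIntegrable G volume)
    (h1 : Tendsto (fun n => eLpNorm (fun x => w n x - u x) (ENNReal.ofReal p) volume) atTop (𝓝 0))
    (h2 : Tendsto (fun n => ∫⁻ x, ‖weakGradient (w n) x - G x‖ₑ) atTop (𝓝 0))
    (e : EuclideanSpace ℝ (Fin N)) : HasWeakDeriv volume e u (fun x => inner ℝ (G x) e) := by
  intro φ hφ hc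
  have hφ1 : ContDiff ℝ 1 φ := hφ.of_le (by exact_mod_cast le_top)
  have hDc : Continuous fun x => fderiv ℝ φ x e :=
    (hφ1.continuous_fderiv (by norm_num)).clm_apply continuous_const
  have hDs : HasCompactSupport fun x => fderiv ℝ φ x e := hc.fderiv_apply (𝕜 := ℝ) e
  have hul := locallyIntegrable_of_memLp hp.le hu
  have iu : Integrable (fun x => u x * fderiv ℝ φ x e) volume :=
    hul.integrable_smul_right_of_hasCompactSupport hDc hDs
  have iw : ∀ n, Integrable (fun x => w n x * fderiv ℝ φ x e) volume := fun n =>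
    (locallyIntegrable_of_memLp hp.le (hw n).memLp).integrable_smul_right_of_hasCompactSupport hDc hDs
  have iG : Integrable (fun x => (inner ℝ (G x) e : ℝ) * φ x) volume :=
    (LocallyIntegrable.inner_const' hGm e).integrable_smul_right_of_hasCompactSupport
      hφ.continuous hc
  have iwG : ∀ n, Integrable (fun x => (inner ℝ (weakGradient (w n) x) e : ℝ) * φ x) volume := fun n =>
    (locallyIntegrable_of_memLp hp.le ((hw n).memLp_inner
      e)).integrable_smul_right_of_hasCompactSupport hφ.continuous hc
  have t1 : Tendsto (fun n => ∫ x, w n x * fderiv ℝ φ x e) atTop (𝓝 (∫ x, u x * fderiv ℝ φ x e)) := by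
    refine tendsto_integral_of_L1 _ iu.1 (Eventually.of_forall iw) ?_
    have := tendsto_lintegral_mul_of_tendsto_eLpNorm hp (fun n => (hw n).memLp.1.sub hu.1) h1 hDc hDs
    simpa only [← sub_mul, Pi.sub_apply] using this
  have t2 : Tendsto (fun n => ∫ x, (inner ℝ (weakGradient (w n) x) e : ℝ) * φ x) atTop
      (𝓝 (∫ x, (inner ℝ (G x) e : ℝ) * φ x)) := by
    refine tendsto_integral_of_L1 _ iG.1 (Eventually.of_forall iwG) ?_
    obtain ⟨C, hC⟩ := hc.exists_bound_of_continuous hφ.continuous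
    have h3 := ENNReal.Tendsto.const_mul (a := ENNReal.ofReal (‖e‖ * C)) h2
      (Or.inr ENNReal.ofReal_ne_top)
    rw [mul_zero] at h3
    refine tendsto_of_tendsto_of_tendsto_of_le_of_le tendsto_const_nhds h3 (fun _ => zero_le)
      fun n => ?_
    simp only
    rw [← lintegral_const_mul' _ _ ENNReal.ofReal_ne_top]
    refine lintegral_mono fun x => ?_
    rw [← sub_mul, ← inner_sub_left, ← ofReal_norm, ← ofReal_norm,
      ← ENNReal.ofReal_mul (mul_nonneg (norm_nonneg _) ((norm_nonneg _).trans (hC 0)))]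
    refine ENNReal.ofReal_le_ofReal ?_
    rw [norm_mul]
    calc _ ≤ (‖weakGradient (w n) x - G x‖ * ‖e‖) * C :=
          mul_le_mul (norm_inner_le_norm _ _) (hC x) (norm_nonneg _) (by positivity)
      _ = _ := by ring
  have t3 := t2.neg
  refine tendsto_nhds_unique t1 (t3.congr fun n => ?_)
  exact ((hw n).hasWeakDeriv e φ hφ hc).symm

end LowerSemicontinuity

/-! ### Compactness of sequences of bounded energy -/

section Compactness

/-- Almost minimizers of a bounded function over a decreasing sequence of sets: the infima over the
sets converge, so that midpoints of late almost minimizers cannot improve them by much. -/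
lemma exists_almost_minimizing {X : Type*} {K : ℕ → Set X} (hK : Antitone K)
    (hne : ∀ n, (K n).Nonempty) {Ψ : X → ℝ} {B : ℝ} (h0 : ∀ x, 0 ≤ Ψ x) (hB : ∀ x ∈ K 0, Ψ x ≤ B) :
    ∃ v : ℕ → X, (∀ n, v n ∈ K n) ∧ ∀ ε : ℝ, 0 < ε → ∃ n₀, ∀ j ≥ n₀, ∀ k ≥ j, ∀ y ∈ K j,
      (Ψ (v j) + Ψ (v k)) / 2 - Ψ y ≤ ε := by
  set m : ℕ → ℝ := fun n => sInf (Ψ '' K n) with hm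
  have hbdd : ∀ n, BddBelow (Ψ '' K n) := fun n => ⟨0, by rintro _ ⟨x, -, rfl⟩; exact h0 x⟩
  have hne' : ∀ n, (Ψ '' K n).Nonempty := fun n => (hne n).image Ψ
  have hmono : Monotone m := fun i j hij => csInf_le_csInf (hbdd i) (hne' j) (image_mono (hK hij))
  have hmB : ∀ n, m n ≤ B := by
    intro n
    obtain ⟨x, hx⟩ := hne n
    exact (csInf_le (hbdd n) ⟨x, hx, rfl⟩).trans (hB x (hK (Nat.zero_le n) hx))
  have hv : ∀ n : ℕ, ∃ x ∈ K n, Ψ x < m n + 1 / ((n : ℝ) + 1) := by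
    intro n
    obtain ⟨_, ⟨x, hx, rfl⟩, h⟩ := exists_lt_of_csInf_lt (hne' n)
      (show sInf (Ψ '' K n) < m n + 1 / ((n : ℝ) + 1) by
        have : (0 : ℝ) < 1 / ((n : ℝ) + 1) := by positivity
        simp only [hm]; linarith)
    exact ⟨x, hx, h⟩
  choose v hvK hv using hv
  refine ⟨v, hvK, fun ε hε => ?_⟩
  have hlim := tendsto_atTop_ciSup hmono ⟨B, by rintro _ ⟨n, rfl⟩; exact hmB n⟩
  have hsup : ∀ n, m n ≤ ⨆ n, m n := fun n => hmono.ge_of_tendsto hlim n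
  have e1 := (hlim.eventually (lt_mem_nhds (show (⨆ n, m n) - ε < ⨆ n, m n by linarith))).and
    ((tendsto_one_div_add_atTop_nhds_zero_nat (𝕜 := ℝ)).eventually
      (gt_mem_nhds (show (0:ℝ) < ε / 2 by linarith)))
  obtain ⟨n₀, hn₀⟩ := eventually_atTop.1 e1
  refine ⟨n₀, fun j hj k hk y hy => ?_⟩
  obtain ⟨h1, h2⟩ := hn₀ j hj
  obtain ⟨-, h4⟩ := hn₀ k (hj.trans hk)
  have h5 : m j ≤ Ψ y := csInf_le (hbdd j) ⟨y, hy, rfl⟩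
  have h6 := hv j
  have h7 := hv k
  have h8 := hsup k
  linarith

variable {N : ℕ} {Ω : Set (EuclideanSpace ℝ (Fin N))} {p s : ℝ}
  {H : EuclideanSpace ℝ (Fin N) → ℝ}

lemma integrable_areaFun (hp : 1 < p) (hfin : volume Ω ≠ ⊤) {v : EuclideanSpace ℝ (Fin N) → ℝ}
    (hv : MemW01p Ω p v) :
    Integrable (fun x => areaFun (weakGradient v x)) (volume.restrict Ω) ∧
      ∀ x, areaFun (weakGradient v x) ≤ 2 + ‖weakGradient v x‖ ^ p := by
  have hb : ∀ x, areaFun (weakGradient v x) ≤ 2 + ‖weakGradient v x‖ ^ p := by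
    intro x
    refine (areaFun_le _).trans ?_
    rcases le_total ‖weakGradient v x‖ 1 with h | h
    · have : 0 ≤ ‖weakGradient v x‖ ^ p := by positivity
      linarith
    · have := Real.self_le_rpow_of_one_le h hp.le
      linarith
  have hfin' : IsFiniteMeasure (volume.restrict Ω) := ⟨by simpa using hfin.lt_top⟩
  refine ⟨?_, hb⟩
  refine ((integrable_const (2 : ℝ)).add (integrable_norm_rpow_of_memLp (by linarith)
    hv.memLp_weakGradient).restrict).mono' ?_ (ae_of_all _ fun x => ?_)
  · have hc : Continuous (areaFun : EuclideanSpace ℝ (Fin N) → ℝ) := by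
      unfold areaFun; fun_prop
    exact hc.comp_aestronglyMeasurable hv.memLp_weakGradient.1.restrict
  · rw [Real.norm_of_nonneg (zero_le_one.trans (one_le_areaFun _))]
    exact hb x

lemma exists_integral_norm_rpow_le_energy (hp : 1 < p) (hH : IsFinslerMinkowskiNorm H) :
    ∃ C : ℝ, 0 ≤ C ∧ ∀ v : EuclideanSpace ℝ (Fin N) → ℝ, MemW01p Ω p v →
      ∫ x in Ω, ‖weakGradient v x‖ ^ p ≤ C * energy Ω H p s v := by
  obtain ⟨C₁, C₂, hC₁, hC, hb⟩ := hH.equivalent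
  have hp0 : 0 < p := by linarith
  refine ⟨(C₁ ^ p)⁻¹, by positivity, fun v hv => ?_⟩
  have i1 := (hH.integrable_rpow hp hv).restrict (s := Ω)
  have i2 := (integrable_norm_rpow_of_memLp hp0 hv.memLp_weakGradient).restrict (s := Ω)
  have h1 : ∫ x in Ω, ‖weakGradient v x‖ ^ p ≤
      ∫ x in Ω, (C₁ ^ p)⁻¹ * H (weakGradient v x) ^ p := by
    refine integral_mono i2 (i1.const_mul _) fun x => ?_
    simp only
    rw [inv_mul_eq_div, le_div_iff₀ (by positivity), mul_comm,
      ← Real.mul_rpow hC₁.le (norm_nonneg _)]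
    exact Real.rpow_le_rpow (by positivity) (hb _).1 hp0.le
  refine h1.trans ?_
  rw [integral_const_mul]
  have h2 : 0 ≤ ∫ z : EuclideanSpace ℝ (Fin N) × EuclideanSpace ℝ (Fin N),
      |v z.1 - v z.2| ^ p * kernel N p s z :=
    integral_nonneg fun z => mul_nonneg (by positivity) (kernel_nonneg z)
  refine mul_le_mul_of_nonneg_left ?_ (by positivity)
  unfold energy
  linarith

lemma eLpNorm_midpoint_sub_le (hp : 1 ≤ p) {v v' u : EuclideanSpace ℝ (Fin N) → ℝ}
    (hv : MemLp v (ENNReal.ofReal p) volume) (hv' : MemLp v' (ENNReal.ofReal p) volume)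
    (hu : MemLp u (ENNReal.ofReal p) volume) {ε : ℝ} (hε : 0 ≤ ε)
    (h : eLpNorm (fun x => v x - u x) (ENNReal.ofReal p) volume ≤ ENNReal.ofReal ε)
    (h' : eLpNorm (fun x => v' x - u x) (ENNReal.ofReal p) volume ≤ ENNReal.ofReal ε) :
    eLpNorm (fun x => (1 / 2 * v x + 1 / 2 * v' x) - u x) (ENNReal.ofReal p) volume ≤
      ENNReal.ofReal ε := by
  have e : (fun x => (1 / 2 * v x + 1 / 2 * v' x) - u x) =
      ((1 / 2 : ℝ) • fun x => v x - u x) + (1 / 2 : ℝ) • fun x => v' x - u x := by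
    ext x; simp only [Pi.add_apply, Pi.smul_apply, smul_eq_mul]; ring
  have c : ‖(1 / 2 : ℝ)‖ₑ = ENNReal.ofReal (1 / 2) := Real.enorm_eq_ofReal (by norm_num)
  rw [e]
  refine (eLpNorm_add_le ((hv.1.sub hu.1).const_smul _) ((hv'.1.sub hu.1).const_smul _)
    (by simpa using ENNReal.ofReal_le_ofReal hp)).trans ?_
  rw [eLpNorm_const_smul, eLpNorm_const_smul, c]
  refine (add_le_add (mul_le_mul_right h _) (mul_le_mul_right h' _)).trans ?_
  rw [← ENNReal.ofReal_mul (by norm_num), ← ENNReal.ofReal_add (by positivity) (by positivity)]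
  exact ENNReal.ofReal_le_ofReal (le_of_eq (by ring))

/-- The `L^1` distance of two gradients is controlled by the convexity defect of
`∫ √(1 + |∇w|²)` at the midpoint. -/
lemma exists_integral_norm_sub_gradient_le (hp : 1 < p) (hfin : volume Ω ≠ ⊤) {δ : ℝ} (hδ : 0 < δ) :
    ∃ D : ℝ, 0 ≤ D ∧ ∀ v v' : EuclideanSpace ℝ (Fin N) → ℝ, MemW01p Ω p v → MemW01p Ω p v' →
      ∫ x in Ω, ‖weakGradient v x - weakGradient v' x‖ ≤
        δ * (volume.real Ω + (∫ x in Ω, ‖weakGradient v x‖ ^ p) +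
            ∫ x in Ω, ‖weakGradient v' x‖ ^ p) +
          D * (((∫ x in Ω, areaFun (weakGradient v x)) + ∫ x in Ω, areaFun (weakGradient v' x)) / 2 -
            ∫ x in Ω, areaFun (weakGradient (fun x => 1 / 2 * v x + 1 / 2 * v' x) x)) := by
  have hp0 : 0 < p := by linarith
  have hfin' : IsFiniteMeasure (volume.restrict Ω) := ⟨by simpa using hfin.lt_top⟩
  obtain ⟨D, hD0, hD⟩ := exists_norm_sub_le_areaDefect (V := EuclideanSpace ℝ (Fin N)) hp hδ
  refine ⟨D, hD0, fun v v' hv hv' => ?_⟩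
  obtain ⟨hmid, hg⟩ := hv.lin_comb hv' hp.le (1 / 2) (1 / 2)
  obtain ⟨i1, -⟩ := integrable_areaFun hp hfin hv
  obtain ⟨i2, -⟩ := integrable_areaFun hp hfin hv'
  obtain ⟨i3, -⟩ := integrable_areaFun hp hfin hmid
  have ed : (fun x => (areaFun (weakGradient v x) + areaFun (weakGradient v' x)) / 2 -
      areaFun (weakGradient (fun x => 1 / 2 * v x + 1 / 2 * v' x) x)) =ᵐ[volume.restrict Ω]
      fun x => areaDefect (weakGradient v x) (weakGradient v' x) := by
    filter_upwards [ae_restrict_of_ae hg] with x hx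
    rw [hx, areaDefect]
  have i4 : Integrable (fun x => areaDefect (weakGradient v x) (weakGradient v' x))
      (volume.restrict Ω) := (((i1.add i2).div_const 2).sub i3).congr ed
  have h4 : ∫ x in Ω, areaDefect (weakGradient v x) (weakGradient v' x) =
      ((∫ x in Ω, areaFun (weakGradient v x)) + ∫ x in Ω, areaFun (weakGradient v' x)) / 2 -
        ∫ x in Ω, areaFun (weakGradient (fun x => 1 / 2 * v x + 1 / 2 * v' x) x) := by
    have i12 : Integrable (fun x => (areaFun (weakGradient v x) + areaFun (weakGradient v' x)) / 2)
      (volume.restrict Ω) := (i1.add i2).div_const 2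
    rw [← integral_congr_ae ed, integral_sub i12 i3, integral_div, integral_add i1 i2]
  have j1 := (integrable_norm_rpow_of_memLp hp0 hv.memLp_weakGradient).restrict (s := Ω)
  have j2 := (integrable_norm_rpow_of_memLp hp0 hv'.memLp_weakGradient).restrict (s := Ω)
  have j4 : Integrable (fun x => 1 + ‖weakGradient v x‖ ^ p) (volume.restrict Ω) :=
    (integrable_const _).add j1
  have j5 : Integrable (fun x => 1 + ‖weakGradient v x‖ ^ p + ‖weakGradient v' x‖ ^ p)
      (volume.restrict Ω) := j4.add j2
  have j3 : Integrable (fun x => δ * (1 + ‖weakGradient v x‖ ^ p + ‖weakGradient v' x‖ ^ p))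
      (volume.restrict Ω) := j5.const_mul δ
  have jd : Integrable (fun x => weakGradient v x - weakGradient v' x) (volume.restrict Ω) :=
    ((hv.memLp_weakGradient.sub hv'.memLp_weakGradient).restrict Ω).integrable
      (by simpa using ENNReal.ofReal_le_ofReal hp.le)
  have := integral_mono jd.norm (j3.add (i4.const_mul D))
    (fun x => hD (weakGradient v x) (weakGradient v' x))
  refine this.trans (le_of_eq ?_)
  simp only [Pi.add_apply]
  rw [integral_add j3 (i4.const_mul D), integral_const_mul, integral_const_mul,
    integral_add j4 j2, integral_add (integrable_const _) j1, integral_const, smul_eq_mul,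
    mul_one, measureReal_restrict_apply_univ, h4]

/-- A limit in `L^p` of functions of bounded energy lies in `W₀^{1,p}`, and the energy is lower
semicontinuous. Among the functions that are close to the limit and have almost minimal energy,
those nearly minimizing the strictly convex functional `∫ √(1 + |∇w|²)` have gradients that
converge in `L^1`, so that no weak compactness is needed. -/
lemma memW01p_and_energy_le_of_tendsto (hN : 1 ≤ N) (hp : 1 < p) (hs₀ : 0 < s) (hs₁ : s < 1)
    (hfin : volume Ω ≠ ⊤)
    (hH : IsFinslerMinkowskiNorm H) {w : ℕ → EuclideanSpace ℝ (Fin N) → ℝ}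
    {u : EuclideanSpace ℝ (Fin N) → ℝ} (hw : ∀ n, MemW01p Ω p (w n))
    (hu : MemLp u (ENNReal.ofReal p) volume)
    (h1 : Tendsto (fun n => eLpNorm (fun x => w n x - u x) (ENNReal.ofReal p) volume) atTop (𝓝 0))
    {L : ℝ} (hL : Tendsto (fun n => energy Ω H p s (w n)) atTop (𝓝 L)) :
    MemW01p Ω p u ∧ energy Ω H p s u ≤ L := by
  have hp0 : 0 < p := by linarith
  have hfin' : IsFiniteMeasure (volume.restrict Ω) := ⟨by simpa using hfin.lt_top⟩
  have hL0 : 0 ≤ L := ge_of_tendsto' hL fun n => energy_nonneg hH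
  set ε : ℕ → ℝ := fun n => 1 / ((n : ℝ) + 1) with hε
  have hε0 : ∀ n, 0 < ε n := fun n => by positivity
  have hεa : Antitone ε := fun i j hij => one_div_le_one_div_of_le (by positivity) (by simpa using hij)
  have hεt : Tendsto ε atTop (𝓝 0) := tendsto_one_div_add_atTop_nhds_zero_nat
  set K : ℕ → Set (EuclideanSpace ℝ (Fin N) → ℝ) := fun n => {v | MemW01p Ω p v ∧
    eLpNorm (fun x => v x - u x) (ENNReal.ofReal p) volume ≤ ENNReal.ofReal (ε n) ∧
    energy Ω H p s v ≤ L + ε n} with hK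
  obtain ⟨C, hC0, hC⟩ := exists_integral_norm_rpow_le_energy (Ω := Ω) (s := s) hp hH
  set Ψ : (EuclideanSpace ℝ (Fin N) → ℝ) → ℝ :=
    fun v => ∫ x in Ω, areaFun (weakGradient v x) with hΨ
  have hgrad : ∀ n, ∀ v ∈ K n, ∫ x in Ω, ‖weakGradient v x‖ ^ p ≤ C * (L + 1) := by
    intro n v hv
    refine (hC v hv.1).trans (mul_le_mul_of_nonneg_left (hv.2.2.trans ?_) hC0)
    have : ε n ≤ 1 := by
      have := hεa (Nat.zero_le n)
      simpa [hε] using this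
    linarith
  have hKa : Antitone K := fun i j hij v hv =>
    ⟨hv.1, hv.2.1.trans (ENNReal.ofReal_le_ofReal (hεa hij)), hv.2.2.trans (by linarith [hεa hij])⟩
  have hKne : ∀ n, (K n).Nonempty := by
    intro n
    have e1 := (ENNReal.tendsto_nhds_zero.1 h1) (ENNReal.ofReal (ε n)) (by simpa using hε0 n)
    have e2 := hL.eventually_le_const (show L < L + ε n by linarith [hε0 n])
    obtain ⟨k, hk1, hk2⟩ := (e1.and e2).exists
    exact ⟨w k, hw k, hk1, hk2⟩
  have hKm : ∀ n, ∀ v ∈ K n, ∀ v' ∈ K n, (fun x => 1 / 2 * v x + 1 / 2 * v' x) ∈ K n := by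
    intro n v hv v' hv'
    refine ⟨(hv.1.lin_comb hv'.1 hp.le _ _).1, ?_, ?_⟩
    · exact eLpNorm_midpoint_sub_le hp.le hv.1.memLp hv'.1.memLp hu (hε0 n).le hv.2.1 hv'.2.1
    · refine (energy_midpoint_le hN hp hs₀ hs₁ hH hv.1 hv'.1).trans ?_
      linarith [hv.2.2, hv'.2.2]
  have hΨB : ∀ v ∈ K 0, Ψ v ≤ 2 * volume.real Ω + C * (L + 1) := by
    intro v hv
    obtain ⟨i1, hb⟩ := integrable_areaFun hp hfin hv.1
    have i2 := (integrable_norm_rpow_of_memLp hp0 hv.1.memLp_weakGradient).restrict (s := Ω)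
    have := integral_mono i1 ((integrable_const (2 : ℝ)).add i2) hb
    refine this.trans ?_
    simp only [Pi.add_apply]
    rw [integral_add (integrable_const _) i2, integral_const]
    have := hgrad 0 v hv
    simp only [measureReal_restrict_apply_univ, smul_eq_mul]
    linarith
  obtain ⟨v, hvK, hv⟩ := exists_almost_minimizing hKa hKne
    (fun v => integral_nonneg fun x => zero_le_one.trans (one_le_areaFun _)) hΨB
  -- the gradients of the almost minimizers form a Cauchy sequence in `L^1`
  have hint1 : ∀ n, Integrable (weakGradient (v n)) volume := by
    intro n
    have : IntegrableOn (weakGradient (v n)) Ω volume := by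
      refine MemLp.integrable (q := ENNReal.ofReal p) (by simpa using ENNReal.ofReal_le_ofReal hp.le)
        ((hvK n).1.memLp_weakGradient.restrict Ω)
    exact this.integrable_of_ae_notMem_eq_zero ((hvK n).1.weakGradient_eq_zero_off hp)
  have hcauchy : ∀ δ : ℝ, 0 < δ → ∃ n₀, ∀ j ≥ n₀, ∀ k ≥ j,
      ∫⁻ x, ‖weakGradient (v j) x - weakGradient (v k) x‖ₑ ≤ ENNReal.ofReal δ := by
    intro δ hδ
    set R : ℝ := volume.real Ω + 2 * (C * (L + 1)) + 1 with hR
    have hR0 : 0 < R := by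
      have : 0 ≤ volume.real Ω := measureReal_nonneg
      positivity
    obtain ⟨D, hD0, hD⟩ := exists_integral_norm_sub_gradient_le hp hfin
      (show 0 < δ / 2 / R by positivity)
    obtain ⟨n₀, hn₀⟩ := hv (δ / 2 / (D + 1)) (by positivity)
    refine ⟨n₀, fun j hj k hk => ?_⟩
    have h3 := hn₀ j hj k hk _ (hKm j _ (hvK j) _ (hKa hk (hvK k)))
    have jd : Integrable (fun x => weakGradient (v j) x - weakGradient (v k) x) volume :=
      (hint1 j).sub (hint1 k)
    have h5 : ∫ x in Ω, ‖weakGradient (v j) x - weakGradient (v k) x‖ ≤ δ := by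
      refine (hD _ _ (hvK j).1 (hvK k).1).trans ?_
      have a1 : volume.real Ω + (∫ x in Ω, ‖weakGradient (v j) x‖ ^ p) +
          (∫ x in Ω, ‖weakGradient (v k) x‖ ^ p) ≤ R := by
        have := hgrad j _ (hvK j)
        have := hgrad k _ (hvK k)
        linarith
      have a2 : δ / 2 / R * (volume.real Ω + (∫ x in Ω, ‖weakGradient (v j) x‖ ^ p) +
          (∫ x in Ω, ‖weakGradient (v k) x‖ ^ p)) ≤ δ / 2 := by
        refine (mul_le_mul_of_nonneg_left a1 (by positivity)).trans_eq ?_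
        field_simp
      have a3 := (mul_le_mul_of_nonneg_left h3 hD0)
      have a4 : D * (δ / 2 / (D + 1)) ≤ δ / 2 := by
        rw [mul_div_assoc', div_le_iff₀ (by positivity)]
        nlinarith
      change D * ((((∫ x in Ω, areaFun (weakGradient (v j) x)) +
        ∫ x in Ω, areaFun (weakGradient (v k) x)) / 2) - ∫ x in Ω, areaFun
        (weakGradient (fun x => 1 / 2 * v j x + 1 / 2 * v k x) x)) ≤ _ at a3
      linarith
    have h6 : ∫ x, ‖weakGradient (v j) x - weakGradient (v k) x‖ =
        ∫ x in Ω, ‖weakGradient (v j) x - weakGradient (v k) x‖ := by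
      refine (setIntegral_eq_integral_of_ae_compl_eq_zero ?_).symm
      filter_upwards [(hvK j).1.weakGradient_eq_zero_off hp, (hvK k).1.weakGradient_eq_zero_off hp]
        with x h1 h2 h3
      rw [h1 h3, h2 h3, sub_zero, norm_zero]
    calc ∫⁻ x, ‖weakGradient (v j) x - weakGradient (v k) x‖ₑ
        = ENNReal.ofReal (∫ x, ‖weakGradient (v j) x - weakGradient (v k) x‖) :=
          (ofReal_integral_norm_eq_lintegral_enorm jd).symm
      _ ≤ _ := ENNReal.ofReal_le_ofReal (h6.le.trans h5)
  have hmem1 : ∀ n, MemLp (weakGradient (v n)) (ENNReal.ofReal 1) volume := fun n => by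
    rw [ENNReal.ofReal_one]; exact memLp_one_iff_integrable.2 (hint1 n)
  obtain ⟨G, hG1, hGt⟩ := exists_limit_of_cauchy (p := 1) le_rfl hmem1 (by
    intro δ hδ
    simp only [ENNReal.rpow_one]
    obtain ⟨δ', hδ'0, hδ'⟩ := ENNReal.lt_iff_exists_real_btwn.1 hδ
    obtain ⟨h7, h8⟩ := hδ'
    obtain ⟨n₀, hn₀⟩ := hcauchy δ' (by simpa using h7)
    refine ⟨n₀, fun m hm n hn => ?_⟩
    rcases le_total m n with h | h
    · exact (hn₀ m hm n h).trans h8.le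
    · refine le_trans (le_of_eq (lintegral_congr fun x => ?_)) ((hn₀ n hn m h).trans h8.le)
      rw [← enorm_neg, neg_sub])
  obtain ⟨θ, hθ, hGae, -⟩ := exists_subseq_ae_dominated (p := 1) le_rfl hmem1 hG1 hGt
  simp only [ENNReal.rpow_one] at hGt
  have hvt : Tendsto (fun n => eLpNorm (fun x => v n x - u x) (ENNReal.ofReal p) volume) atTop
      (𝓝 0) := by
    have : Tendsto (fun n => ENNReal.ofReal (ε n)) atTop (𝓝 0) := by
      simpa using ENNReal.tendsto_ofReal hεt
    exact tendsto_of_tendsto_of_tendsto_of_le_of_le tendsto_const_nhds this (fun _ => zero_le)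
      fun n => (hvK n).2.1
  -- the limit of the gradients lies in `L^p`
  have hGp : MemLp G (ENNReal.ofReal p) volume := by
    rw [memLp_ofReal_iff hp0]
    refine ⟨hG1.1, ?_⟩
    have f1 : ∫⁻ x, ‖G x‖ₑ ^ p ≤ liminf (fun n => ∫⁻ x, ‖weakGradient (v (θ n)) x‖ₑ ^ p) atTop := by
      refine le_trans (le_of_eq (lintegral_congr_ae ?_)) (lintegral_liminf_le' fun n => ?_)
      · filter_upwards [hGae] with x hx
        exact (Tendsto.liminf_eq ((ENNReal.continuous_rpow_const.tendsto _).comp hx.enorm)).symm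
      · exact (hint1 _).1.enorm.pow_const p
    have f2 : ∀ n, ∫⁻ x, ‖weakGradient (v (θ n)) x‖ₑ ^ p ≤ ENNReal.ofReal (C * (L + 1)) := by
      intro n
      have i1 := integrable_norm_rpow_of_memLp hp0 (hvK (θ n)).1.memLp_weakGradient
      have h6 : ∫ x, ‖weakGradient (v (θ n)) x‖ ^ p = ∫ x in Ω, ‖weakGradient (v (θ n)) x‖ ^ p := by
        refine (setIntegral_eq_integral_of_ae_compl_eq_zero ?_).symm
        filter_upwards [(hvK (θ n)).1.weakGradient_eq_zero_off hp] with x h1 h3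
        rw [h1 h3, norm_zero, Real.zero_rpow hp0.ne']
      calc ∫⁻ x, ‖weakGradient (v (θ n)) x‖ₑ ^ p
          = ∫⁻ x, ENNReal.ofReal (‖weakGradient (v (θ n)) x‖ ^ p) :=
            lintegral_congr fun x => enorm_rpow_eq_ofReal hp0.le _
        _ = ENNReal.ofReal (∫ x, ‖weakGradient (v (θ n)) x‖ ^ p) :=
            (ofReal_integral_eq_lintegral_ofReal i1 (ae_of_all _ fun x => by positivity)).symm
        _ ≤ _ := ENNReal.ofReal_le_ofReal (h6.le.trans (hgrad _ _ (hvK _)))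
    refine lt_of_le_of_lt (f1.trans ?_) (ENNReal.ofReal_lt_top (r := C * (L + 1)))
    refine (liminf_le_liminf (Eventually.of_forall f2)).trans ?_
    rw [liminf_const]
  have hu0 : ∀ᵐ x, x ∉ Ω → u x = 0 := by
    have huae := exists_subseq_ae_dominated hp.le (fun n => (hvK n).1.memLp) hu (by
      have := (ENNReal.continuous_rpow_const (y := p)).tendsto _ |>.comp hvt
      rw [ENNReal.zero_rpow_of_pos hp0] at this
      refine this.congr fun n => ?_
      simp only [Function.comp]
      rw [eLpNorm_ofReal_rpow hp0])
    obtain ⟨θ', -, ht, -⟩ := huae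
    have h9 : ∀ᵐ x, ∀ n, x ∉ Ω → v (θ' n) x = 0 := ae_all_iff.2 fun n => (hvK _).1.2
    filter_upwards [ht, h9] with x h1 h2 h3
    refine tendsto_nhds_unique h1 ?_
    simp only [h2 _ h3]
    exact tendsto_const_nhds
  obtain ⟨hmem, hgr⟩ := memW01p_of_hasWeakDeriv hp.le hu hGp (fun e =>
    hasWeakDeriv_of_tendsto hp (fun n => (hvK n).1) hu (locallyIntegrable_of_memLp hp.le hGp)
      hvt hGt e) hu0
  refine ⟨hmem, ?_⟩
  -- pass to a further subsequence along which the functions converge almost everywhere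
  obtain ⟨θ', hθ', ht, -⟩ := exists_subseq_ae_dominated hp.le
    (fun n => (hvK (θ n)).1.memLp) hu (by
      have := (ENNReal.continuous_rpow_const (y := p)).tendsto _ |>.comp (hvt.comp hθ.tendsto_atTop)
      rw [ENNReal.zero_rpow_of_pos hp0] at this
      refine this.congr fun n => ?_
      simp only [Function.comp]
      rw [eLpNorm_ofReal_rpow hp0])
  refine energy_le_of_ae_tendsto hN hp hs₀ hs₁ hH (w := fun n => v (θ (θ' n)))
    (l := fun n => L + ε (θ (θ' n))) (fun n => (hvK _).1) hmem ht ?_ (fun n => (hvK _).2.2) ?_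
  · filter_upwards [hGae, hgr] with x h1 h2
    rw [h2]
    exact h1.comp hθ'.tendsto_atTop
  · have := (hεt.comp (hθ.comp hθ').tendsto_atTop).const_add L
    simpa using this

/-- Sequences in `W₀^{1,p}(Ω)` of bounded energy and bounded `L^p` norm: after passing to a
subsequence they converge almost everywhere and dominated in `L^p`, and the energy is lower
semicontinuous. -/
theorem exists_subseq_energy_compact (hN : 1 ≤ N) (hp : 1 < p) (hs₀ : 0 < s) (hs₁ : s < 1)
    (hΩ : Bornology.IsBounded Ω) (hΩm : MeasurableSet Ω) (hH : IsFinslerMinkowskiNorm H)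
    {w : ℕ → EuclideanSpace ℝ (Fin N) → ℝ} (hw : ∀ n, MemW01p Ω p (w n)) {M : ℝ}
    (hwM : ∀ n, ∫ x in Ω, |w n x| ^ p ≤ M) (hE : ∀ n, energy Ω H p s (w n) ≤ M) :
    ∃ (θ : ℕ → ℕ) (u : EuclideanSpace ℝ (Fin N) → ℝ) (L : ℝ), StrictMono θ ∧ MemW01p Ω p u ∧
      Tendsto (fun n => energy Ω H p s (w (θ n))) atTop (𝓝 L) ∧ energy Ω H p s u ≤ L ∧
      (∀ᵐ x, Tendsto (fun n => w (θ n) x) atTop (𝓝 (u x))) ∧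
      ∃ g : EuclideanSpace ℝ (Fin N) → ℝ, Integrable g ∧ ∀ᵐ x, ∀ n, |w (θ n) x| ^ p ≤ g x := by
  have hp0 : 0 < p := by linarith
  have hfin : volume Ω ≠ ⊤ := hΩ.measure_lt_top.ne
  have hws : ∀ n, ∫⁻ z : EuclideanSpace ℝ (Fin N) × EuclideanSpace ℝ (Fin N),
        ENNReal.ofReal (|w n z.1 - w n z.2| ^ p * kernel N p s z) ≤ ENNReal.ofReal M := by
    intro n
    refine le_trans ?_ (ENNReal.ofReal_le_ofReal (hE n))
    rw [ofReal_energy hN hp hs₀ hs₁ hH (hw n)]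
    exact le_add_self
  have hwp : ∀ n, ∫⁻ x, ‖w n x‖ₑ ^ p ≤ ENNReal.ofReal M := by
    intro n
    have i1 := integrable_norm_rpow_of_memLp hp0 (hw n).memLp
    have h6 : ∫ x, ‖w n x‖ ^ p = ∫ x in Ω, ‖w n x‖ ^ p := by
      refine (setIntegral_eq_integral_of_ae_compl_eq_zero ?_).symm
      filter_upwards [(hw n).2] with x h1 h3
      rw [h1 h3, norm_zero, Real.zero_rpow hp0.ne']
    calc ∫⁻ x, ‖w n x‖ₑ ^ p = ∫⁻ x, ENNReal.ofReal (‖w n x‖ ^ p) :=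
          lintegral_congr fun x => enorm_rpow_eq_ofReal hp0.le _
      _ = ENNReal.ofReal (∫ x, ‖w n x‖ ^ p) :=
          (ofReal_integral_eq_lintegral_ofReal i1 (ae_of_all _ fun x => by positivity)).symm
      _ ≤ _ := ENNReal.ofReal_le_ofReal (h6.le.trans (hwM n))
  obtain ⟨θ₁, hθ₁, hc⟩ := exists_subseq_cauchy hp hs₀ hΩ hΩm ENNReal.ofReal_ne_top hw hwp hws
  obtain ⟨u, hu, hut⟩ := exists_limit_of_cauchy hp.le (fun n => (hw (θ₁ n)).memLp) hc
  obtain ⟨L, hL, θ₂, hθ₂, hEt⟩ := (isCompact_Icc (a := (0:ℝ)) (b := M)).tendsto_subseq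
    (x := fun n => energy Ω H p s (w (θ₁ n))) fun n => ⟨energy_nonneg hH, hE _⟩
  obtain ⟨θ₃, hθ₃, hae, g, hg, hgb⟩ := exists_subseq_ae_dominated hp.le
    (fun n => (hw (θ₁ (θ₂ n))).memLp) hu (hut.comp hθ₂.tendsto_atTop)
  have hEt' : Tendsto (fun n => energy Ω H p s (w (θ₁ (θ₂ (θ₃ n))))) atTop (𝓝 L) :=
    hEt.comp hθ₃.tendsto_atTop
  have hlast : Tendsto (fun n => eLpNorm (fun x => w (θ₁ (θ₂ (θ₃ n))) x - u x) (ENNReal.ofReal p)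
      volume) atTop (𝓝 0) := by
    have h1 := hut.comp (hθ₂.comp hθ₃).tendsto_atTop
    have := (ENNReal.continuous_rpow_const (y := 1 / p)).tendsto _ |>.comp h1
    rw [ENNReal.zero_rpow_of_pos (by positivity)] at this
    refine this.congr fun n => ?_
    simp only [Function.comp]
    rw [eLpNorm_ofReal_eq hp0]
  obtain ⟨m1, m2⟩ := memW01p_and_energy_le_of_tendsto hN hp hs₀ hs₁ hfin hH
    (fun n => hw (θ₁ (θ₂ (θ₃ n)))) hu hlast hEt'
  exact ⟨θ₁ ∘ θ₂ ∘ θ₃, u, L, hθ₁.comp (hθ₂.comp hθ₃), m1, hEt', m2, hae, g, hg, hgb⟩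

end Compactness

/-! ### Superposition operators and the asymptotic quotients of the nonlinearity -/

section Superposition

/-- Superposition with a Carathéodory function preserves measurability. -/
lemma aestronglyMeasurable_superposition {α : Type*} [MeasurableSpace α] {ρ : Measure α}
    {F : α → ℝ → ℝ} (hm : ∀ t, AEStronglyMeasurable (fun x => F x t) ρ)
    (hc : ∀ᵐ x ∂ρ, Continuous (F x)) {u : α → ℝ} (hu : AEMeasurable u ρ) :
    AEStronglyMeasurable (fun x => F x (u x)) ρ := by
  refine aestronglyMeasurable_of_tendsto_ae (u := atTop)
    (f := fun (n : ℕ) x => F x ((⌊((n : ℝ) + 1) * hu.mk u x⌋ : ℝ) / ((n : ℝ) + 1))) ?_ ?_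
  · intro n
    have e : ∀ᵐ x ∂ρ, ∀ k : ℤ, F x ((k : ℝ) / ((n : ℝ) + 1)) =
        (hm ((k : ℝ) / ((n : ℝ) + 1))).mk _ x := ae_all_iff.2 fun k => (hm _).ae_eq_mk
    have hk : Measurable fun x => ⌊((n : ℝ) + 1) * hu.mk u x⌋ :=
      (hu.measurable_mk.const_mul _).floor
    have hG : Measurable fun z : ℤ × α => (hm ((z.1 : ℝ) / ((n : ℝ) + 1))).mk _ z.2 :=
      measurable_from_prod_countable_right fun k =>
        (hm ((k : ℝ) / ((n : ℝ) + 1))).stronglyMeasurable_mk.measurable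
    refine AEStronglyMeasurable.congr
      (hG.comp (hk.prodMk measurable_id)).aestronglyMeasurable ?_
    filter_upwards [e] with x hx
    exact (hx _).symm
  · filter_upwards [hc, hu.ae_eq_mk] with x hx hux
    rw [hux]
    refine (hx.tendsto _).comp ?_
    have h := tendsto_nat_floor_mul_div_atTop (R := ℝ) (a := 1) zero_le_one
    set t := hu.mk u x
    have h1 : Tendsto (fun n : ℕ => t - 1 / ((n : ℝ) + 1)) atTop (𝓝 t) := by
      simpa using (tendsto_one_div_add_atTop_nhds_zero_nat (𝕜 := ℝ)).const_sub t
    refine tendsto_of_tendsto_of_tendsto_of_le_of_le h1 tendsto_const_nhds (fun n => ?_) fun n => ?_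
    · have hn : (0 : ℝ) < (n : ℝ) + 1 := by positivity
      simp only
      rw [le_div_iff₀ hn, sub_mul, one_div_mul_cancel hn.ne']
      have := Int.lt_floor_add_one (((n : ℝ) + 1) * t)
      linarith
    · have hn : (0 : ℝ) < (n : ℝ) + 1 := by positivity
      simp only
      rw [div_le_iff₀ hn]
      have := Int.floor_le (((n : ℝ) + 1) * t)
      linarith

/-- The extension of `f` to negative arguments by `f x 0`. -/
def posExt {α : Type*} (f : α → ℝ → ℝ) (x : α) (t : ℝ) : ℝ := f x (max t 0)

lemma posExt_of_nonneg {α : Type*} (f : α → ℝ → ℝ) (x : α) {t : ℝ} (ht : 0 ≤ t) :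
    posExt f x t = f x t := by rw [posExt, max_eq_left ht]

/-- The primitive `∫₀ʳ f(x, τ⁺) dτ`. -/
def primitive {α : Type*} (f : α → ℝ → ℝ) (x : α) (r : ℝ) : ℝ := ∫ τ in (0 : ℝ)..r, posExt f x τ

variable {N : ℕ} {Ω : Set (EuclideanSpace ℝ (Fin N))} {p : ℝ}
  {f : EuclideanSpace ℝ (Fin N) → ℝ → ℝ}

namespace IsBrezisOswald

lemma continuous_posExt (hf : IsBrezisOswald Ω p f) :
    ∀ᵐ x ∂volume.restrict Ω, Continuous (posExt f x) := by
  filter_upwards [hf.continuous] with x hx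
  exact hx.comp_continuous (continuous_id.max continuous_const) fun t => mem_Ici.2 (le_max_right _ _)

lemma aestronglyMeasurable_posExt (hf : IsBrezisOswald Ω p f) (t : ℝ) :
    AEStronglyMeasurable (fun x => posExt f x t) (volume.restrict Ω) :=
  hf.measurable _ (le_max_right _ _)

lemma aestronglyMeasurable_comp (hf : IsBrezisOswald Ω p f) {u : EuclideanSpace ℝ (Fin N) → ℝ}
    (hu : AEStronglyMeasurable u (volume.restrict Ω)) :
    AEStronglyMeasurable (fun x => posExt f x (u x)) (volume.restrict Ω) :=
  aestronglyMeasurable_superposition hf.aestronglyMeasurable_posExt hf.continuous_posExt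
    hu.aemeasurable

lemma aestronglyMeasurable_primitive (hf : IsBrezisOswald Ω p f)
    {u : EuclideanSpace ℝ (Fin N) → ℝ} (hu : AEStronglyMeasurable u (volume.restrict Ω)) :
    AEStronglyMeasurable (fun x => primitive f x (u x)) (volume.restrict Ω) := by
  refine aestronglyMeasurable_superposition (F := primitive f) (fun r => ?_) ?_ hu.aemeasurable
  · have h : AEStronglyMeasurable (fun z : EuclideanSpace ℝ (Fin N) × ℝ => posExt f z.1 z.2)
        ((volume.restrict Ω).prod volume) := by
      refine aestronglyMeasurable_superposition
        (F := fun (z : EuclideanSpace ℝ (Fin N) × ℝ) t => posExt f z.1 t) (fun t => ?_) ?_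
        measurable_snd.aemeasurable
      · exact (hf.aestronglyMeasurable_posExt t).comp_fst
      · exact Measure.quasiMeasurePreserving_fst.ae hf.continuous_posExt
    have h' : ∀ a b : ℝ, AEStronglyMeasurable (fun x => ∫ τ in Ioc a b, posExt f x τ)
        (volume.restrict Ω) := fun a b => by
      refine AEStronglyMeasurable.integral_prod_right'
        (f := fun z : EuclideanSpace ℝ (Fin N) × ℝ => posExt f z.1 z.2) (h.mono_ac ?_)
      exact Measure.AbsolutelyContinuous.prod Measure.AbsolutelyContinuous.rfl
        Measure.restrict_le_self.absolutelyContinuous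
    exact (h' 0 r).sub (h' r 0)
  · filter_upwards [hf.continuous_posExt] with x hx
    exact intervalIntegral.continuous_primitive (fun a b => hx.intervalIntegrable a b) 0

/-- The limits of `f(x,t)/t^{p-1}` at `0` and `∞` exist, by monotonicity. -/
lemma tendsto_aZero (hf : IsBrezisOswald Ω p f) : ∀ᵐ x ∂volume.restrict Ω,
    Tendsto (fun t : ℝ => ((f x t / t ^ (p - 1) : ℝ) : EReal)) (𝓝[>] 0) (𝓝 (aZero p f x)) ∧
      ∀ t : ℝ, 0 < t → ((f x t / t ^ (p - 1) : ℝ) : EReal) ≤ aZero p f x := by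
  filter_upwards [hf.strictAnti] with x hx
  set q : ℝ → ℝ := fun t => f x t / t ^ (p - 1) with hq
  have h : Tendsto (fun t : ℝ => (q t : EReal)) (𝓝[>] 0) (𝓝 (⨆ t ∈ Ioi (0 : ℝ), (q t : EReal))) := by
    refine tendsto_order.2 ⟨fun b hb => ?_, fun b hb => ?_⟩
    · obtain ⟨t, ht⟩ := lt_iSup_iff.1 hb
      obtain ⟨ht0, ht⟩ := lt_iSup_iff.1 ht
      filter_upwards [Ioo_mem_nhdsGT (mem_Ioi.1 ht0)] with τ hτ
      exact ht.trans (EReal.coe_lt_coe_iff.2 (hx hτ.1 ht0 hτ.2))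
    · filter_upwards [self_mem_nhdsWithin] with τ hτ
      exact lt_of_le_of_lt (le_iSup₂ (f := fun t (_ : t ∈ Ioi (0 : ℝ)) => (q t : EReal)) τ hτ) hb
  have e : aZero p f x = ⨆ t ∈ Ioi (0 : ℝ), (q t : EReal) := h.limUnder_eq
  rw [e]
  exact ⟨h, fun t ht => le_iSup₂ (f := fun t (_ : t ∈ Ioi (0 : ℝ)) => (q t : EReal)) t ht⟩

/-- The limit `a_∞` is a bounded function; it is the strict lower bound of the quotients. -/
lemma exists_aInfty (hp : 1 < p) (hf : IsBrezisOswald Ω p f) : ∃ c : ℝ, 0 < c ∧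
    (∀ᵐ x ∂volume.restrict Ω, ∀ t, 0 ≤ t → |f x t| ≤ c * (1 + t ^ (p - 1))) ∧
    ∃ A : EuclideanSpace ℝ (Fin N) → ℝ, AEStronglyMeasurable A (volume.restrict Ω) ∧
      ∀ᵐ x ∂volume.restrict Ω, aInfty p f x = (A x : EReal) ∧ |A x| ≤ c ∧
        (∀ t : ℝ, 0 < t → A x < f x t / t ^ (p - 1)) ∧
        Tendsto (fun t : ℝ => f x t / t ^ (p - 1)) atTop (𝓝 (A x)) := by
  obtain ⟨c, hc, hgr⟩ := hf.growth
  have hp1 : 0 < p - 1 := by linarith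
  have key : ∀ᵐ x ∂volume.restrict Ω, aInfty p f x = ((aInfty p f x).toReal : EReal) ∧
      |(aInfty p f x).toReal| ≤ c ∧
        (∀ t : ℝ, 0 < t → (aInfty p f x).toReal < f x t / t ^ (p - 1)) ∧
        Tendsto (fun t : ℝ => f x t / t ^ (p - 1)) atTop (𝓝 (aInfty p f x).toReal) := by
    filter_upwards [hf.strictAnti, hgr] with x hx hg
    set q : ℝ → ℝ := fun t => f x t / t ^ (p - 1) with hq
    have hb : ∀ t : ℝ, 0 < t → |q t| ≤ c * (t ^ (-(p - 1)) + 1) := by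
      intro t ht
      have h1 := hg t ht.le
      have h2 : 0 < t ^ (p - 1) := by positivity
      simp only [hq]
      rw [abs_div, abs_of_pos h2, div_le_iff₀ h2, mul_assoc, add_mul, one_mul,
        ← Real.rpow_add ht]
      simpa using h1
    have hbl : ∀ t : ℝ, 0 < t → -c ≤ q t := by
      intro t ht
      have hl : Tendsto (fun τ : ℝ => -(c * (τ ^ (-(p - 1)) + 1))) atTop (𝓝 (-(c * (0 + 1)))) :=
        (((tendsto_rpow_neg_atTop hp1).add_const 1).const_mul c).neg
      rw [zero_add, mul_one] at hl
      refine le_of_tendsto hl ?_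
      filter_upwards [eventually_gt_atTop t] with τ hτ
      have h1 := (abs_le.1 (hb τ (ht.trans hτ))).1
      have h2 : q τ < q t := hx (mem_Ioi.2 ht) (mem_Ioi.2 (ht.trans hτ)) hτ
      linarith
    set A : ℝ := sInf (q '' Ioi 0) with hA
    have hbd : BddBelow (q '' Ioi 0) := ⟨-c, by rintro _ ⟨t, ht, rfl⟩; exact hbl t ht⟩
    have hle : ∀ t : ℝ, 0 < t → A ≤ q t := fun t ht => csInf_le hbd ⟨t, ht, rfl⟩
    have h : Tendsto q atTop (𝓝 A) := by
      refine tendsto_order.2 ⟨fun b hb => ?_, fun b hb => ?_⟩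
      · filter_upwards [eventually_gt_atTop 0] with τ hτ
        exact hb.trans_le (hle τ hτ)
      · obtain ⟨_, ⟨t, ht, rfl⟩, h⟩ := exists_lt_of_csInf_lt (nonempty_Ioi.image q) hb
        filter_upwards [eventually_gt_atTop t] with τ hτ
        exact (hx ht (mem_Ioi.2 ((mem_Ioi.1 ht).trans hτ)) hτ).trans h
    have e : aInfty p f x = (A : EReal) :=
      ((continuous_coe_real_ereal.tendsto A).comp h).limUnder_eq
    have e' : (aInfty p f x).toReal = A := by rw [e, EReal.toReal_coe]
    rw [e']
    refine ⟨e, abs_le.2 ⟨le_csInf (nonempty_Ioi.image q) ?_, ?_⟩, fun t ht => ?_, h⟩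
    · rintro _ ⟨t, ht, rfl⟩; exact hbl t ht
    · have hl : Tendsto (fun τ : ℝ => c * (τ ^ (-(p - 1)) + 1)) atTop (𝓝 (c * (0 + 1))) :=
        ((tendsto_rpow_neg_atTop hp1).add_const 1).const_mul c
      rw [zero_add, mul_one] at hl
      refine le_of_tendsto_of_tendsto h hl ?_
      filter_upwards [eventually_gt_atTop 0] with τ hτ
      exact (le_abs_self _).trans (hb τ hτ)
    · have h1 : q (t + 1) < q t := hx (mem_Ioi.2 ht) (mem_Ioi.2 (by linarith)) (by linarith)
      exact (hle (t + 1) (by linarith)).trans_lt h1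
  refine ⟨c, hc, hgr, fun x => (aInfty p f x).toReal, ?_, key⟩
  refine aestronglyMeasurable_of_tendsto_ae (u := atTop)
    (f := fun (n : ℕ) x => f x ((n : ℝ)) / ((n : ℝ)) ^ (p - 1)) (fun n => ?_) ?_
  · have h := (hf.measurable _ (Nat.cast_nonneg n)).aemeasurable.div_const ((n : ℝ) ^ (p - 1))
    exact h.aestronglyMeasurable
  · filter_upwards [key] with x hx
    exact hx.2.2.2.comp tendsto_natCast_atTop_atTop

lemma apply_zero_nonneg (hf : IsBrezisOswald Ω p f) : ∀ᵐ x ∂volume.restrict Ω, 0 ≤ f x 0 := by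
  obtain ⟨ρ, hρ, h⟩ := hf.pos
  filter_upwards [h, hf.continuous] with x hx hc
  have h1 : Tendsto (f x) (𝓝[>] 0) (𝓝 (f x 0)) :=
    (hc 0 self_mem_Ici).mono_left (nhdsWithin_mono _ Ioi_subset_Ici_self)
  refine ge_of_tendsto h1 ?_
  filter_upwards [Ioo_mem_nhdsGT hρ] with t ht using (hx t ht.1 ht.2).le

end IsBrezisOswald

end Superposition

/-! ### Integrals of extended real valued functions -/

section ExtendedIntegral

variable {N : ℕ} {Ω : Set (EuclideanSpace ℝ (Fin N))} {p : ℝ}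
  {u : EuclideanSpace ℝ (Fin N) → ℝ}

/-- Restricting the integral to `{u ≠ 0}` is immaterial for functions that vanish where `u` does. -/
lemma setLIntegral_ne_zero_eq
    (hu : AEStronglyMeasurable u (volume.restrict Ω)) {g : EuclideanSpace ℝ (Fin N) → ℝ≥0∞}
    (hg : ∀ x, u x = 0 → g x = 0) : ∫⁻ x in {x ∈ Ω | u x ≠ 0}, g x = ∫⁻ x in Ω, g x := by
  have hS : NullMeasurableSet {x | u x ≠ 0} (volume.restrict Ω) :=
    hu.aemeasurable.nullMeasurable (measurableSet_singleton 0).compl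
  have e : {x ∈ Ω | u x ≠ 0} = {x | u x ≠ 0} ∩ Ω := by ext; simp [and_comm]
  rw [e, ← Measure.restrict_restrict₀ hS, ← lintegral_indicator₀ hS]
  refine lintegral_congr fun x => ?_
  by_cases hx : u x = 0
  · rw [indicator_of_notMem (by simpa using hx), hg x hx]
  · rw [indicator_of_mem (by simpa using hx)]

lemma ae_restrict_ne_zero (hΩ : MeasurableSet Ω)
    (hu : AEStronglyMeasurable u (volume.restrict Ω)) {P : EuclideanSpace ℝ (Fin N) → Prop}
    (h : ∀ᵐ x ∂volume.restrict Ω, u x ≠ 0 → P x) :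
    ∀ᵐ x ∂volume.restrict {x ∈ Ω | u x ≠ 0}, P x := by
  have hS : NullMeasurableSet {x ∈ Ω | u x ≠ 0} volume := by
    have h1 : NullMeasurableSet {x | u x ≠ 0} (volume.restrict Ω) :=
      hu.aemeasurable.nullMeasurable (measurableSet_singleton 0).compl
    have e : {x ∈ Ω | u x ≠ 0} = {x | u x ≠ 0} ∩ Ω := by ext; simp [and_comm]
    rw [e]
    exact (nullMeasurableSet_restrict hΩ.nullMeasurableSet).1 h1
  rw [ae_restrict_iff'₀ hS]
  filter_upwards [(ae_restrict_iff' hΩ).1 h] with x hx hxs using hx hxs.1 hxs.2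

lemma coe_integral_eq {r : EuclideanSpace ℝ (Fin N) → ℝ} (hr : Integrable r (volume.restrict Ω)) :
    ((∫ x in Ω, r x : ℝ) : EReal) = ((∫⁻ x in Ω, ENNReal.ofReal (r x) : ℝ≥0∞) : EReal) -
      ((∫⁻ x in Ω, ENNReal.ofReal (-r x) : ℝ≥0∞) : EReal) := by
  have h1 : ∫⁻ x in Ω, ENNReal.ofReal (r x) ≠ ⊤ := hr.lintegral_lt_top.ne
  have h2 : ∫⁻ x in Ω, ENNReal.ofReal (-r x) ≠ ⊤ := hr.neg.lintegral_lt_top.ne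
  rw [integral_eq_lintegral_pos_part_sub_lintegral_neg_part hr, EReal.coe_sub,
    EReal.coe_ennreal_toReal h1, EReal.coe_ennreal_toReal h2]

/-- An integrable lower bound `r` for an extended real valued function bounds its integral from
below. For `a₀`, this is how finite quotients `f(x,t)/t^{p-1}` enter. -/
lemma coe_integral_le_erealIntegral (hΩ : MeasurableSet Ω)
    (hu : AEStronglyMeasurable u (volume.restrict Ω)) {r : EuclideanSpace ℝ (Fin N) → ℝ}
    (hr : Integrable r (volume.restrict Ω)) (hr0 : ∀ x, u x = 0 → r x = 0)
    {g : EuclideanSpace ℝ (Fin N) → EReal}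
    (hg : ∀ᵐ x ∂volume.restrict Ω, u x ≠ 0 → (r x : EReal) ≤ g x) :
    ((∫ x in Ω, r x : ℝ) : EReal) ≤ erealIntegral {x ∈ Ω | u x ≠ 0} g := by
  rw [coe_integral_eq hr, erealIntegral]
  have hgs := ae_restrict_ne_zero hΩ hu hg
  rw [← setLIntegral_ne_zero_eq hu (g := fun x => ENNReal.ofReal (r x)) (by
      intro x hx; simp [hr0 x hx]),
    ← setLIntegral_ne_zero_eq hu (g := fun x => ENNReal.ofReal (-r x)) (by
      intro x hx; simp [hr0 x hx])]
  refine EReal.sub_le_sub ?_ ?_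
  · rw [EReal.coe_ennreal_le_coe_ennreal_iff]
    refine lintegral_mono_ae ?_
    filter_upwards [hgs] with x hx
    have := EReal.toENNReal_le_toENNReal hx
    rwa [EReal.toENNReal_of_ne_top (EReal.coe_ne_top _), EReal.toReal_coe] at this
  · rw [EReal.coe_ennreal_le_coe_ennreal_iff]
    refine lintegral_mono_ae ?_
    filter_upwards [hgs] with x hx
    have := EReal.toENNReal_le_toENNReal (EReal.neg_le_neg_iff.2 hx)
    rwa [← EReal.coe_neg, EReal.toENNReal_of_ne_top (EReal.coe_ne_top _), EReal.toReal_coe] at this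

lemma erealIntegral_eq_coe_integral (hΩ : MeasurableSet Ω)
    (hu : AEStronglyMeasurable u (volume.restrict Ω)) {r : EuclideanSpace ℝ (Fin N) → ℝ}
    (hr : Integrable r (volume.restrict Ω)) (hr0 : ∀ x, u x = 0 → r x = 0)
    {g : EuclideanSpace ℝ (Fin N) → EReal}
    (hg : ∀ᵐ x ∂volume.restrict Ω, u x ≠ 0 → g x = (r x : EReal)) :
    erealIntegral {x ∈ Ω | u x ≠ 0} g = ((∫ x in Ω, r x : ℝ) : EReal) := by
  have hgs := ae_restrict_ne_zero hΩ hu hg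
  rw [coe_integral_eq hr, erealIntegral,
    ← setLIntegral_ne_zero_eq hu (g := fun x => ENNReal.ofReal (r x)) (by
      intro x hx; simp [hr0 x hx]),
    ← setLIntegral_ne_zero_eq hu (g := fun x => ENNReal.ofReal (-r x)) (by
      intro x hx; simp [hr0 x hx])]
  congr 2 <;> refine lintegral_congr_ae ?_
  · filter_upwards [hgs] with x hx
    rw [hx, EReal.toENNReal_of_ne_top (EReal.coe_ne_top _), EReal.toReal_coe]
  · filter_upwards [hgs] with x hx
    rw [hx, ← EReal.coe_neg, EReal.toENNReal_of_ne_top (EReal.coe_ne_top _), EReal.toReal_coe]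

end ExtendedIntegral

/-! ### The signs of the two eigenvalue-type infima -/

section Infima

variable {N : ℕ} {Ω : Set (EuclideanSpace ℝ (Fin N))} {p s : ℝ}
  {H : EuclideanSpace ℝ (Fin N) → ℝ} {f : EuclideanSpace ℝ (Fin N) → ℝ → ℝ}
  {v : EuclideanSpace ℝ (Fin N) → ℝ}

lemma eLpNorm_eq_one_iff (hp : 0 < p) (hv : MemLp v (ENNReal.ofReal p) volume) :
    eLpNorm v (ENNReal.ofReal p) (volume.restrict Ω) = 1 ↔ ∫ x in Ω, |v x| ^ p = 1 := by
  have i1 : Integrable (fun x => |v x| ^ p) (volume.restrict Ω) :=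
    (integrable_norm_rpow_of_memLp hp hv).restrict
  have h1 : ∫⁻ x in Ω, ‖v x‖ₑ ^ p = ENNReal.ofReal (∫ x in Ω, |v x| ^ p) := by
    rw [ofReal_integral_eq_lintegral_ofReal i1 (ae_of_all _ fun x => by positivity)]
    exact lintegral_congr fun x => enorm_rpow_eq_ofReal hp.le _
  rw [eLpNorm_ofReal_eq hp, h1, ← ENNReal.one_rpow (1 / p),
    (ENNReal.rpow_left_injective (by positivity : (1 / p) ≠ 0)).eq_iff, ENNReal.ofReal_eq_one]

lemma integrable_bounded_mul_abs_rpow (hp : 0 < p) (hv : MemLp v (ENNReal.ofReal p) volume)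
    {B : EuclideanSpace ℝ (Fin N) → ℝ} (hB : AEStronglyMeasurable B (volume.restrict Ω)) {c : ℝ}
    (hc : ∀ᵐ x ∂volume.restrict Ω, |B x| ≤ c) :
    Integrable (fun x => B x * |v x| ^ p) (volume.restrict Ω) :=
  (integrable_norm_rpow_of_memLp hp hv).restrict.bdd_mul hB hc

/-- Inequalities between an energy and a `p`-homogeneous integral extend from the unit sphere. -/
lemma integral_mul_abs_rpow_add_le_energy (hp : 1 < p) (hH : IsFinslerMinkowskiNorm H)
    {B : EuclideanSpace ℝ (Fin N) → ℝ} {δ : ℝ}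
    (h : ∀ w, MemW01p Ω p w → ∫ x in Ω, |w x| ^ p = 1 →
      (∫ x in Ω, B x * |w x| ^ p) + δ ≤ energy Ω H p s w) (hv : MemW01p Ω p v) :
    (∫ x in Ω, B x * |v x| ^ p) + δ * ∫ x in Ω, |v x| ^ p ≤ energy Ω H p s v := by
  have hp0 : 0 < p := by linarith
  have i1 : Integrable (fun x => |v x| ^ p) (volume.restrict Ω) :=
    (integrable_norm_rpow_of_memLp hp0 hv.memLp).restrict
  set m := ∫ x in Ω, |v x| ^ p with hm
  have hm0 : 0 ≤ m := integral_nonneg fun x => by positivity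
  rcases hm0.eq_or_lt with h0 | h0
  · have hz : (fun x => |v x| ^ p) =ᵐ[volume.restrict Ω] 0 :=
      (integral_eq_zero_iff_of_nonneg (fun x => by positivity) i1).1 h0.symm
    have : ∫ x in Ω, B x * |v x| ^ p = 0 := by
      rw [integral_congr_ae (g := fun _ => (0 : ℝ))]
      · simp
      · filter_upwards [hz] with x hx
        simp only [Pi.zero_apply] at hx
        rw [hx, mul_zero]
    rw [this, ← h0]
    simpa using energy_nonneg hH
  · set k : ℝ := m ^ (-(1 / p)) with hk
    have hk0 : 0 < k := by positivity
    have hkp : k ^ p = m⁻¹ := by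
      rw [hk, ← Real.rpow_mul hm0, ← Real.rpow_neg_one]
      congr 1; field_simp
    have e1 : ∀ x, |k * v x| ^ p = m⁻¹ * |v x| ^ p := fun x => by
      rw [abs_mul, Real.mul_rpow (abs_nonneg _) (abs_nonneg _), abs_of_pos hk0, hkp]
    have h1 := h (fun x => k * v x) (hv.const_mul hp.le k).1 (by
      simp only [e1]
      rw [integral_const_mul, ← hm, inv_mul_cancel₀ h0.ne'])
    rw [energy_const_mul hp hH hv, abs_of_pos hk0, hkp] at h1
    simp only [e1] at h1
    have e2 : ∫ x in Ω, B x * (m⁻¹ * |v x| ^ p) = m⁻¹ * ∫ x in Ω, B x * |v x| ^ p := by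
      rw [← integral_const_mul]
      congr 1; ext x; ring
    rw [e2] at h1
    have h2 := mul_le_mul_of_nonneg_left h1 hm0
    rw [mul_add, mul_inv_cancel_left₀ h0.ne', mul_inv_cancel_left₀ h0.ne'] at h2
    linarith

/-- By compactness, the strict inequality `∫ A|v|^p < energy v` on the unit sphere holds with a
uniform gap, also for a function close to `A`. -/
lemma exists_gap (hN : 1 ≤ N) (hp : 1 < p) (hs₀ : 0 < s) (hs₁ : s < 1)
    (hΩ : Bornology.IsBounded Ω) (hΩm : MeasurableSet Ω) (hH : IsFinslerMinkowskiNorm H)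
    {A : EuclideanSpace ℝ (Fin N) → ℝ} {B : ℕ → EuclideanSpace ℝ (Fin N) → ℝ}
    (hB : ∀ n, AEStronglyMeasurable (B n) (volume.restrict Ω)) {c : ℝ}
    (hBc : ∀ n, ∀ᵐ x ∂volume.restrict Ω, |B n x| ≤ c)
    (hBA : ∀ᵐ x ∂volume.restrict Ω, Tendsto (fun n => B n x) atTop (𝓝 (A x)))
    (h : ∀ v, MemW01p Ω p v → ∫ x in Ω, |v x| ^ p = 1 →
      ∫ x in Ω, A x * |v x| ^ p < energy Ω H p s v) :
    ∃ n, ∃ δ : ℝ, 0 < δ ∧ ∀ v, MemW01p Ω p v → ∫ x in Ω, |v x| ^ p = 1 →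
      (∫ x in Ω, B n x * |v x| ^ p) + δ ≤ energy Ω H p s v := by
  have hp0 : 0 < p := by linarith
  by_contra hcon
  push Not at hcon
  choose w hw hw1 hwE using fun n : ℕ => hcon n (1 / ((n : ℝ) + 1)) (by positivity)
  have hi : ∀ n, Integrable (fun x => |w n x| ^ p) (volume.restrict Ω) := fun n =>
    (integrable_norm_rpow_of_memLp hp0 (hw n).memLp).restrict
  have hEb : ∀ n, energy Ω H p s (w n) ≤ |c| + 1 := by
    intro n
    refine (hwE n).le.trans (add_le_add ?_ ?_)
    · have := integral_mono_ae (integrable_bounded_mul_abs_rpow hp0 (hw n).memLp (hB n) (hBc n))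
        ((hi n).const_mul |c|) (by
          filter_upwards [hBc n] with x hx
          exact mul_le_mul_of_nonneg_right ((le_abs_self _).trans (hx.trans (le_abs_self c)))
            (by positivity))
      rwa [integral_const_mul, hw1 n, mul_one] at this
    · rw [div_le_one (by positivity)]
      linarith [(Nat.cast_nonneg n : (0:ℝ) ≤ n)]
  obtain ⟨θ, u, L, hθ, hu, hL, huL, hae, g, hg, hgb⟩ :=
    exists_subseq_energy_compact hN hp hs₀ hs₁ hΩ hΩm hH hw (M := |c| + 1)
      (fun n => by rw [hw1 n]; linarith [abs_nonneg c]) hEb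
  have hae' : ∀ᵐ x ∂volume.restrict Ω, Tendsto (fun n => |w (θ n) x| ^ p) atTop (𝓝 (|u x| ^ p)) := by
    filter_upwards [ae_restrict_of_ae hae] with x hx
    exact hx.abs.rpow_const (Or.inr hp0.le)
  have hgb' : ∀ᵐ x ∂volume.restrict Ω, ∀ n, |w (θ n) x| ^ p ≤ g x := ae_restrict_of_ae hgb
  have t1 : Tendsto (fun n => ∫ x in Ω, |w (θ n) x| ^ p) atTop (𝓝 (∫ x in Ω, |u x| ^ p)) := by
    refine tendsto_integral_of_dominated_convergence g (fun n => (hi _).1) hg.restrict (fun n => ?_) hae'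
    filter_upwards [hgb'] with x hx
    rw [Real.norm_of_nonneg (by positivity)]
    exact hx n
  simp only [hw1] at t1
  have hu1 : ∫ x in Ω, |u x| ^ p = 1 := tendsto_nhds_unique t1 tendsto_const_nhds
  have t2 : Tendsto (fun n => ∫ x in Ω, B (θ n) x * |w (θ n) x| ^ p) atTop
      (𝓝 (∫ x in Ω, A x * |u x| ^ p)) := by
    refine tendsto_integral_of_dominated_convergence (fun x => |c| * g x)
      (fun n => (hB _).mul (hi _).1) (hg.restrict.const_mul _) (fun n => ?_) ?_
    · filter_upwards [hgb', hBc (θ n)] with x hx hx'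
      rw [norm_mul, Real.norm_of_nonneg (by positivity : 0 ≤ |w (θ n) x| ^ p)]
      exact mul_le_mul (hx'.trans (le_abs_self c)) (hx n) (by positivity) (abs_nonneg c)
    · filter_upwards [hae', hBA] with x hx hx'
      exact (hx'.comp hθ.tendsto_atTop).mul hx
  have t3 : Tendsto (fun n => (∫ x in Ω, B (θ n) x * |w (θ n) x| ^ p) + 1 / ((θ n : ℝ) + 1)) atTop
      (𝓝 ((∫ x in Ω, A x * |u x| ^ p) + 0)) :=
    t2.add ((tendsto_one_div_add_atTop_nhds_zero_nat (𝕜 := ℝ)).comp hθ.tendsto_atTop)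
  have := le_of_tendsto_of_tendsto' hL t3 fun n => (hwE (θ n)).le
  linarith [h u hu hu1]

/-- Positivity of `β₁` for `a_∞`, unfolded into an inequality between real integrals. -/
lemma integral_lt_energy_of_betaOne_pos (hp : 1 < p) (hΩm : MeasurableSet Ω)
    {A : EuclideanSpace ℝ (Fin N) → ℝ} (hA : AEStronglyMeasurable A (volume.restrict Ω)) {c : ℝ}
    (hAc : ∀ᵐ x ∂volume.restrict Ω, aInfty p f x = (A x : EReal) ∧ |A x| ≤ c)
    (h : 0 < betaOne Ω H p s (aInfty p f)) (hv : MemW01p Ω p v) (hv1 : ∫ x in Ω, |v x| ^ p = 1) :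
    ∫ x in Ω, A x * |v x| ^ p < energy Ω H p s v := by
  have hp0 : 0 < p := by linarith
  have h1 := h.trans_le (iInf₂_le v ⟨hv, (eLpNorm_eq_one_iff hp0 hv.memLp).2 hv1⟩)
  rw [erealIntegral_eq_coe_integral hΩm hv.memLp.1.restrict
    (integrable_bounded_mul_abs_rpow hp0 hv.memLp hA (hAc.mono fun x hx => hx.2))
    (fun x hx => by rw [hx, abs_zero, Real.zero_rpow hp0.ne', mul_zero])
    (hAc.mono fun x hx _ => by rw [hx.1, EReal.coe_mul])] at h1
  rw [← EReal.coe_sub, ← EReal.coe_zero, EReal.coe_lt_coe_iff] at h1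
  linarith

lemma betaOne_pos_of_gap (hp : 1 < p) (hΩm : MeasurableSet Ω)
    {A : EuclideanSpace ℝ (Fin N) → ℝ} (hA : AEStronglyMeasurable A (volume.restrict Ω)) {c : ℝ}
    (hAc : ∀ᵐ x ∂volume.restrict Ω, aInfty p f x = (A x : EReal) ∧ |A x| ≤ c) {δ : ℝ} (hδ : 0 < δ)
    (h : ∀ v, MemW01p Ω p v → ∫ x in Ω, |v x| ^ p = 1 →
      (∫ x in Ω, A x * |v x| ^ p) + δ ≤ energy Ω H p s v) :
    0 < betaOne Ω H p s (aInfty p f) := by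
  have hp0 : 0 < p := by linarith
  refine lt_of_lt_of_le (EReal.coe_lt_coe_iff.2 hδ) (le_iInf₂ fun v hv => ?_)
  have h1 := h v hv.1 ((eLpNorm_eq_one_iff hp0 hv.1.memLp).1 hv.2)
  rw [erealIntegral_eq_coe_integral hΩm hv.1.memLp.1.restrict
    (integrable_bounded_mul_abs_rpow hp0 hv.1.memLp hA (hAc.mono fun x hx => hx.2))
    (fun x hx => by rw [hx, abs_zero, Real.zero_rpow hp0.ne', mul_zero])
    (hAc.mono fun x hx _ => by rw [hx.1, EReal.coe_mul])]
  rw [← EReal.coe_sub, EReal.coe_le_coe_iff]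
  linarith

lemma betaOne_neg_of_lt (hp : 1 < p) (hΩm : MeasurableSet Ω) (hv : MemW01p Ω p v)
    (hv1 : ∫ x in Ω, |v x| ^ p = 1) {b : EuclideanSpace ℝ (Fin N) → ℝ}
    (hb : Integrable (fun x => b x * |v x| ^ p) (volume.restrict Ω))
    (hba : ∀ᵐ x ∂volume.restrict Ω, v x ≠ 0 → (b x : EReal) ≤ aZero p f x)
    (h : energy Ω H p s v < ∫ x in Ω, b x * |v x| ^ p) :
    betaOne Ω H p s (aZero p f) < 0 := by
  have hp0 : 0 < p := by linarith
  refine lt_of_le_of_lt (iInf₂_le v ⟨hv, (eLpNorm_eq_one_iff hp0 hv.memLp).2 hv1⟩) ?_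
  have h1 := coe_integral_le_erealIntegral hΩm hv.memLp.1.restrict hb
    (fun x hx => by rw [hx, abs_zero, Real.zero_rpow hp0.ne', mul_zero])
    (g := fun x => aZero p f x * ((|v x| ^ p : ℝ) : EReal)) (hba.mono fun x hx h0 => by
      rw [EReal.coe_mul]
      exact mul_le_mul_of_nonneg_right (hx h0) (EReal.coe_nonneg.2 (by positivity)))
  refine lt_of_le_of_lt (EReal.sub_le_sub le_rfl h1) ?_
  rw [← EReal.coe_sub, ← EReal.coe_zero, EReal.coe_lt_coe_iff]
  linarith

lemma IsBrezisOswald.integrable_comp_mul (hp : 1 < p) (hf : IsBrezisOswald Ω p f)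
    (hfin : volume Ω ≠ ⊤) {u φ : EuclideanSpace ℝ (Fin N) → ℝ}
    (hu : MemLp u (ENNReal.ofReal p) (volume.restrict Ω))
    (hφ : MemLp φ (ENNReal.ofReal p) (volume.restrict Ω)) :
    Integrable (fun x => posExt f x (u x) * φ x) (volume.restrict Ω) := by
  have hp0 : 0 < p := by linarith
  have hfin' : IsFiniteMeasure (volume.restrict Ω) := ⟨by simpa using hfin.lt_top⟩
  obtain ⟨c, hc, hgr⟩ := hf.growth
  have iu := integrable_norm_rpow_of_memLp hp0 hu
  have iφ := integrable_norm_rpow_of_memLp hp0 hφ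
  have iφ1 : Integrable φ (volume.restrict Ω) :=
    hφ.integrable (by simpa using ENNReal.ofReal_le_ofReal hp.le)
  refine ((iφ1.norm.add ((iu.add iφ).const_mul (2 ^ p))).const_mul c).mono'
    ((hf.aestronglyMeasurable_comp hu.1).mul hφ.1) ?_
  filter_upwards [hgr] with x hx
  have h1 : |posExt f x (u x)| ≤ c * (1 + |u x| ^ (p - 1)) := by
    refine (hx _ (le_max_right _ _)).trans ?_
    have : (max (u x) 0) ^ (p - 1) ≤ |u x| ^ (p - 1) :=
      Real.rpow_le_rpow (le_max_right _ _) (max_le (le_abs_self _) (abs_nonneg _)) (by linarith)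
    gcongr
  have h2 : |u x| ^ (p - 1) * |φ x| ≤ 2 ^ p * (|u x| ^ p + |φ x| ^ p) := by
    refine le_trans ?_ (rpow_sub_one_mul_le hp.le (abs_nonneg (u x)) (abs_nonneg (φ x)))
    have : |u x| ≤ |u x| + |φ x| := le_add_of_nonneg_right (abs_nonneg _)
    have hp1 : 0 ≤ p - 1 := by linarith
    gcongr
  simp only [Pi.add_apply, norm_mul, Real.norm_eq_abs]
  calc |posExt f x (u x)| * |φ x| ≤ c * (1 + |u x| ^ (p - 1)) * |φ x| := by gcongr
    _ = c * (|φ x| + |u x| ^ (p - 1) * |φ x|) := by ring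
    _ ≤ _ := by gcongr

/-- If `β₁` for `a₀` is negative, then the quotient at a small multiple of some function of the unit
sphere already makes the difference negative. -/
lemma exists_energy_lt_of_betaOne_neg (hp : 1 < p) (hfin : volume Ω ≠ ⊤) (hΩm : MeasurableSet Ω)
    (hH : IsFinslerMinkowskiNorm H) (hf : IsBrezisOswald Ω p f)
    (h : betaOne Ω H p s (aZero p f) < 0) :
    ∃ (w : EuclideanSpace ℝ (Fin N) → ℝ) (n : ℕ), MemW01p Ω p w ∧
      Integrable (fun x => f x (|w x| / ((n : ℝ) + 1)) * (((n : ℝ) + 1) ^ (p - 1) * |w x|))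
        (volume.restrict Ω) ∧
      energy Ω H p s w <
        ∫ x in Ω, f x (|w x| / ((n : ℝ) + 1)) * (((n : ℝ) + 1) ^ (p - 1) * |w x|) := by
  have hp0 : 0 < p := by linarith
  have hp1 : 0 < p - 1 := by linarith
  obtain ⟨w, h⟩ := iInf_lt_iff.1 h
  obtain ⟨⟨hw, -⟩, h⟩ := iInf_lt_iff.1 h
  have hwm := hw.memLp.1.restrict (s := Ω)
  obtain ⟨c, hc, hgr, A, -, hAq⟩ := hf.exists_aInfty hp
  obtain ⟨ρ, hρ, hpos⟩ := hf.pos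
  have iw : Integrable (fun x => |w x| ^ p) (volume.restrict Ω) :=
    (integrable_norm_rpow_of_memLp hp0 hw.memLp).restrict
  set r : ℕ → EuclideanSpace ℝ (Fin N) → ℝ := fun n x =>
    f x (|w x| / ((n : ℝ) + 1)) * (((n : ℝ) + 1) ^ (p - 1) * |w x|) with hr
  have hq : ∀ (n : ℕ) x, w x ≠ 0 → r n x =
      f x (|w x| / ((n : ℝ) + 1)) / (|w x| / ((n : ℝ) + 1)) ^ (p - 1) * |w x| ^ p := by
    intro n x hx
    have h1 : 0 < |w x| := abs_pos.2 hx
    have h2 : |w x| ^ p = |w x| ^ (p - 1) * |w x| := by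
      rw [← Real.rpow_add_one h1.ne']; ring_nf
    rw [Real.div_rpow h1.le (by positivity), h2]
    have h3 : 0 < |w x| ^ (p - 1) := by positivity
    have h4 : 0 < ((n : ℝ) + 1) ^ (p - 1) := by positivity
    simp only [hr]
    field_simp
  have hr0 : ∀ n x, w x = 0 → r n x = 0 := fun n x hx => by simp [hr, hx]
  -- the integrands are bounded below, uniformly in `n`
  have hrl : ∀ n, ∀ᵐ x ∂volume.restrict Ω, -(c * |w x| ^ p) ≤ r n x := by
    intro n
    filter_upwards [hAq] with x hx
    by_cases h0 : w x = 0
    · rw [hr0 n x h0, h0, abs_zero, Real.zero_rpow hp0.ne']; simp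
    · rw [hq n x h0]
      have h1 := hx.2.2.1 (|w x| / ((n : ℝ) + 1)) (by have := abs_pos.2 h0; positivity)
      have h2 := (abs_le.1 hx.2.1).1
      have h3 : 0 ≤ |w x| ^ p := by positivity
      nlinarith
  have ir : ∀ n, Integrable (r n) (volume.restrict Ω) := by
    intro n
    have h2 := hf.integrable_comp_mul hp hfin (u := fun x => |w x| / ((n : ℝ) + 1))
      (φ := fun x => ((n : ℝ) + 1) ^ (p - 1) * |w x|)
      ((hw.memLp.norm.mul_const ((n : ℝ) + 1)⁻¹).restrict Ω)
      ((hw.memLp.norm.const_mul _).restrict Ω)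
    refine h2.congr (ae_of_all _ fun x => ?_)
    simp only [hr]
    rw [posExt_of_nonneg _ _ (by positivity)]
  set e : ℕ → ℝ := fun n => ∫ x in Ω, max (-r n x) 0 with he
  have het : Tendsto e atTop (𝓝 0) := by
    have := tendsto_integral_of_dominated_convergence (μ := volume.restrict Ω)
      (F := fun n x => max (-r n x) 0) (f := fun _ => (0 : ℝ)) (fun x => c * |w x| ^ p)
      (fun n => ((ir n).neg.pos_part).1) (iw.const_mul c) (fun n => by
        filter_upwards [hrl n] with x hx
        rw [Real.norm_of_nonneg (le_max_right _ _)]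
        exact max_le (by linarith) (by positivity)) (by
        filter_upwards [hpos] with x hx
        refine tendsto_const_nhds.congr' ?_
        have h1 : Tendsto (fun n : ℕ => |w x| / ((n : ℝ) + 1)) atTop (𝓝 0) := by
          have := (tendsto_one_div_add_atTop_nhds_zero_nat (𝕜 := ℝ)).const_mul |w x|
          simpa [div_eq_mul_inv] using this
        filter_upwards [h1.eventually_lt_const hρ] with n hn
        refine (max_eq_right ?_).symm
        by_cases h0 : w x = 0
        · rw [hr0 n x h0]; simp
        · have := hx _ (by have := abs_pos.2 h0; positivity) hn
          have : 0 ≤ r n x := by simp only [hr]; positivity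
          linarith)
    simpa using this
  by_contra hcon
  push Not at hcon
  have hle : ∀ n, ∫ x in Ω, r n x ≤ energy Ω H p s w := fun n => hcon w n hw (ir n)
  have hlim : ∀ᵐ x ∂volume.restrict Ω, w x ≠ 0 →
      Tendsto (fun n => ENNReal.ofReal (r n x)) atTop
        (𝓝 (aZero p f x * ((|w x| ^ p : ℝ) : EReal)).toENNReal) := by
    filter_upwards [hf.tendsto_aZero] with x hx h0
    have hw0 : 0 < |w x| := abs_pos.2 h0
    have h1 : Tendsto (fun n : ℕ => |w x| / ((n : ℝ) + 1)) atTop (𝓝[>] 0) := by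
      refine tendsto_nhdsWithin_iff.2 ⟨?_, Eventually.of_forall fun n => mem_Ioi.2 (by positivity)⟩
      have := (tendsto_one_div_add_atTop_nhds_zero_nat (𝕜 := ℝ)).const_mul |w x|
      simpa [div_eq_mul_inv] using this
    have h2 := hx.1.comp h1
    have h3 := ENNReal.Tendsto.mul_const (b := ENNReal.ofReal (|w x| ^ p))
      ((EReal.continuous_toENNReal.tendsto _).comp h2) (Or.inr ENNReal.ofReal_ne_top)
    have e1 : (aZero p f x * ((|w x| ^ p : ℝ) : EReal)).toENNReal =
        (aZero p f x).toENNReal * ENNReal.ofReal (|w x| ^ p) := by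
      rw [mul_comm, EReal.toENNReal_mul (EReal.coe_nonneg.2 (by positivity)), mul_comm,
        EReal.toENNReal_of_ne_top (EReal.coe_ne_top _), EReal.toReal_coe]
    rw [e1]
    refine h3.congr fun n => ?_
    simp only [Function.comp]
    rw [hq n x h0, EReal.toENNReal_of_ne_top (EReal.coe_ne_top _), EReal.toReal_coe,
      ← ENNReal.ofReal_mul' (by positivity)]
  have hlim' := ae_restrict_ne_zero hΩm hwm hlim
  have hP : ∫⁻ x in {x ∈ Ω | w x ≠ 0}, (aZero p f x * ((|w x| ^ p : ℝ) : EReal)).toENNReal ≤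
      ENNReal.ofReal (energy Ω H p s w) := by
    calc ∫⁻ x in {x ∈ Ω | w x ≠ 0}, (aZero p f x * ((|w x| ^ p : ℝ) : EReal)).toENNReal
        = ∫⁻ x in {x ∈ Ω | w x ≠ 0}, liminf (fun n => ENNReal.ofReal (r n x)) atTop := by
          refine lintegral_congr_ae ?_
          filter_upwards [hlim'] with x hx using hx.liminf_eq.symm
      _ ≤ liminf (fun n => ∫⁻ x in {x ∈ Ω | w x ≠ 0}, ENNReal.ofReal (r n x)) atTop :=
          lintegral_liminf_le' fun n => ((ir n).1.aemeasurable.ennreal_ofReal).mono_measure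
            (Measure.restrict_mono (sep_subset _ _) le_rfl)
      _ ≤ liminf (fun n => ENNReal.ofReal (energy Ω H p s w + e n)) atTop := by
          refine liminf_le_liminf (Eventually.of_forall fun n => ?_)
          have h1 : ∫ x in Ω, max (r n x) 0 ≤ energy Ω H p s w + e n := by
            have : ∫ x in Ω, max (r n x) 0 = (∫ x in Ω, r n x) + e n := by
              have ine : Integrable (fun x => max (-r n x) 0) (volume.restrict Ω) :=
                (ir n).neg.pos_part
              simp only [he]
              rw [← integral_add (ir n) ine]
              congr 1; ext x
              rcases le_total 0 (r n x) with h | h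
              · rw [max_eq_left h, max_eq_right (by linarith)]; ring
              · rw [max_eq_right h, max_eq_left (by linarith)]; ring
            linarith [hle n]
          calc ∫⁻ x in {x ∈ Ω | w x ≠ 0}, ENNReal.ofReal (r n x)
              ≤ ∫⁻ x in Ω, ENNReal.ofReal (r n x) := lintegral_mono_set (sep_subset _ _)
            _ = ∫⁻ x in Ω, ENNReal.ofReal (max (r n x) 0) :=
                lintegral_congr fun x => by simp
            _ = ENNReal.ofReal (∫ x in Ω, max (r n x) 0) :=
                (ofReal_integral_eq_lintegral_ofReal (ir n).pos_part
                  (ae_of_all _ fun x => le_max_right _ _)).symm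
            _ ≤ _ := ENNReal.ofReal_le_ofReal h1
      _ = ENNReal.ofReal (energy Ω H p s w) := by
          refine Tendsto.liminf_eq (ENNReal.tendsto_ofReal ?_)
          simpa using het.const_add (energy Ω H p s w)
  refine absurd h (not_lt.2 ?_)
  have hX : erealIntegral {x ∈ Ω | w x ≠ 0} (fun x => aZero p f x * ((|w x| ^ p : ℝ) : EReal)) ≤
      (energy Ω H p s w : EReal) := by
    unfold erealIntegral
    refine (EReal.sub_le_sub le_rfl (EReal.coe_ennreal_nonneg _)).trans ?_
    rw [sub_zero]
    refine (EReal.coe_ennreal_le_coe_ennreal_iff.2 hP).trans_eq ?_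
    rw [EReal.coe_ennreal_ofReal, max_eq_left (energy_nonneg hH)]
  refine le_trans (le_of_eq ?_) (EReal.sub_le_sub le_rfl hX)
  rw [← EReal.coe_sub, sub_self, EReal.coe_zero]

end Infima

/-! ### Picone's inequality -/

section Picone

/-- Young's inequality in the form used for the local part of Picone's inequality. -/
lemma mul_rpow_sub_one_mul_le {p a b : ℝ} (hp : 1 < p) (ha : 0 ≤ a) (hb : 0 ≤ b) :
    p * (a ^ (p - 1) * b) ≤ (p - 1) * a ^ p + b ^ p := by
  have hp0 : 0 < p := by linarith
  have hp1 : p - 1 ≠ 0 := by linarith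
  have h := Real.young_inequality_of_nonneg hb (Real.rpow_nonneg ha (p - 1))
    (Real.HolderConjugate.conjExponent hp)
  have e : (a ^ (p - 1)) ^ p.conjExponent = a ^ p := by
    rw [← Real.rpow_mul ha, Real.conjExponent]
    congr 1; field_simp
  rw [e, Real.conjExponent] at h
  have h2 := mul_le_mul_of_nonneg_left h hp0.le
  have e2 : p * (b ^ p / p + a ^ p / (p / (p - 1))) = (p - 1) * a ^ p + b ^ p := by
    field_simp; ring
  rw [e2] at h2
  linarith

/-- The discrete Picone inequality. -/
lemma discrete_picone {p a b A B : ℝ} (hp : 1 < p) (ha : 0 < a) (hb : 0 < b) (hA : 0 ≤ A)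
    (hB : 0 ≤ B) :
    |a - b| ^ (p - 2) * (a - b) * (A ^ p * a ^ (1 - p) - B ^ p * b ^ (1 - p)) ≤ |A - B| ^ p := by
  have hp0 : 0 < p := by linarith
  have key : ∀ a b A B : ℝ, 0 < b → b < a → 0 ≤ A → 0 ≤ B →
      |a - b| ^ (p - 2) * (a - b) * (A ^ p * a ^ (1 - p) - B ^ p * b ^ (1 - p)) ≤ |A - B| ^ p := by
    intro a b A B hb hab hA hB
    have ha : 0 < a := hb.trans hab
    have hd : 0 < a - b := by linarith
    have e1 : |a - b| ^ (p - 2) * (a - b) = (a - b) ^ (p - 1) := by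
      rw [abs_of_pos hd, ← Real.rpow_add_one hd.ne']; ring_nf
    have h1 := (convexOn_rpow hp.le).2 (mem_Ici.2 (by positivity : 0 ≤ B / b))
      (mem_Ici.2 (by positivity : 0 ≤ |A - B| / (a - b))) (by positivity : 0 ≤ b / a)
      (by positivity : 0 ≤ (a - b) / a) (by field_simp; ring)
    simp only [smul_eq_mul] at h1
    have h2 : A / a ≤ b / a * (B / b) + (a - b) / a * (|A - B| / (a - b)) := by
      have : b / a * (B / b) + (a - b) / a * (|A - B| / (a - b)) = (B + |A - B|) / a := by
        field_simp
      rw [this]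
      gcongr
      linarith [le_abs_self (A - B)]
    have h3 : (A / a) ^ p ≤ b / a * (B / b) ^ p + (a - b) / a * (|A - B| / (a - b)) ^ p :=
      (Real.rpow_le_rpow (by positivity) h2 hp0.le).trans h1
    rw [Real.div_rpow hA ha.le, Real.div_rpow hB hb.le, Real.div_rpow (abs_nonneg _) hd.le] at h3
    have f : ∀ t : ℝ, 0 < t → t ^ (1 - p) = t / t ^ p := fun t ht => by
      rw [Real.rpow_sub ht, Real.rpow_one]
    have f' : (a - b) ^ (p - 1) = (a - b) ^ p / (a - b) := by
      rw [Real.rpow_sub hd, Real.rpow_one]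
    rw [e1, f a ha, f b hb, f']
    have pa : 0 < a ^ p := by positivity
    have pb : 0 < b ^ p := by positivity
    have pd : 0 < (a - b) ^ p := by positivity
    generalize A ^ p = A' at *
    generalize B ^ p = B' at *
    generalize |A - B| ^ p = D at *
    generalize a ^ p = a' at *
    generalize b ^ p = b' at *
    generalize (a - b) ^ p = d' at *
    have h4 := mul_le_mul_of_nonneg_left h3 ha.le
    have e4 : a * (b / a * (B' / b') + (a - b) / a * (D / d')) =
        B' * (b / b') + (a - b) * (D / d') := by field_simp
    rw [e4] at h4
    have h5 : A' * (a / a') - B' * (b / b') ≤ (a - b) * (D / d') := by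
      have : a * (A' / a') = A' * (a / a') := by ring
      linarith
    calc d' / (a - b) * (A' * (a / a') - B' * (b / b')) ≤ d' / (a - b) * ((a - b) * (D / d')) := by
          gcongr
      _ = D := by field_simp
  rcases lt_trichotomy a b with h | h | h
  · have := key b a B A ha h hB hA
    rw [abs_sub_comm b a, abs_sub_comm B A] at this
    calc _ = |a - b| ^ (p - 2) * (b - a) * (B ^ p * b ^ (1 - p) - A ^ p * a ^ (1 - p)) := by ring
      _ ≤ _ := this
  · subst h
    simp only [sub_self, mul_zero, zero_mul]
    positivity
  · exact key a b A B hb h hA hB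

variable {N : ℕ} {Ω : Set (EuclideanSpace ℝ (Fin N))} {p s : ℝ}
  {H : EuclideanSpace ℝ (Fin N) → ℝ} {u v : EuclideanSpace ℝ (Fin N) → ℝ}

/-- The pointwise Picone inequality for the local operator. -/
lemma local_picone (hH : IsFinslerMinkowskiNorm H) (hp : 1 < p) {a T d : ℝ} (ha : 0 < a)
    (hd : 0 < d ∧ d ≤ 1) (X Y : EuclideanSpace ℝ (Fin N)) :
    H X ^ (p - 1) * inner ℝ (gradient H X) ((a ^ (1 - p) * (p * |T| ^ (p - 2) * T * d)) • Y +
      (|T| ^ p * ((1 - p) * a ^ (-p))) • X) ≤ H Y ^ p := by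
  have hp0 : 0 < p := by linarith
  by_cases hX : X = 0
  · rw [hX, hH.map_zero, Real.zero_rpow (by linarith), zero_mul]
    exact Real.rpow_nonneg (hH.nonneg _) _
  rw [inner_add_right, inner_smul_right, inner_smul_right, hH.inner_gradient_self hX]
  have h1 := hH.abs_inner_gradient_le hX Y
  have hr0 : 0 ≤ |T| / a := by positivity
  have hHX := hH.nonneg X
  have hHY := hH.nonneg Y
  have e1 : a ^ (1 - p) * |T| ^ (p - 1) = (|T| / a) ^ (p - 1) := by
    rw [Real.div_rpow (abs_nonneg _) ha.le, show 1 - p = -(p - 1) by ring, Real.rpow_neg ha.le]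
    field_simp
  have e2 : |T| ^ p * a ^ (-p) = (|T| / a) ^ p := by
    rw [Real.div_rpow (abs_nonneg _) ha.le, Real.rpow_neg ha.le]
    field_simp
  have h2 : a ^ (1 - p) * (p * |T| ^ (p - 2) * T * d) * inner ℝ (gradient H X) Y ≤
      p * ((|T| / a) ^ (p - 1)) * H Y := by
    refine (le_abs_self _).trans ?_
    rw [abs_mul]
    refine mul_le_mul ?_ h1 (abs_nonneg _) (by positivity)
    have : a ^ (1 - p) * (p * |T| ^ (p - 2) * T * d) = a ^ (1 - p) * p * d * (|T| ^ (p - 2) * T) := by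
      ring
    rw [this, abs_mul, abs_rpow_sub_two_mul p T hp, ← e1,
      abs_of_pos (by have := hd.1; positivity)]
    have h3 : 0 ≤ a ^ (1 - p) * p * |T| ^ (p - 1) := by positivity
    nlinarith [hd.2]
  have h4 := mul_rpow_sub_one_mul_le hp (mul_nonneg hr0 hHX) hHY
  rw [Real.mul_rpow hr0 hHX, Real.mul_rpow hr0 hHX] at h4
  have e3 : H X ^ p = H X ^ (p - 1) * H X := by
    have : 0 < H X := lt_of_le_of_ne hHX fun h => hX ((hH.eq_zero_iff X).1 h.symm)
    rw [← Real.rpow_add_one this.ne']; ring_nf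
  have e4 : |T| ^ p * ((1 - p) * a ^ (-p)) = -((p - 1) * (|T| / a) ^ p) := by rw [← e2]; ring
  rw [e4]
  have h5 := mul_le_mul_of_nonneg_left h2 (Real.rpow_nonneg hHX (p - 1))
  calc _ = H X ^ (p - 1) * (a ^ (1 - p) * (p * |T| ^ (p - 2) * T * d) * inner ℝ (gradient H X) Y) -
        (p - 1) * ((|T| / a) ^ p * (H X ^ (p - 1) * H X)) := by ring
    _ ≤ H X ^ (p - 1) * (p * ((|T| / a) ^ (p - 1)) * H Y) -
        (p - 1) * ((|T| / a) ^ p * (H X ^ (p - 1) * H X)) := by linarith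
    _ ≤ H Y ^ p := by rw [← e3]; linarith

/-- The defect of the discrete Picone inequality for the test function `quot p k ε u v`, without
the kernel. -/
def piconeDefect (p k ε : ℝ) (u v : EuclideanSpace ℝ (Fin N) → ℝ)
    (z : EuclideanSpace ℝ (Fin N) × EuclideanSpace ℝ (Fin N)) : ℝ :=
  |v z.1 - v z.2| ^ p - |u z.1 - u z.2| ^ (p - 2) * (u z.1 - u z.2) *
    (quot p k ε (u z.1) (v z.1) - quot p k ε (u z.2) (v z.2))

lemma piconeDefect_nonneg (hp : 1 < p) {k ε : ℝ} (hk : 0 < k) (hε : 0 < ε)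
    {z : EuclideanSpace ℝ (Fin N) × EuclideanSpace ℝ (Fin N)} (h1 : 0 ≤ u z.1) (h2 : 0 ≤ u z.2) :
    0 ≤ piconeDefect p k ε u v z := by
  have h := discrete_picone hp (add_pos_of_nonneg_of_pos h1 hε) (add_pos_of_nonneg_of_pos h2 hε)
    (abs_nonneg (trunc k (v z.1))) (abs_nonneg (trunc k (v z.2)))
  rw [add_sub_add_right_eq_sub] at h
  have h3 : |(|trunc k (v z.1)| - |trunc k (v z.2)|)| ^ p ≤ |v z.1 - v z.2| ^ p :=
    Real.rpow_le_rpow (abs_nonneg _)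
      ((abs_abs_sub_abs_le _ _).trans (abs_trunc_sub_le hk _ _)) (by linarith)
  unfold piconeDefect quot
  rw [abs_of_nonneg h1, abs_of_nonneg h2]
  linarith

/-- Picone's inequality for the mixed operator, keeping the defect of the nonlocal part. -/
theorem weakForm_quot_add_le (hN : 1 ≤ N) (hp : 1 < p) (hs₀ : 0 < s) (hs₁ : s < 1)
    (hH : IsFinslerMinkowskiNorm H) (hu : MemW01p Ω p u) (hu0 : ∀ᵐ x, 0 ≤ u x)
    (hv : MemW01p Ω p v) {k ε : ℝ} (hk : 0 < k) (hε : 0 < ε) :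
    Integrable (fun z => piconeDefect p k ε u v z * kernel N p s z) ∧
    weakForm Ω H p s u (fun x => quot p k ε (u x) (v x)) +
      ∫ z, piconeDefect p k ε u v z * kernel N p s z ≤ energy Ω H p s v := by
  obtain ⟨hφ, hg⟩ := hu.quot_comp hv hp hk hε
  have j1 := hv.integrable_gagliardo hN hp hs₀ hs₁
  have j2 := hu.integrable_nonlocal_form hN hp hs₀ hs₁ hφ
  have e : (fun z => piconeDefect p k ε u v z * kernel N p s z) = fun z =>
      |v z.1 - v z.2| ^ p * kernel N p s z - |u z.1 - u z.2| ^ (p - 2) * (u z.1 - u z.2) *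
        (quot p k ε (u z.1) (v z.1) - quot p k ε (u z.2) (v z.2)) * kernel N p s z := by
    ext z
    unfold piconeDefect
    ring
  rw [e]
  refine ⟨j1.sub j2, ?_⟩
  rw [integral_sub j1 j2]
  have i1 := (hu.integrable_local_form hH hp hφ).restrict (s := Ω)
  have i2 := (hH.integrable_rpow hp hv).restrict (s := Ω)
  have h1 : ∫ x in Ω, H (weakGradient u x) ^ (p - 1) * inner ℝ (gradient H (weakGradient u x))
        (weakGradient (fun x => quot p k ε (u x) (v x)) x) ≤
      ∫ x in Ω, H (weakGradient v x) ^ p := by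
    refine integral_mono_ae i1 i2 ?_
    filter_upwards [ae_restrict_of_ae hg, ae_restrict_of_ae hu0,
      ae_restrict_of_ae (hu.weakGradient_eq_zero hp)] with x hx h0 hx0
    rcases h0.eq_or_lt with h | h
    · rw [hx0 h.symm, hH.map_zero, Real.zero_rpow (by linarith), zero_mul]
      exact Real.rpow_nonneg (hH.nonneg _) _
    · have := local_picone hH hp (T := trunc k (v x)) (add_pos (abs_pos.2 h.ne') hε)
        (trunc_deriv_mem k (v x)) (weakGradient u x) (weakGradient v x)
      rw [hx, quotGradient, sign_pos h]
      simpa using this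
  unfold weakForm energy
  linarith

end Picone

/-! ### The strong maximum principle -/

section StrongMaximumPrinciple

variable {N : ℕ} {Ω : Set (EuclideanSpace ℝ (Fin N))} {p s : ℝ}
  {H : EuclideanSpace ℝ (Fin N) → ℝ} {u v : EuclideanSpace ℝ (Fin N) → ℝ}

/-- A domination of `u^{p-1}` times the Picone test function by `|v|^p`, uniform in `k` and `ε`. -/
lemma rpow_sub_one_mul_quot_le {k ε a b : ℝ} (hp : 1 < p) (hk : 0 < k) (hε : 0 < ε) (ha : 0 ≤ a) :
    a ^ (p - 1) * quot p k ε a b ≤ |b| ^ p := by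
  have h1 : |trunc k b| ^ p ≤ |b| ^ p :=
    Real.rpow_le_rpow (abs_nonneg _) (abs_trunc_le hk b) (by linarith)
  have h2 : a ^ (p - 1) * (|a| + ε) ^ (1 - p) ≤ 1 := by
    rw [abs_of_nonneg ha, show 1 - p = -(p - 1) by ring, Real.rpow_neg (by positivity),
      ← div_eq_mul_inv, div_le_one (by positivity)]
    exact Real.rpow_le_rpow ha (by linarith) (by linarith)
  calc a ^ (p - 1) * quot p k ε a b = |trunc k b| ^ p * (a ^ (p - 1) * (|a| + ε) ^ (1 - p)) := by
        unfold quot; ring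
    _ ≤ |b| ^ p * 1 := by gcongr
    _ = _ := mul_one _

/-- At a pair of points where `u` vanishes and is positive respectively, the Picone defect blows up
as `ε → 0`. -/
lemma tendsto_piconeDefect (hp : 1 < p) {k : ℝ} (hk : 0 < k)
    {z : EuclideanSpace ℝ (Fin N) × EuclideanSpace ℝ (Fin N)} (h1 : u z.1 = 0) (h2 : 0 < u z.2)
    (hv : 0 < v z.1) :
    Tendsto (fun n : ℕ => piconeDefect p k (1 / ((n : ℝ) + 1)) u v z) atTop atTop := by
  have hp1 : 0 < p - 1 := by linarith
  set a := u z.2 with ha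
  set T₁ := |trunc k (v z.1)| ^ p with hT₁
  set T₂ := |trunc k (v z.2)| ^ p with hT₂
  have hT₁0 : 0 < T₁ := by
    have := abs_pos.2 (trunc_pos hk hv).ne'
    positivity
  have e : |u z.1 - u z.2| ^ (p - 2) * (u z.1 - u z.2) = -(a ^ (p - 1)) := by
    rw [h1, zero_sub, abs_neg, abs_of_pos h2, mul_neg, ← Real.rpow_add_one h2.ne']
    ring_nf
  have ha1 : 0 < a ^ (p - 1) := by positivity
  have hlow : ∀ n : ℕ, a ^ (p - 1) * (T₁ * ((n : ℝ) + 1) ^ (p - 1)) - a ^ (p - 1) * (T₂ * a ^ (1 - p)) ≤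
      piconeDefect p k (1 / ((n : ℝ) + 1)) u v z := by
    intro n
    have hε : (0 : ℝ) < 1 / ((n : ℝ) + 1) := by positivity
    have q1 : quot p k (1 / ((n : ℝ) + 1)) (u z.1) (v z.1) = T₁ * ((n : ℝ) + 1) ^ (p - 1) := by
      rw [quot, h1, abs_zero, zero_add, one_div, Real.inv_rpow (by positivity),
        ← Real.rpow_neg (by positivity), neg_sub]
    have q2 : quot p k (1 / ((n : ℝ) + 1)) (u z.2) (v z.2) ≤ T₂ * a ^ (1 - p) := by
      rw [quot, abs_of_pos h2]
      refine mul_le_mul_of_nonneg_left ?_ (by positivity)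
      exact Real.rpow_le_rpow_of_nonpos h2 (by linarith) (by linarith)
    unfold piconeDefect
    rw [e, q1]
    have h3 : 0 ≤ |v z.1 - v z.2| ^ p := by positivity
    have h4 := mul_le_mul_of_nonneg_left q2 ha1.le
    linarith
  refine tendsto_atTop_mono hlow (tendsto_atTop_add_const_right _ _ ?_)
  refine Tendsto.const_mul_atTop ha1 (Tendsto.const_mul_atTop hT₁0 ?_)
  exact (tendsto_rpow_atTop hp1).comp
    (tendsto_atTop_add_const_right _ _ tendsto_natCast_atTop_atTop)

lemma aemeasurable_liminf {α : Type*} [MeasurableSpace α] {ρ : Measure α} {h : ℕ → α → ℝ≥0∞}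
    (hm : ∀ n, AEMeasurable (h n) ρ) : AEMeasurable (fun x => liminf (fun n => h n x) atTop) ρ := by
  refine ⟨fun x => liminf (fun n => (hm n).mk _ x) atTop,
    Measurable.liminf fun n => (hm n).measurable_mk, ?_⟩
  filter_upwards [ae_all_iff.2 fun n => (hm n).ae_eq_mk] with x hx
  simp only [hx]

/-- The strong maximum principle: the nonlocal part of Picone's inequality forces a nontrivial
supersolution to be positive almost everywhere. -/
theorem ae_pos_of_supersolution (hN : 1 ≤ N) (hp : 1 < p) (hs₀ : 0 < s) (hs₁ : s < 1)
    (hΩ : Bornology.IsBounded Ω) (hΩo : IsOpen Ω) (hH : IsFinslerMinkowskiNorm H)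
    (hu : MemW01p Ω p u) (hu0 : ∀ᵐ x, 0 ≤ u x) (hnt : 0 < volume {x ∈ Ω | 0 < u x}) {c : ℝ}
    (hsup : ∀ φ, MemW01p Ω p φ → (∀ x, 0 ≤ φ x) →
      ∃ h : EuclideanSpace ℝ (Fin N) → ℝ, Integrable h (volume.restrict Ω) ∧
        (∀ᵐ x ∂volume.restrict Ω, -(c * (u x ^ (p - 1) * φ x)) ≤ h x) ∧
        weakForm Ω H p s u φ = ∫ x in Ω, h x) (hc : 0 ≤ c) :
    ∀ᵐ x ∂volume.restrict Ω, 0 < u x := by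
  have hp0 : 0 < p := by linarith
  obtain ⟨ψ, hψs, hψc, hψ0⟩ := hΩo.exists_contDiff_support_eq (n := (⊤ : ℕ∞))
  have hψ_off : ∀ x ∉ Ω, ψ x = 0 := fun x hx => by
    rw [← hψs] at hx; simpa using hx
  have hψ_pos : ∀ x ∈ Ω, 0 < ψ x := fun x hx => by
    rw [← hψs] at hx
    exact lt_of_le_of_ne (hψ0 ⟨x, rfl⟩).1 (Ne.symm hx)
  have hψcs : HasCompactSupport ψ := by
    refine HasCompactSupport.of_support_subset_isCompact hΩ.isCompact_closure ?_
    rw [hψs]; exact subset_closure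
  have hψW : MemW01p Ω p ψ := memW01p_of_contDiff hp.le hψc hψcs hψ_off
  have iψ : Integrable (fun x => |ψ x| ^ p) (volume.restrict Ω) :=
    (integrable_norm_rpow_of_memLp hp0 hψW.memLp).restrict
  set ε : ℕ → ℝ := fun n => 1 / ((n : ℝ) + 1) with hε
  have hε0 : ∀ n, 0 < ε n := fun n => by positivity
  set M := energy Ω H p s ψ + c * ∫ x in Ω, |ψ x| ^ p with hM
  have hb : ∀ n, ∫ z, piconeDefect p 1 (ε n) u ψ z * kernel N p s z ≤ M := by
    intro n
    have h1 := (weakForm_quot_add_le hN hp hs₀ hs₁ hH hu hu0 hψW one_pos (hε0 n)).2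
    obtain ⟨h, hi, hl, he⟩ := hsup _ (hu.quot_comp hψW hp one_pos (hε0 n)).1
      (fun x => quot_nonneg (hε0 n) _ _)
    have h2 : ∫ x in Ω, -(c * |ψ x| ^ p) ≤ ∫ x in Ω, h x := by
      refine integral_mono_ae (iψ.const_mul c).neg hi ?_
      filter_upwards [hl, ae_restrict_of_ae hu0] with x hx h0
      have := mul_le_mul_of_nonneg_left
        (rpow_sub_one_mul_quot_le (b := ψ x) hp one_pos (hε0 n) h0) hc
      linarith
    rw [integral_neg, integral_const_mul, ← he] at h2
    linarith
  have hu0p : ∀ᵐ z : EuclideanSpace ℝ (Fin N) × EuclideanSpace ℝ (Fin N), 0 ≤ u z.1 ∧ 0 ≤ u z.2 := by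
    filter_upwards [Measure.quasiMeasurePreserving_fst.ae hu0,
      Measure.quasiMeasurePreserving_snd.ae hu0] with z h1 h2 using ⟨h1, h2⟩
  have hfin : ∫⁻ z, liminf (fun n => ENNReal.ofReal (piconeDefect p 1 (ε n) u ψ z * kernel N p s z))
      atTop ≤ ENNReal.ofReal M := by
    refine (lintegral_liminf_le' fun n => ?_).trans ?_
    · exact (weakForm_quot_add_le hN hp hs₀ hs₁ hH hu hu0 hψW one_pos
        (hε0 n)).1.1.aemeasurable.ennreal_ofReal
    · refine (liminf_le_liminf (Eventually.of_forall fun n =>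
        (?_ : _ ≤ ENNReal.ofReal M))).trans (le_of_eq (liminf_const _))
      rw [← ofReal_integral_eq_lintegral_ofReal
        (weakForm_quot_add_le hN hp hs₀ hs₁ hH hu hu0 hψW one_pos (hε0 n)).1 (by
          filter_upwards [hu0p] with z hz
          exact mul_nonneg (piconeDefect_nonneg hp one_pos (hε0 n) hz.1 hz.2) (kernel_nonneg z))]
      exact ENNReal.ofReal_le_ofReal (hb n)
  have hae : ∀ᵐ z, liminf (fun n => ENNReal.ofReal
      (piconeDefect p 1 (ε n) u ψ z * kernel N p s z)) atTop < ⊤ :=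
    ae_lt_top' (aemeasurable_liminf fun n => (weakForm_quot_add_le hN hp hs₀ hs₁ hH hu hu0 hψW one_pos
        (hε0 n)).1.1.aemeasurable.ennreal_ofReal) (hfin.trans_lt ENNReal.ofReal_lt_top).ne
  have hnull : volume ({x ∈ Ω | u x = 0} ×ˢ {x ∈ Ω | 0 < u x}) = 0 := by
    refine measure_mono_null (fun z hz => ?_) (ae_iff.1 hae)
    obtain ⟨⟨hz1, hz2⟩, hz3, hz4⟩ := hz
    have hne : z.1 ≠ z.2 := fun h => by rw [h] at hz2; linarith
    have hK : 0 < kernel N p s z := by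
      unfold kernel
      exact Real.rpow_pos_of_pos (norm_pos_iff.2 (sub_ne_zero.2 hne)) _
    have ht := ENNReal.tendsto_ofReal_atTop.comp
      ((tendsto_piconeDefect hp one_pos hz2 hz4 (hψ_pos _ hz1)).atTop_mul_const hK)
    have := ht.liminf_eq
    simp only [mem_ofPred_eq, not_lt, top_le_iff]
    exact this
  rw [Measure.volume_eq_prod, Measure.prod_prod, mul_eq_zero] at hnull
  have hZ : volume {x ∈ Ω | u x = 0} = 0 := hnull.resolve_right hnt.ne'
  have hZ' : ∀ᵐ x, ¬(x ∈ Ω ∧ u x = 0) := by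
    rw [ae_iff]; simpa using hZ
  rw [ae_restrict_iff' hΩo.measurableSet]
  filter_upwards [hZ', hu0] with x h1 h2 h3
  exact lt_of_le_of_ne h2 fun h => h1 ⟨h3, h.symm⟩

end StrongMaximumPrinciple

/-! ### Necessity of the eigenvalue conditions -/

section Necessity

variable {N : ℕ} {Ω : Set (EuclideanSpace ℝ (Fin N))} {p s : ℝ}
  {H : EuclideanSpace ℝ (Fin N) → ℝ} {f : EuclideanSpace ℝ (Fin N) → ℝ → ℝ}
  {u : EuclideanSpace ℝ (Fin N) → ℝ}

lemma IsWeakSolution.ae_nonneg (hΩm : MeasurableSet Ω) (hu : IsWeakSolution Ω H p s f u) :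
    ∀ᵐ x, 0 ≤ u x := by
  filter_upwards [(ae_restrict_iff' hΩm).1 hu.nonneg, hu.mem.2] with x h1 h2
  by_cases hx : x ∈ Ω
  · exact h1 hx
  · rw [h2 hx]

/-- Testing the equation with `u` itself gives `energy u = ∫ f(x,u) u`, and by strict monotonicity
`f(x,u)/u^{p-1}` is strictly below the quotient at `u/2`, hence below `a₀` with a finite quantity in
between; the normalization of `u` is then a function with a negative value. -/
theorem IsWeakSolution.betaOne_aZero_neg (hp : 1 < p) (hΩm : MeasurableSet Ω)
    (hfin : volume Ω ≠ ⊤)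
    (hH : IsFinslerMinkowskiNorm H) (hf : IsBrezisOswald Ω p f) (hu : IsWeakSolution Ω H p s f u)
    (hpos : ∀ᵐ x ∂volume.restrict Ω, 0 < u x) : betaOne Ω H p s (aZero p f) < 0 := by
  have hp0 : 0 < p := by linarith
  have hp1 : 0 < p - 1 := by linarith
  have hΩ0 : 0 < volume Ω := hu.nontrivial.trans_le (measure_mono (sep_subset _ _))
  have hne : (volume.restrict Ω) univ ≠ 0 := by simpa using hΩ0.ne'
  have iu : Integrable (fun x => |u x| ^ p) (volume.restrict Ω) :=
    (integrable_norm_rpow_of_memLp hp0 hu.mem.memLp).restrict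
  have pos_of_ae : ∀ h : EuclideanSpace ℝ (Fin N) → ℝ, Integrable h (volume.restrict Ω) →
      (∀ᵐ x ∂volume.restrict Ω, 0 < h x) → 0 < ∫ x in Ω, h x := by
    intro h hi h0
    rw [integral_pos_iff_support_of_nonneg_ae (h0.mono fun x hx => hx.le) hi]
    have : (volume.restrict Ω) (Function.support h)ᶜ = 0 := by
      refine ae_iff.1 (h0.mono fun x hx => ?_)
      exact hx.ne'
    rw [pos_iff_ne_zero]
    intro h1
    refine hne ?_
    rw [← union_compl_self (Function.support h)]
    exact measure_union_null h1 this
  set m := ∫ x in Ω, |u x| ^ p with hm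
  have hm0 : 0 < m := pos_of_ae _ iu (hpos.mono fun x hx => by
    have := abs_pos.2 hx.ne'
    positivity)
  set b : EuclideanSpace ℝ (Fin N) → ℝ := fun x => posExt f x (u x / 2) / (u x / 2) ^ (p - 1) with hb
  have hbu : ∀ x, 0 < u x → b x * |u x| ^ p = posExt f x (u x / 2) * (2 ^ (p - 1) * u x) := by
    intro x hx
    have h2 : |u x| ^ p = u x ^ (p - 1) * u x := by
      rw [abs_of_pos hx, ← Real.rpow_add_one hx.ne']; ring_nf
    have h3 : 0 < u x ^ (p - 1) := by positivity
    rw [h2]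
    simp only [hb]
    rw [Real.div_rpow hx.le (by norm_num)]
    field_simp
  have ib : Integrable (fun x => b x * |u x| ^ p) (volume.restrict Ω) := by
    refine (hf.integrable_comp_mul hp hfin (u := fun x => u x / 2) (φ := fun x => 2 ^ (p - 1) * u x)
      ((by simpa [div_eq_mul_inv] using hu.mem.memLp.mul_const (2:ℝ)⁻¹ :
        MemLp (fun x => u x / 2) (ENNReal.ofReal p) volume).restrict Ω)
      ((hu.mem.memLp.const_mul _).restrict Ω)).congr ?_
    filter_upwards [hpos] with x hx using (hbu x hx).symm
  have iff' : Integrable (fun x => f x (u x) * u x) (volume.restrict Ω) := by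
    refine (hf.integrable_comp_mul hp hfin (hu.mem.memLp.restrict Ω) (hu.mem.memLp.restrict Ω)).congr ?_
    filter_upwards [hpos] with x hx
    rw [posExt_of_nonneg _ _ hx.le]
  have hE : energy Ω H p s u = ∫ x in Ω, f x (u x) * u x := by
    rw [← hu.eqn u hu.mem, weakForm_self hp hH]
  have hlt : energy Ω H p s u < ∫ x in Ω, b x * |u x| ^ p := by
    rw [hE, ← sub_pos, ← integral_sub ib iff']
    refine pos_of_ae _ (ib.sub iff') ?_
    filter_upwards [hpos, hf.strictAnti] with x hx hanti
    have h1 : f x (u x) / u x ^ (p - 1) < f x (u x / 2) / (u x / 2) ^ (p - 1) :=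
      hanti (mem_Ioi.2 (by positivity)) (mem_Ioi.2 hx) (by linarith)
    have h2 : f x (u x) * u x = f x (u x) / u x ^ (p - 1) * |u x| ^ p := by
      have h2 : |u x| ^ p = u x ^ (p - 1) * u x := by
        rw [abs_of_pos hx, ← Real.rpow_add_one hx.ne']; ring_nf
      have h3 : 0 < u x ^ (p - 1) := by positivity
      rw [h2]; field_simp
    have h3 : 0 < |u x| ^ p := by have := abs_pos.2 hx.ne'; positivity
    rw [h2, sub_pos]
    simp only [hb]
    rw [posExt_of_nonneg _ _ (by positivity)]
    exact mul_lt_mul_of_pos_right h1 h3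
  set k : ℝ := m ^ (-(1 / p)) with hk
  have hk0 : 0 < k := by positivity
  have hkp : k ^ p = m⁻¹ := by
    rw [hk, ← Real.rpow_mul hm0.le, ← Real.rpow_neg_one]
    congr 1; field_simp
  have e1 : ∀ x, |k * u x| ^ p = m⁻¹ * |u x| ^ p := fun x => by
    rw [abs_mul, Real.mul_rpow (abs_nonneg _) (abs_nonneg _), abs_of_pos hk0, hkp]
  have e2 : (fun x => b x * |k * u x| ^ p) = fun x => m⁻¹ * (b x * |u x| ^ p) := by
    ext x; rw [e1]; ring
  refine betaOne_neg_of_lt hp hΩm (hu.mem.const_mul hp.le k).1 ?_ (b := b) ?_ ?_ ?_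
  · simp only [e1]
    rw [integral_const_mul, ← hm, inv_mul_cancel₀ hm0.ne']
  · rw [e2]; exact ib.const_mul _
  · filter_upwards [hpos, hf.tendsto_aZero] with x hx h _
    have := h.2 (u x / 2) (by positivity)
    simp only [hb]
    rwa [posExt_of_nonneg _ _ (by positivity)]
  · rw [e2, integral_const_mul, energy_const_mul hp hH hu.mem, abs_of_pos hk0, hkp]
    exact mul_lt_mul_of_pos_left hlt (by positivity)

/-- For `v` in the unit sphere, Picone's inequality with test functions tending to `|v|^p u^{1-p}`
gives `∫ f(x,u) u^{1-p} |v|^p ≤ energy v`, and `f(x,u)/u^{p-1} > a_∞`. The strict inequality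
`∫ a_∞ |v|^p < energy v` becomes a uniform gap by compactness. -/
theorem IsWeakSolution.betaOne_aInfty_pos (hN : 1 ≤ N) (hp : 1 < p) (hs₀ : 0 < s) (hs₁ : s < 1)
    (hΩ : Bornology.IsBounded Ω) (hΩm : MeasurableSet Ω)
    (hH : IsFinslerMinkowskiNorm H) (hf : IsBrezisOswald Ω p f) (hu : IsWeakSolution Ω H p s f u)
    (hpos : ∀ᵐ x ∂volume.restrict Ω, 0 < u x) : 0 < betaOne Ω H p s (aInfty p f) := by
  have hp0 : 0 < p := by linarith
  have hp1 : 0 < p - 1 := by linarith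
  have hfin : volume Ω ≠ ⊤ := hΩ.measure_lt_top.ne
  have hu0 := hu.ae_nonneg hΩm
  obtain ⟨c, hc, hgr, A, hA, hAq⟩ := hf.exists_aInfty hp
  have hum : AEStronglyMeasurable u (volume.restrict Ω) := hu.mem.memLp.1.restrict
  have key : ∀ v, MemW01p Ω p v → ∫ x in Ω, |v x| ^ p = 1 →
      ∫ x in Ω, A x * |v x| ^ p < energy Ω H p s v := by
    intro v hv hv1
    have iv : Integrable (fun x => |v x| ^ p) (volume.restrict Ω) :=
      (integrable_norm_rpow_of_memLp hp0 hv.memLp).restrict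
    set φ : ℕ → EuclideanSpace ℝ (Fin N) → ℝ := fun n x =>
      quot p ((n : ℝ) + 1) (1 / ((n : ℝ) + 1)) (u x) (v x) with hφ
    have hk : ∀ n : ℕ, (0 : ℝ) < (n : ℝ) + 1 := fun n => by positivity
    have hε : ∀ n : ℕ, (0 : ℝ) < 1 / ((n : ℝ) + 1) := fun n => by positivity
    have hφW : ∀ n, MemW01p Ω p (φ n) := fun n => (hu.mem.quot_comp hv hp (hk n) (hε n)).1
    have hφ0 : ∀ n x, 0 ≤ φ n x := fun n x => quot_nonneg (hε n) _ _
    have hφE : ∀ n, ∫ x in Ω, f x (u x) * φ n x ≤ energy Ω H p s v := by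
      intro n
      obtain ⟨-, h2⟩ := weakForm_quot_add_le hN hp hs₀ hs₁ hH hu.mem hu0 hv (hk n) (hε n)
      rw [hu.eqn _ (hφW n)] at h2
      have h3 : 0 ≤ ∫ z, piconeDefect p ((n : ℝ) + 1) (1 / ((n : ℝ) + 1)) u v z * kernel N p s z := by
        refine integral_nonneg_of_ae ?_
        filter_upwards [Measure.quasiMeasurePreserving_fst.ae hu0,
          Measure.quasiMeasurePreserving_snd.ae hu0] with z h1 h2
        exact mul_nonneg (piconeDefect_nonneg hp (hk n) (hε n) h1 h2) (kernel_nonneg z)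
      linarith
    have iφ : ∀ n, Integrable (fun x => f x (u x) * φ n x) (volume.restrict Ω) := fun n => by
      refine (hf.integrable_comp_mul hp hfin (hu.mem.memLp.restrict Ω)
        ((hφW n).memLp.restrict Ω)).congr ?_
      filter_upwards [hpos] with x hx
      rw [posExt_of_nonneg _ _ hx.le]
    -- pointwise limit of the test functions
    have hφt : ∀ x, 0 < u x → Tendsto (fun n => φ n x) atTop (𝓝 (|v x| ^ p * u x ^ (1 - p))) := by
      intro x hx
      have h1 : Tendsto (fun n : ℕ => |trunc ((n : ℝ) + 1) (v x)| ^ p) atTop (𝓝 (|v x| ^ p)) :=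
        (tendsto_trunc (v x)).abs.rpow_const (Or.inr hp0.le)
      have h2 : Tendsto (fun n : ℕ => |u x| + 1 / ((n : ℝ) + 1)) atTop (𝓝 (|u x| + 0)) :=
        tendsto_one_div_add_atTop_nhds_zero_nat.const_add _
      rw [add_zero, abs_of_pos hx] at h2
      have := h1.mul (h2.rpow_const (p := 1 - p) (Or.inl hx.ne'))
      refine this.congr fun n => ?_
      simp only [hφ, quot, abs_of_pos hx]
    have hup : ∀ x, 0 < u x → u x ^ (p - 1) * (|v x| ^ p * u x ^ (1 - p)) = |v x| ^ p := by
      intro x hx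
      rw [mul_comm, mul_assoc, ← Real.rpow_add hx]
      simp
    set g : ℕ → EuclideanSpace ℝ (Fin N) → ℝ := fun n x => A x * (u x ^ (p - 1) * φ n x) with hg
    have hgm : ∀ n, AEStronglyMeasurable (g n) (volume.restrict Ω) := fun n => by
      have := hA.aemeasurable.mul ((hum.aemeasurable.pow_const (p - 1)).mul
        (hφW n).memLp.1.restrict.aemeasurable)
      exact this.aestronglyMeasurable
    have hgb : ∀ n, ∀ᵐ x ∂volume.restrict Ω, ‖g n x‖ ≤ c * |v x| ^ p := by
      intro n
      filter_upwards [hpos, hAq] with x hx hAx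
      have h1 : 0 ≤ u x ^ (p - 1) * φ n x := mul_nonneg (by positivity) (hφ0 n x)
      rw [norm_mul, Real.norm_of_nonneg h1]
      exact mul_le_mul hAx.2.1 (rpow_sub_one_mul_quot_le hp (hk n) (hε n) hx.le) h1 hc.le
    have ig : ∀ n, Integrable (g n) (volume.restrict Ω) := fun n =>
      (iv.const_mul c).mono' (hgm n) (hgb n)
    have tg : Tendsto (fun n => ∫ x in Ω, g n x) atTop (𝓝 (∫ x in Ω, A x * |v x| ^ p)) := by
      refine tendsto_integral_of_dominated_convergence _ hgm (iv.const_mul c) hgb ?_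
      filter_upwards [hpos] with x hx
      rw [← hup x hx]
      exact ((hφt x hx).const_mul _).const_mul _
    set r : EuclideanSpace ℝ (Fin N) → ℝ := fun x =>
      (f x (u x) - A x * u x ^ (p - 1)) * (|v x| ^ p * u x ^ (1 - p)) with hr
    have hfA : ∀ᵐ x ∂volume.restrict Ω, 0 < f x (u x) - A x * u x ^ (p - 1) := by
      filter_upwards [hpos, hAq] with x hx hAx
      have := hAx.2.2.1 (u x) hx
      rw [lt_div_iff₀ (by positivity)] at this
      linarith
    have hF : ∫⁻ x in Ω, ENNReal.ofReal (r x) ≤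
        ENNReal.ofReal (energy Ω H p s v - ∫ x in Ω, A x * |v x| ^ p) := by
      have hd : ∀ n x, (f x (u x) - A x * u x ^ (p - 1)) * φ n x = f x (u x) * φ n x - g n x :=
        fun n x => by simp only [hg]; ring
      have id : ∀ n, Integrable (fun x => f x (u x) * φ n x - g n x) (volume.restrict Ω) :=
        fun n => (iφ n).sub (ig n)
      calc ∫⁻ x in Ω, ENNReal.ofReal (r x)
          = ∫⁻ x in Ω, liminf (fun n => ENNReal.ofReal (f x (u x) * φ n x - g n x)) atTop := by
            refine lintegral_congr_ae ?_
            filter_upwards [hpos] with x hx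
            refine (Tendsto.liminf_eq (ENNReal.tendsto_ofReal ?_)).symm
            simp only [← hd]
            exact (hφt x hx).const_mul _
        _ ≤ liminf (fun n => ∫⁻ x in Ω, ENNReal.ofReal (f x (u x) * φ n x - g n x)) atTop :=
            lintegral_liminf_le' fun n => (id n).1.aemeasurable.ennreal_ofReal
        _ ≤ liminf (fun n => ENNReal.ofReal (energy Ω H p s v - ∫ x in Ω, g n x)) atTop := by
            refine liminf_le_liminf (Eventually.of_forall fun n => ?_)
            rw [← ofReal_integral_eq_lintegral_ofReal (id n) (by
              filter_upwards [hfA] with x hx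
              rw [← hd]
              exact mul_nonneg hx.le (hφ0 n x)), integral_sub (iφ n) (ig n)]
            exact ENNReal.ofReal_le_ofReal (by linarith [hφE n])
        _ = _ := (ENNReal.tendsto_ofReal (tg.const_sub _)).liminf_eq
    by_contra hcon
    push Not at hcon
    rw [ENNReal.ofReal_of_nonpos (by linarith), nonpos_iff_eq_zero] at hF
    have hrm : AEMeasurable (fun x => ENNReal.ofReal (r x)) (volume.restrict Ω) := by
      refine AEMeasurable.ennreal_ofReal (AEMeasurable.mul (AEMeasurable.sub ?_ ?_) (AEMeasurable.mul ?_ ?_))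
      · refine (hf.aestronglyMeasurable_comp hum).aemeasurable.congr ?_
        filter_upwards [hpos] with x hx
        rw [posExt_of_nonneg _ _ hx.le]
      · exact hA.aemeasurable.mul (hum.aemeasurable.pow_const _)
      · exact iv.1.aemeasurable
      · exact hum.aemeasurable.pow_const _
    have hz : ∀ᵐ x ∂volume.restrict Ω, |v x| ^ p = 0 := by
      filter_upwards [(lintegral_eq_zero_iff' hrm).1 hF, hfA, hpos] with x h1 h2 h3
      have h4 : r x ≤ 0 := by simpa using h1
      have h5 : 0 < u x ^ (1 - p) := by positivity
      by_contra h0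
      have h6 : 0 < |v x| ^ p := lt_of_le_of_ne (by positivity) (Ne.symm h0)
      have : 0 < r x := by simp only [hr]; positivity
      linarith
    rw [integral_congr_ae (g := fun _ => (0:ℝ)) hz] at hv1
    simp at hv1
  obtain ⟨n, δ, hδ, hgap⟩ := exists_gap hN hp hs₀ hs₁ hΩ hΩm hH (A := A) (B := fun _ => A)
    (fun _ => hA) (c := c) (fun _ => hAq.mono fun x hx => hx.2.1)
    (ae_of_all _ fun x => tendsto_const_nhds) key
  exact betaOne_pos_of_gap hp hΩm hA (hAq.mono fun x hx => ⟨hx.1, hx.2.1⟩) hδ hgap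

end Necessity

/-! ### The variational functional and its minimizers -/

section Existence

variable {N : ℕ} {Ω : Set (EuclideanSpace ℝ (Fin N))} {p s : ℝ}
  {H : EuclideanSpace ℝ (Fin N) → ℝ} {f : EuclideanSpace ℝ (Fin N) → ℝ → ℝ}
  {u v : EuclideanSpace ℝ (Fin N) → ℝ}

/-- The functional whose critical points are the weak solutions; the nonlinearity is extended to
negative arguments by its value at `0`. -/
def action {N : ℕ} (Ω : Set (EuclideanSpace ℝ (Fin N))) (H : EuclideanSpace ℝ (Fin N) → ℝ)
    (p s : ℝ) (f : EuclideanSpace ℝ (Fin N) → ℝ → ℝ) (u : EuclideanSpace ℝ (Fin N) → ℝ) : ℝ :=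
  energy Ω H p s u / p - ∫ x in Ω, primitive f x (u x)

lemma primitive_zero {α : Type*} (f : α → ℝ → ℝ) (x : α) : primitive f x 0 = 0 := by
  simp [primitive]

lemma hasDerivAt_primitive {α : Type*} {f : α → ℝ → ℝ} {x : α} (h : Continuous (posExt f x))
    (r : ℝ) : HasDerivAt (primitive f x) (posExt f x r) r :=
  intervalIntegral.integral_hasDerivAt_right (h.intervalIntegrable _ _)
    (h.stronglyMeasurableAtFilter _ _) h.continuousAt

lemma abs_posExt_le {c : ℝ} (hp : 1 < p) (hc : 0 < c) {x : EuclideanSpace ℝ (Fin N)}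
    (h : ∀ t, 0 ≤ t → |f x t| ≤ c * (1 + t ^ (p - 1))) (t : ℝ) :
    |posExt f x t| ≤ c * (1 + |t| ^ (p - 1)) := by
  refine (h _ (le_max_right _ _)).trans ?_
  have : (max t 0) ^ (p - 1) ≤ |t| ^ (p - 1) :=
    Real.rpow_le_rpow (le_max_right _ _) (max_le (le_abs_self _) (abs_nonneg _)) (by linarith)
  gcongr

lemma abs_le_one_add_rpow (hp : 1 < p) (r : ℝ) : |r| ≤ 1 + |r| ^ p := by
  rcases le_total |r| 1 with h | h
  · have : 0 ≤ |r| ^ p := by positivity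
    linarith
  · have := Real.self_le_rpow_of_one_le h hp.le
    linarith

lemma abs_primitive_le {c : ℝ} (hp : 1 < p) (hc : 0 < c) {x : EuclideanSpace ℝ (Fin N)}
    (h : ∀ t, 0 ≤ t → |f x t| ≤ c * (1 + t ^ (p - 1))) (r : ℝ) :
    |primitive f x r| ≤ 2 * c * (1 + |r| ^ p) := by
  have h1 : ‖primitive f x r‖ ≤ c * (1 + |r| ^ (p - 1)) * |r - 0| := by
    refine intervalIntegral.norm_integral_le_of_norm_le_const fun τ hτ => ?_
    refine (abs_posExt_le hp hc h τ).trans ?_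
    have h2 : |τ| ≤ |r| := by
      rcases le_total 0 r with h0 | h0
      · rw [uIoc_of_le h0] at hτ
        rw [abs_of_pos hτ.1, abs_of_nonneg h0]; exact hτ.2
      · rw [uIoc_of_ge h0] at hτ
        rw [abs_of_nonpos hτ.2, abs_of_nonpos h0]; linarith [hτ.1]
    have hp1 : 0 ≤ p - 1 := by linarith
    gcongr
  rw [sub_zero, Real.norm_eq_abs] at h1
  have h3 : |r| ^ (p - 1) * |r| = |r| ^ p := by
    rcases eq_or_ne r 0 with rfl | h0
    · simp [Real.zero_rpow (by linarith : p ≠ 0)]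
    · rw [← Real.rpow_add_one (by simpa using h0)]; ring_nf
  have h4 := abs_le_one_add_rpow hp r
  calc |primitive f x r| ≤ c * (1 + |r| ^ (p - 1)) * |r| := h1
    _ = c * (|r| + |r| ^ p) := by rw [← h3]; ring
    _ ≤ c * ((1 + |r| ^ p) + (1 + |r| ^ p)) := by
        gcongr
        linarith
    _ = _ := by ring

lemma primitive_nonpos {x : EuclideanSpace ℝ (Fin N)} (h0 : 0 ≤ f x 0) {r : ℝ} (hr : r ≤ 0) :
    primitive f x r ≤ 0 := by
  have : primitive f x r = ∫ τ in (0:ℝ)..r, f x 0 := by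
    refine intervalIntegral.integral_congr fun τ hτ => ?_
    rw [uIcc_of_ge hr] at hτ
    simp only [posExt, max_eq_right hτ.2]
  rw [this, intervalIntegral.integral_const, smul_eq_mul, sub_zero]
  exact mul_nonpos_of_nonpos_of_nonneg hr h0

lemma integral_rpow_sub_one_eq (hp : 1 < p) (r : ℝ) :
    ∫ τ in (0:ℝ)..r, τ ^ (p - 1) = r ^ p / p := by
  rw [integral_rpow (Or.inl (by linarith))]
  simp [Real.zero_rpow (by linarith : p ≠ 0)]

lemma intervalIntegrable_mul_rpow (hp : 1 < p) (b C r : ℝ) :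
    IntervalIntegrable (fun τ : ℝ => b * τ ^ (p - 1) + C) volume 0 r :=
  ((intervalIntegral.intervalIntegrable_rpow' (by linarith)).const_mul b).add
    intervalIntegrable_const

lemma primitive_le {x : EuclideanSpace ℝ (Fin N)} (hp : 1 < p) (hx : Continuous (posExt f x))
    {b C r : ℝ} (hr : 0 ≤ r) (h : ∀ τ, 0 ≤ τ → f x τ ≤ b * τ ^ (p - 1) + C) :
    primitive f x r ≤ b * r ^ p / p + C * r := by
  have h1 := intervalIntegral.integral_mono_on hr (hx.intervalIntegrable 0 r)
    (intervalIntegrable_mul_rpow hp b C r) (fun τ hτ => by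
      rw [posExt_of_nonneg _ _ hτ.1]; exact h τ hτ.1)
  refine h1.trans (le_of_eq ?_)
  rw [intervalIntegral.integral_add ((intervalIntegral.intervalIntegrable_rpow'
    (by linarith)).const_mul b) intervalIntegrable_const, intervalIntegral.integral_const_mul,
    integral_rpow_sub_one_eq hp, intervalIntegral.integral_const, smul_eq_mul]
  ring

/-- The monotonicity of `f(x,t)/t^{p-1}` bounds the primitive from below. -/
lemma mul_le_mul_primitive {x : EuclideanSpace ℝ (Fin N)} (hp : 1 < p)
    (hx : Continuous (posExt f x))
    (hanti : StrictAntiOn (fun t => f x t / t ^ (p - 1)) (Ioi 0)) (h0 : 0 ≤ f x 0) {r : ℝ}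
    (hr : 0 ≤ r) : f x r * r ≤ p * primitive f x r := by
  have hp0 : 0 < p := by linarith
  rcases hr.eq_or_lt with h | h
  · rw [← h, primitive_zero]; simp
  set b := f x r / r ^ (p - 1) with hb
  have h1 := intervalIntegral.integral_mono_on hr (intervalIntegrable_mul_rpow hp b 0 r)
    (hx.intervalIntegrable 0 r) (fun τ hτ => by
      rw [posExt_of_nonneg _ _ hτ.1, add_zero]
      rcases hτ.1.eq_or_lt with h2 | h2
      · rw [← h2, Real.zero_rpow (by linarith), mul_zero]; exact h0
      · have := hanti.antitoneOn (mem_Ioi.2 h2) (mem_Ioi.2 h) hτ.2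
        rw [le_div_iff₀ (by positivity)] at this
        exact this)
  simp only [add_zero] at h1
  rw [intervalIntegral.integral_const_mul, integral_rpow_sub_one_eq hp] at h1
  have h2 : r ^ p = r ^ (p - 1) * r := by
    rw [← Real.rpow_add_one h.ne']; ring_nf
  have h3 : 0 < r ^ (p - 1) := by positivity
  have h4 : b * (r ^ p / p) = f x r * r / p := by
    rw [h2, hb]; field_simp
  rw [h4, div_le_iff₀ hp0] at h1
  rw [mul_comm p]
  exact h1

lemma IsBrezisOswald.integrable_primitive (hp : 1 < p) (hf : IsBrezisOswald Ω p f)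
    (hfin : volume Ω ≠ ⊤) (hu : MemLp u (ENNReal.ofReal p) volume) :
    Integrable (fun x => primitive f x (u x)) (volume.restrict Ω) := by
  have hfin' : IsFiniteMeasure (volume.restrict Ω) := ⟨by simpa using hfin.lt_top⟩
  obtain ⟨c, hc, hgr⟩ := hf.growth
  have iu : Integrable (fun x => |u x| ^ p) (volume.restrict Ω) :=
    (integrable_norm_rpow_of_memLp (by linarith) hu).restrict
  refine (((integrable_const (1:ℝ)).add iu).const_mul (2 * c)).mono'
    (hf.aestronglyMeasurable_primitive hu.1.restrict) ?_
  filter_upwards [hgr] with x hx using abs_primitive_le hp hc hx _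

lemma memW01p_zero (hp : 1 ≤ p) : MemW01p Ω p (fun _ => (0:ℝ)) :=
  memW01p_of_contDiff hp contDiff_const HasCompactSupport.zero fun _ _ => rfl

lemma action_posPart_le (hN : 1 ≤ N) (hp : 1 < p) (hs₀ : 0 < s) (hs₁ : s < 1)
    (hfin : volume Ω ≠ ⊤) (hH : IsFinslerMinkowskiNorm H) (hf : IsBrezisOswald Ω p f)
    (hu : MemW01p Ω p u) : action Ω H p s f (fun x => max (u x) 0) ≤ action Ω H p s f u := by
  have h1 := energy_posPart_le hN hp hs₀ hs₁ hH hu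
  have h2 : ∫ x in Ω, primitive f x (u x) ≤ ∫ x in Ω, primitive f x (max (u x) 0) := by
    refine integral_mono_ae (hf.integrable_primitive hp hfin hu.memLp)
      (hf.integrable_primitive hp hfin (hu.posPart hp).memLp) ?_
    filter_upwards [hf.apply_zero_nonneg] with x hx
    rcases le_total (u x) 0 with h | h
    · simp only [max_eq_right h, primitive_zero]
      exact primitive_nonpos hx h
    · simp only [max_eq_left h]; exact le_rfl
  unfold action
  have h3 : energy Ω H p s (fun x => max (u x) 0) / p ≤ energy Ω H p s u / p := by
    have : 0 < p := by linarith
    gcongr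
  linarith

/-- Coercivity of the functional on nonnegative functions, from the positivity of `β₁` for `a_∞`. -/
lemma exists_coercive (hN : 1 ≤ N) (hp : 1 < p) (hs₀ : 0 < s) (hs₁ : s < 1)
    (hΩ : Bornology.IsBounded Ω) (hΩm : MeasurableSet Ω) (hH : IsFinslerMinkowskiNorm H)
    (hf : IsBrezisOswald Ω p f) (hβ : 0 < betaOne Ω H p s (aInfty p f)) :
    ∃ δ K : ℝ, 0 < δ ∧ ∀ u, MemW01p Ω p u → (∀ᵐ x, 0 ≤ u x) →
      δ * ∫ x in Ω, |u x| ^ p ≤ action Ω H p s f u + K := by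
  have hp0 : 0 < p := by linarith
  have hp1 : 0 < p - 1 := by linarith
  have hfin : volume Ω ≠ ⊤ := hΩ.measure_lt_top.ne
  have hfin' : IsFiniteMeasure (volume.restrict Ω) := ⟨by simpa using hfin.lt_top⟩
  obtain ⟨c, hc, hgr, A, hA, hAq⟩ := hf.exists_aInfty hp
  set B : ℕ → EuclideanSpace ℝ (Fin N) → ℝ :=
    fun n x => f x ((n : ℝ) + 1) / ((n : ℝ) + 1) ^ (p - 1) with hB
  have hT : ∀ n : ℕ, (1:ℝ) ≤ (n : ℝ) + 1 := fun n => by simp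
  have hBb : ∀ n, ∀ᵐ x ∂volume.restrict Ω, |B n x| ≤ 2 * c := by
    intro n
    filter_upwards [hgr] with x hx
    have h1 := hx ((n : ℝ) + 1) (by positivity)
    have h2 : 1 ≤ ((n : ℝ) + 1) ^ (p - 1) := Real.one_le_rpow (hT n) hp1.le
    simp only [hB]
    rw [abs_div, abs_of_pos (by positivity : 0 < ((n : ℝ) + 1) ^ (p - 1)), div_le_iff₀ (by positivity)]
    nlinarith
  obtain ⟨n, δ, hδ, hgap⟩ := exists_gap hN hp hs₀ hs₁ hΩ hΩm hH (A := A) (B := B)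
    (fun n => by
      have := (hf.measurable _ (by positivity : (0:ℝ) ≤ (n : ℝ) + 1)).aemeasurable.div_const
        (((n : ℝ) + 1) ^ (p - 1))
      exact this.aestronglyMeasurable) hBb
    (by
      filter_upwards [hAq] with x hx
      exact hx.2.2.2.comp (tendsto_atTop_add_const_right _ _ tendsto_natCast_atTop_atTop))
    (fun v hv hv1 => integral_lt_energy_of_betaOne_pos hp hΩm hA
      (hAq.mono fun x hx => ⟨hx.1, hx.2.1⟩) hβ hv hv1)
  have hBm : AEStronglyMeasurable (B n) (volume.restrict Ω) := by
    have := (hf.measurable _ (by positivity : (0:ℝ) ≤ (n : ℝ) + 1)).aemeasurable.div_const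
      (((n : ℝ) + 1) ^ (p - 1))
    exact this.aestronglyMeasurable
  set T : ℝ := (n : ℝ) + 1 with hTd
  have hT1 : 1 ≤ T := hT n
  set C₁ : ℝ := c * (1 + T ^ (p - 1)) + 2 * c * T ^ (p - 1) with hC₁
  have hC₁0 : 0 < C₁ := by positivity
  -- `r ≤ η r^p + R` absorbs the linear term
  set η : ℝ := δ / p / 2 / C₁ with hη
  have hη0 : 0 < η := by positivity
  obtain ⟨R, hR0, hR⟩ : ∃ R : ℝ, 0 ≤ R ∧ ∀ r : ℝ, 0 ≤ r → r ≤ η * r ^ p + R := by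
    obtain ⟨R, h, hR1⟩ := (((tendsto_rpow_atTop hp1).eventually_ge_atTop (1 / η)).and
      (eventually_ge_atTop 1)).exists
    refine ⟨R, by linarith, fun r hr => ?_⟩
    rcases le_total r R with h1 | h1
    · have : 0 ≤ η * r ^ p := by positivity
      linarith
    · have hr0 : 0 < r := by linarith
      have h2 : 1 / η ≤ r ^ (p - 1) := h.trans (Real.rpow_le_rpow (by linarith) h1 hp1.le)
      have h3 : r ^ p = r ^ (p - 1) * r := by
        rw [← Real.rpow_add_one hr0.ne']; ring_nf
      rw [div_le_iff₀ hη0] at h2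
      rw [h3]
      nlinarith
  refine ⟨δ / p / 2, C₁ * R * volume.real Ω, by positivity, fun u hu hu0 => ?_⟩
  have iu : Integrable (fun x => |u x| ^ p) (volume.restrict Ω) :=
    (integrable_norm_rpow_of_memLp hp0 hu.memLp).restrict
  have iB := integrable_bounded_mul_abs_rpow hp0 hu.memLp hBm (hBb n)
  have h1 := integral_mul_abs_rpow_add_le_energy hp hH hgap hu
  have hF : ∫ x in Ω, primitive f x (u x) ≤
      (∫ x in Ω, B n x * |u x| ^ p) / p + C₁ * (η * (∫ x in Ω, |u x| ^ p) + R * volume.real Ω) := by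
    have i3 : Integrable (fun x => B n x * |u x| ^ p / p) (volume.restrict Ω) := iB.div_const p
    have i5 : Integrable (fun x => η * |u x| ^ p + R) (volume.restrict Ω) :=
      (iu.const_mul η).add (integrable_const R)
    have i4 : Integrable (fun x => C₁ * (η * |u x| ^ p + R)) (volume.restrict Ω) := i5.const_mul C₁
    have := integral_mono_ae (hf.integrable_primitive hp hfin hu.memLp) (i3.add i4) (by
      filter_upwards [ae_restrict_of_ae hu0, hf.continuous_posExt, hgr, hf.strictAnti, hBb n]
        with x h0 hcont hg hanti hb
      have h2 : ∀ τ, 0 ≤ τ → f x τ ≤ B n x * τ ^ (p - 1) + C₁ := by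
        intro τ hτ
        rcases le_total τ T with h3 | h3
        · have a1 := (le_abs_self _).trans (hg τ hτ)
          have a2 : τ ^ (p - 1) ≤ T ^ (p - 1) := Real.rpow_le_rpow hτ h3 hp1.le
          have a3 := (abs_le.1 hb).1
          have a4 : 0 ≤ τ ^ (p - 1) := by positivity
          have a5 : -(2 * c * T ^ (p - 1)) ≤ B n x * τ ^ (p - 1) := by nlinarith
          have a6 : c * (1 + τ ^ (p - 1)) ≤ c * (1 + T ^ (p - 1)) := by gcongr
          simp only [hC₁]
          linarith
        · have hτ0 : 0 < τ := by linarith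
          have a1 := hanti.antitoneOn (mem_Ioi.2 (by linarith : 0 < T)) (mem_Ioi.2 hτ0) h3
          rw [div_le_iff₀ (by positivity)] at a1
          have a2 : f x τ ≤ B n x * τ ^ (p - 1) := a1
          linarith
      have h4 := primitive_le hp hcont h0 h2
      have h5 := mul_le_mul_of_nonneg_left (hR _ h0) hC₁0.le
      simp only [Pi.add_apply, abs_of_nonneg h0]
      linarith)
    refine this.trans (le_of_eq ?_)
    simp only [Pi.add_apply]
    rw [integral_add i3 i4, integral_div, integral_const_mul,
      integral_add (iu.const_mul η) (integrable_const R), integral_const_mul, integral_const,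
      smul_eq_mul, measureReal_restrict_apply_univ]
    ring
  have h6 : C₁ * (η * ∫ x in Ω, |u x| ^ p) = δ / p / 2 * ∫ x in Ω, |u x| ^ p := by
    rw [hη]; field_simp
  have h7 : (∫ x in Ω, B n x * |u x| ^ p) / p + δ / p * ∫ x in Ω, |u x| ^ p ≤
      energy Ω H p s u / p := by
    rw [le_div_iff₀ hp0]
    refine le_trans (le_of_eq ?_) h1
    field_simp
  unfold action
  have h8 : δ / p * ∫ x in Ω, |u x| ^ p =
      δ / p / 2 * (∫ x in Ω, |u x| ^ p) + δ / p / 2 * ∫ x in Ω, |u x| ^ p := by ring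
  linarith

/-- The direct method: the functional attains its minimum at a nonnegative function. -/
theorem exists_minimizer (hN : 1 ≤ N) (hp : 1 < p) (hs₀ : 0 < s) (hs₁ : s < 1)
    (hΩ : Bornology.IsBounded Ω) (hΩm : MeasurableSet Ω) (hH : IsFinslerMinkowskiNorm H)
    (hf : IsBrezisOswald Ω p f) (hβ : 0 < betaOne Ω H p s (aInfty p f)) :
    ∃ u, MemW01p Ω p u ∧ (∀ᵐ x, 0 ≤ u x) ∧
      ∀ w, MemW01p Ω p w → action Ω H p s f u ≤ action Ω H p s f w := by
  have hp0 : 0 < p := by linarith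
  have hfin : volume Ω ≠ ⊤ := hΩ.measure_lt_top.ne
  have hfin' : IsFiniteMeasure (volume.restrict Ω) := ⟨by simpa using hfin.lt_top⟩
  obtain ⟨δ, K, hδ, hco⟩ := exists_coercive hN hp hs₀ hs₁ hΩ hΩm hH hf hβ
  obtain ⟨c, hc, hgr⟩ := hf.growth
  set S : Set ℝ := {j | ∃ w, MemW01p Ω p w ∧ (∀ᵐ x, 0 ≤ w x) ∧ action Ω H p s f w = j} with hS
  have hSne : S.Nonempty := ⟨_, fun _ => 0, memW01p_zero hp.le, ae_of_all _ fun _ => le_rfl, rfl⟩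
  have hSb : BddBelow S := by
    refine ⟨-K, ?_⟩
    rintro _ ⟨w, hw, hw0, rfl⟩
    have h1 := hco w hw hw0
    have h2 : 0 ≤ δ * ∫ x in Ω, |w x| ^ p :=
      mul_nonneg hδ.le (integral_nonneg fun x => by positivity)
    linarith
  have hex : ∀ n : ℕ, ∃ w, MemW01p Ω p w ∧ (∀ᵐ x, 0 ≤ w x) ∧
      action Ω H p s f w < sInf S + 1 / ((n : ℝ) + 1) := by
    intro n
    obtain ⟨_, ⟨w, hw, hw0, rfl⟩, h⟩ := exists_lt_of_csInf_lt hSne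
      (show sInf S < sInf S + 1 / ((n : ℝ) + 1) by
        have : (0:ℝ) < 1 / ((n : ℝ) + 1) := by positivity
        linarith)
    exact ⟨w, hw, hw0, h⟩
  choose w hw hw0 hwJ using hex
  have hJb : ∀ n, action Ω H p s f (w n) ≤ sInf S + 1 := by
    intro n
    have h1 : 1 / ((n : ℝ) + 1) ≤ 1 := by
      rw [div_le_one (by positivity)]; simp
    linarith [hwJ n]
  have iw : ∀ n, Integrable (fun x => |w n x| ^ p) (volume.restrict Ω) := fun n =>
    (integrable_norm_rpow_of_memLp hp0 (hw n).memLp).restrict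
  set M₁ := (sInf S + 1 + K) / δ with hM₁
  have hm : ∀ n, ∫ x in Ω, |w n x| ^ p ≤ M₁ := by
    intro n
    rw [hM₁, le_div_iff₀ hδ]
    linarith [hco (w n) (hw n) (hw0 n), hJb n]
  set M₂ := p * (sInf S + 1 + 2 * c * (volume.real Ω + M₁)) with hM₂
  have hE : ∀ n, energy Ω H p s (w n) ≤ M₂ := by
    intro n
    have h1 : ∫ x in Ω, primitive f x (w n x) ≤ 2 * c * (volume.real Ω + M₁) := by
      have i1 : Integrable (fun x => 1 + |w n x| ^ p) (volume.restrict Ω) :=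
        (integrable_const (1:ℝ)).add (iw n)
      have := integral_mono_ae (hf.integrable_primitive hp hfin (hw n).memLp)
        (i1.const_mul (2 * c)) (by
          filter_upwards [hgr] with x hx using (le_abs_self _).trans (abs_primitive_le hp hc hx _))
      refine this.trans ?_
      rw [integral_const_mul, integral_add (integrable_const _) (iw n), integral_const, smul_eq_mul,
        mul_one, measureReal_restrict_apply_univ]
      have := hm n
      gcongr
    have h2 := hJb n
    unfold action at h2
    have h3 : energy Ω H p s (w n) / p ≤ sInf S + 1 + 2 * c * (volume.real Ω + M₁) := by linarith
    rw [div_le_iff₀ hp0] at h3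
    rw [hM₂]; linarith
  obtain ⟨θ, u, L, hθ, hu, hL, huL, hae, g, hg, hgb⟩ :=
    exists_subseq_energy_compact hN hp hs₀ hs₁ hΩ hΩm hH hw (M := max M₁ M₂)
      (fun n => (hm n).trans (le_max_left _ _)) (fun n => (hE n).trans (le_max_right _ _))
  have hu0 : ∀ᵐ x, 0 ≤ u x := by
    filter_upwards [hae, ae_all_iff.2 hw0] with x h1 h2
    exact ge_of_tendsto' h1 fun n => h2 _
  have tF : Tendsto (fun n => ∫ x in Ω, primitive f x (w (θ n) x)) atTop
      (𝓝 (∫ x in Ω, primitive f x (u x))) := by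
    refine tendsto_integral_of_dominated_convergence (fun x => 2 * c * (1 + g x))
      (fun n => (hf.integrable_primitive hp hfin (hw _).memLp).1)
      (((integrable_const (1:ℝ)).add hg.restrict).const_mul _) (fun n => ?_) ?_
    · filter_upwards [hgr, ae_restrict_of_ae hgb] with x h1 h2
      refine (abs_primitive_le hp hc h1 _).trans ?_
      have := h2 n
      gcongr
    · filter_upwards [hf.continuous_posExt, ae_restrict_of_ae hae] with x h1 h2
      exact ((hasDerivAt_primitive h1 (u x)).continuousAt.tendsto).comp h2
  have hJu : action Ω H p s f u ≤ sInf S := by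
    have t1 : Tendsto (fun n => action Ω H p s f (w (θ n))) atTop
        (𝓝 (L / p - ∫ x in Ω, primitive f x (u x))) := (hL.div_const p).sub tF
    have t2 : Tendsto (fun n => sInf S + 1 / ((θ n : ℝ) + 1)) atTop (𝓝 (sInf S + 0)) :=
      ((tendsto_one_div_add_atTop_nhds_zero_nat (𝕜 := ℝ)).comp hθ.tendsto_atTop).const_add _
    have h1 := le_of_tendsto_of_tendsto' t1 t2 fun n => (hwJ (θ n)).le
    have h2 : energy Ω H p s u / p ≤ L / p := by gcongr
    unfold action
    linarith
  refine ⟨u, hu, hu0, fun v hv => ?_⟩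
  refine hJu.trans ((csInf_le hSb ⟨_, hv.posPart hp, ae_of_all _ fun x => le_max_right _ _, rfl⟩).trans
    (action_posPart_le hN hp hs₀ hs₁ hfin hH hf hv))

/-- The functional takes a negative value when `β₁` for `a₀` is negative. -/
lemma exists_action_neg (hN : 1 ≤ N) (hp : 1 < p) (hs₀ : 0 < s) (hs₁ : s < 1)
    (hfin : volume Ω ≠ ⊤) (hΩm : MeasurableSet Ω) (hH : IsFinslerMinkowskiNorm H)
    (hf : IsBrezisOswald Ω p f) (hβ : betaOne Ω H p s (aZero p f) < 0) :
    ∃ v, MemW01p Ω p v ∧ action Ω H p s f v < 0 := by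
  have hp0 : 0 < p := by linarith
  obtain ⟨w, n, hw, hi, hlt⟩ := exists_energy_lt_of_betaOne_neg hp hfin hΩm hH hf hβ
  set T : ℝ := (n : ℝ) + 1 with hT
  have hT0 : 0 < T := by positivity
  have hab := (hw.abs hp).1
  have hv := (hab.const_mul hp.le T⁻¹).1
  refine ⟨fun x => T⁻¹ * |w x|, hv, ?_⟩
  have hE : energy Ω H p s (fun x => T⁻¹ * |w x|) ≤ (T ^ p)⁻¹ * energy Ω H p s w := by
    rw [energy_const_mul hp hH hab, abs_of_pos (by positivity), Real.inv_rpow hT0.le]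
    exact mul_le_mul_of_nonneg_left (energy_abs_le hN hp hs₀ hs₁ hH hw) (by positivity)
  have hF : (T ^ p)⁻¹ * (∫ x in Ω, f x (|w x| / T) * (T ^ (p - 1) * |w x|)) ≤
      p * ∫ x in Ω, primitive f x (T⁻¹ * |w x|) := by
    rw [← integral_const_mul, ← integral_const_mul]
    refine integral_mono_ae (hi.const_mul _)
      ((hf.integrable_primitive hp hfin hv.memLp).const_mul p) ?_
    filter_upwards [hf.continuous_posExt, hf.strictAnti, hf.apply_zero_nonneg] with x h1 h2 h3
    refine le_trans (le_of_eq ?_) (mul_le_mul_primitive hp h1 h2 h3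
      (by positivity : 0 ≤ T⁻¹ * |w x|))
    have e : T ^ p = T ^ (p - 1) * T := by
      rw [← Real.rpow_add_one hT0.ne']; ring_nf
    have h4 : 0 < T ^ (p - 1) := by positivity
    rw [show T⁻¹ * |w x| = |w x| / T by ring, e]
    field_simp
  have h1 : (T ^ p)⁻¹ * energy Ω H p s w <
      (T ^ p)⁻¹ * (∫ x in Ω, f x (|w x| / T) * (T ^ (p - 1) * |w x|)) :=
    mul_lt_mul_of_pos_left hlt (by positivity)
  have h2 : energy Ω H p s (fun x => T⁻¹ * |w x|) / p < ∫ x in Ω, primitive f x (T⁻¹ * |w x|) := by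
    rw [div_lt_iff₀ hp0]
    linarith
  unfold action
  linarith

lemma hasDerivAt_integral_primitive (hp : 1 < p) (hfin : volume Ω ≠ ⊤)
    (hf : IsBrezisOswald Ω p f) {φ : EuclideanSpace ℝ (Fin N) → ℝ}
    (hu : MemLp u (ENNReal.ofReal p) volume) (hφ : MemLp φ (ENNReal.ofReal p) volume) :
    HasDerivAt (fun t : ℝ => ∫ x in Ω, primitive f x (u x + t * φ x))
      (∫ x in Ω, posExt f x (u x) * φ x) 0 := by
  have hp0 : 0 < p := by linarith
  have hp1 : 0 ≤ p - 1 := by linarith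
  have hfin' : IsFiniteMeasure (volume.restrict Ω) := ⟨by simpa using hfin.lt_top⟩
  obtain ⟨c, hc, hgr⟩ := hf.growth
  have iu := (integrable_norm_rpow_of_memLp hp0 hu).restrict (s := Ω)
  have iφ := (integrable_norm_rpow_of_memLp hp0 hφ).restrict (s := Ω)
  have iφ1 : Integrable φ (volume.restrict Ω) :=
    (hφ.restrict Ω).integrable (by simpa using ENNReal.ofReal_le_ofReal hp.le)
  have hlin : ∀ t : ℝ, MemLp (fun x => u x + t * φ x) (ENNReal.ofReal p) volume :=
    fun t => hu.add (hφ.const_mul t)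
  have h := hasDerivAt_integral_of_dominated_loc_of_deriv_le (μ := volume.restrict Ω)
    (F := fun t x => primitive f x (u x + t * φ x))
    (F' := fun t x => posExt f x (u x + t * φ x) * φ x) (x₀ := (0:ℝ)) (s := Metric.ball 0 1)
    (bound := fun x => c * (‖φ x‖ + 2 ^ p * (‖u x‖ ^ p + ‖φ x‖ ^ p)))
    (Metric.ball_mem_nhds _ one_pos)
    (Eventually.of_forall fun t => (hf.integrable_primitive hp hfin (hlin t)).1)
    (hf.integrable_primitive hp hfin (hlin 0))
    (hf.integrable_comp_mul hp hfin ((hlin 0).restrict Ω) (hφ.restrict Ω)).1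
    (by
      filter_upwards [hgr] with x hx t ht
      have ht' : |t| ≤ 1 := by
        have := Metric.mem_ball.1 ht
        rw [Real.dist_eq, sub_zero] at this
        exact this.le
      have h1 := abs_posExt_le hp hc hx (u x + t * φ x)
      have h2 : |u x + t * φ x| ≤ |u x| + |φ x| := by
        refine (abs_add_le _ _).trans ?_
        rw [abs_mul]
        have := mul_le_of_le_one_left (abs_nonneg (φ x)) ht'
        linarith
      rw [norm_mul, Real.norm_eq_abs, Real.norm_eq_abs]
      calc |posExt f x (u x + t * φ x)| * |φ x|
          ≤ c * (1 + (|u x| + |φ x|) ^ (p - 1)) * |φ x| := by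
            refine mul_le_mul_of_nonneg_right (h1.trans ?_) (abs_nonneg _)
            gcongr
        _ = c * (|φ x| + (|u x| + |φ x|) ^ (p - 1) * |φ x|) := by ring
        _ ≤ c * (|φ x| + 2 ^ p * (|u x| ^ p + |φ x| ^ p)) := by
            have := rpow_sub_one_mul_le hp.le (abs_nonneg (u x)) (abs_nonneg (φ x))
            gcongr
        _ = _ := by simp only [Real.norm_eq_abs])
    ((iφ1.norm.add ((iu.add iφ).const_mul _)).const_mul c)
    (by
      filter_upwards [hf.continuous_posExt] with x hx t ht
      have h1 : HasDerivAt (fun t : ℝ => u x + t * φ x) (φ x) t := by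
        simpa using ((hasDerivAt_id t).mul_const (φ x)).const_add (u x)
      exact (hasDerivAt_primitive hx _).comp t h1)
  simpa using h.2

/-- The Euler–Lagrange equation of a minimizer. -/
lemma weakForm_eq_of_minimizer (hN : 1 ≤ N) (hp : 1 < p) (hs₀ : 0 < s) (hs₁ : s < 1)
    (hfin : volume Ω ≠ ⊤) (hH : IsFinslerMinkowskiNorm H) (hf : IsBrezisOswald Ω p f)
    (hu : MemW01p Ω p u)
    (hmin : ∀ w, MemW01p Ω p w → action Ω H p s f u ≤ action Ω H p s f w)
    {φ : EuclideanSpace ℝ (Fin N) → ℝ} (hφ : MemW01p Ω p φ) :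
    weakForm Ω H p s u φ = ∫ x in Ω, posExt f x (u x) * φ x := by
  have hp0 : 0 < p := by linarith
  have hd : HasDerivAt (fun t : ℝ => action Ω H p s f (fun x => u x + t * φ x))
      (p * weakForm Ω H p s u φ / p - ∫ x in Ω, posExt f x (u x) * φ x) 0 :=
    ((hasDerivAt_energy hN hp hs₀ hs₁ hH hu hφ).div_const p).sub
      (hasDerivAt_integral_primitive hp hfin hf hu.memLp hφ.memLp)
  have hm : IsLocalMin (fun t : ℝ => action Ω H p s f (fun x => u x + t * φ x)) 0 := by
    refine Eventually.of_forall fun t => ?_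
    have h1 := hmin (fun x => u x + t * φ x) (by
      simpa using (hu.lin_comb hφ hp.le 1 t).1)
    simpa using h1
  have h0 := hm.hasDerivAt_eq_zero hd
  rw [mul_div_cancel_left₀ _ hp0.ne'] at h0
  linarith

/-- Existence of a positive weak solution under the eigenvalue conditions. -/
theorem exists_weakSolution (hN : 1 ≤ N) (hp : 1 < p) (hs₀ : 0 < s) (hs₁ : s < 1)
    (hΩ : Bornology.IsBounded Ω) (hΩo : IsOpen Ω) (hH : IsFinslerMinkowskiNorm H)
    (hf : IsBrezisOswald Ω p f) (hβ₀ : betaOne Ω H p s (aZero p f) < 0)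
    (hβ : 0 < betaOne Ω H p s (aInfty p f)) :
    ∃ u, IsWeakSolution Ω H p s f u ∧ ∀ᵐ x ∂volume.restrict Ω, 0 < u x := by
  have hp0 : 0 < p := by linarith
  have hp1 : 0 < p - 1 := by linarith
  have hΩm := hΩo.measurableSet
  have hfin : volume Ω ≠ ⊤ := hΩ.measure_lt_top.ne
  obtain ⟨u, hu, hu0, hmin⟩ := exists_minimizer hN hp hs₀ hs₁ hΩ hΩm hH hf hβ
  obtain ⟨v, hv, hvneg⟩ := exists_action_neg hN hp hs₀ hs₁ hfin hΩm hH hf hβ₀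
  have hJ : action Ω H p s f u < 0 := (hmin v hv).trans_lt hvneg
  have hnt : 0 < volume {x ∈ Ω | 0 < u x} := by
    rw [pos_iff_ne_zero]
    intro h0
    have h1 : ∀ᵐ x ∂volume.restrict Ω, u x = 0 := by
      have h2 : ∀ᵐ x, ¬(x ∈ Ω ∧ 0 < u x) := by rw [ae_iff]; simpa using h0
      rw [ae_restrict_iff' hΩm]
      filter_upwards [h2, hu0] with x h3 h4 h5
      by_contra hne
      exact h3 ⟨h5, lt_of_le_of_ne h4 (Ne.symm hne)⟩
    have h2 : ∫ x in Ω, primitive f x (u x) = 0 := by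
      rw [integral_congr_ae (g := fun _ => (0:ℝ))]
      · simp
      · filter_upwards [h1] with x hx
        rw [hx, primitive_zero]
    have h3 : 0 ≤ energy Ω H p s u / p := div_nonneg (energy_nonneg hH) hp0.le
    unfold action at hJ
    linarith
  have heqn : ∀ φ, MemW01p Ω p φ → weakForm Ω H p s u φ = ∫ x in Ω, f x (u x) * φ x := by
    intro φ hφ
    rw [weakForm_eq_of_minimizer hN hp hs₀ hs₁ hfin hH hf hu hmin hφ]
    refine integral_congr_ae ?_
    filter_upwards [ae_restrict_of_ae hu0] with x hx
    rw [posExt_of_nonneg _ _ hx]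
  refine ⟨u, ⟨hu, ae_restrict_of_ae hu0, hnt, heqn⟩, ?_⟩
  obtain ⟨c, hc, -, A, -, hAq⟩ := hf.exists_aInfty hp
  refine ae_pos_of_supersolution hN hp hs₀ hs₁ hΩ hΩo hH hu hu0 hnt (c := c) (fun φ hφ hφ0 => ?_) hc.le
  refine ⟨fun x => f x (u x) * φ x, ?_, ?_, heqn φ hφ⟩
  · refine (hf.integrable_comp_mul hp hfin (hu.memLp.restrict Ω) (hφ.memLp.restrict Ω)).congr ?_
    filter_upwards [ae_restrict_of_ae hu0] with x hx
    rw [posExt_of_nonneg _ _ hx]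
  · filter_upwards [ae_restrict_of_ae hu0, hAq, hf.apply_zero_nonneg] with x h0 hAx hf0
    have h1 : -(c * u x ^ (p - 1)) ≤ f x (u x) := by
      rcases h0.eq_or_lt with h | h
      · rw [← h, Real.zero_rpow hp1.ne']; linarith
      · have h2 := hAx.2.2.1 (u x) h
        have h3 : 0 < u x ^ (p - 1) := by positivity
        rw [lt_div_iff₀ h3] at h2
        have h4 := (abs_le.1 hAx.2.1).1
        nlinarith
    have := mul_le_mul_of_nonneg_right h1 (hφ0 x)
    linarith

end Existence

end

end MixedBO

theorem theorem2 {N : ℕ} (hN : 2 ≤ N) {p s : ℝ} (hp : 1 < p) (hs₀ : 0 < s) (hs₁ : s < 1)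
    {Ω : Set (EuclideanSpace ℝ (Fin N))} (hΩ : MixedBO.IsBoundedC1Domain Ω)
    {H : EuclideanSpace ℝ (Fin N) → ℝ} (hH : MixedBO.IsFinslerMinkowskiNorm H)
    {f : EuclideanSpace ℝ (Fin N) → ℝ → ℝ} (hf : MixedBO.IsBrezisOswald Ω p f) :
    (∃ u : EuclideanSpace ℝ (Fin N) → ℝ,
      MixedBO.IsWeakSolution Ω H p s f u ∧ ∀ᵐ x ∂volume.restrict Ω, 0 < u x) ↔
    MixedBO.betaOne Ω H p s (MixedBO.aZero p f) < 0 ∧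
      0 < MixedBO.betaOne Ω H p s (MixedBO.aInfty p f) := by
  have hN1 : 1 ≤ N := by omega
  have hΩm := hΩ.isOpen.measurableSet
  have hfin : volume Ω ≠ ⊤ := hΩ.isBounded.measure_lt_top.ne
  constructor
  · rintro ⟨u, hu, hpos⟩
    exact ⟨hu.betaOne_aZero_neg hp hΩm hfin hH hf hpos,
      hu.betaOne_aInfty_pos hN1 hp hs₀ hs₁ hΩ.isBounded hΩm hH hf hpos⟩
  · rintro ⟨h0, h1⟩
    exact MixedBO.exists_weakSolution hN1 hp hs₀ hs₁ hΩ.isBounded hΩ.isOpen hH hf h0 h1
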